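/- Let $n\ge 4$. **Young walls.** The pattern of type $D_n$ is the quadrant tiled by unit squares in columns $0,1,2,\dots$ (left to right) and rows $0,1,2,\dots$ (bottom to top). In the rows whose index is divisible by $n-2$ each square is cut by its diagonal from bottom left to top right into two half-blocks (upper left and lower right); in the other rows each square is one full block. From bottom to top the labels in a column are $0/1,\,2,\dots,n-2,\,(n-1)/n,\,n-2,\dots,2,\,0/1,\dots$, repeated with period $2n-4$. In even columns the upper left half-blocks carry $0$ resp. $n-1$ and the lower right ones $1$ resp. $n$; in odd columns this is reversed. The lower right half-blocks of row $0$ are grey, all other blocks are white. A Young wall is a set $Y$ of blocks that contains all grey half-blocks and finitely many white blocks, such that: no block lies on top of a missing block or half-block; if a block is in $Y$, so is the block of the same row and the same shape in the column directly to its left; and no two full columns have the same height. Here a column is full if its top is a full block or a pair of half-blocks, and its height is its number of white blocks and half-blocks. Let $\mathcal Z_\Delta$ be the set of Young walls, let $wt_j(Y)$ be the number of white blocks of $Y$ with label $j$, and $\mathbf q^{\mathbf{wt}(Y)}=\prod_{j=0}^n q_j^{wt_j(Y)}$. A bar is a connected set of white blocks (two blocks being adjacent if the closed unit squares containing them meet)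 in which each of the labels $0,1,n-1,n$ occurs once and each of the labels $2,\dots,n-2$ occurs twice. A Young wall $Y$ is a core if there is no bar $S\subseteq Y$ such that $Y\setminus S$ is a Young wall. Let $\mathcal C_\Delta$ be the set of cores, and $$q=q_0q_1q_2^2\cdots q_{n-2}^2q_{n-1}q_n .$$ **Coordinates of cores.** Each column of $Y$ of height $s>0$ gives a bead at position $s$. Beads of full columns are uncoloured. The bead of a non-full column $C$ is white if the half-block at its top is lower right and the number of full columns shorter than $C$ is even, or it is upper left and that number is odd; otherwise it is black. For $1\le k<2n-2$ with $k\neq n-1$, the ruler $R_k$ is the set of positions congruent to $k$ modulo $2n-2$. For $z\in\mathbb Z$ put $p(z)=2z$ if $z\ge 0$ and $p(z)=-2z-1$ if $z<0$. A core $Y$ has coordinates $(z_1,\dots,z_n)\in\mathbb Z^n$ if * for $1\le s\le n-2$, $z_s$ is the number of beads on $R_s$ minus the number of beads on $R_{2n-2-s}$; * with $\alpha_i=\max(p(z_{n-1})-i,0)$ and $\beta_i=\max(p(z_n)-i,0)$, the coloured beads are exactly the following: for each $i\ge 0$ with $\alpha_i+\beta_i>0$, one bead at position $(n-1)(\alpha_i+\beta_i)$,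 black if $\beta_i$ is odd and white if $\beta_i$ is even. For integers $1\le l$ and $r\le n-2$ write $z_l+\dots+z_r=2a_{l\dots r}-b_{l\dots r}$ with $a_{l\dots r}\in\mathbb Z$, $b_{l\dots r}\in\{0,1\}$, and $c_{l\dots r}=2b_{l\dots r}-1$ (so for the empty sum $a=b=0$, $c=-1$). Define $(z_1,\dots,z_n)\mapsto(m_1,\dots,m_n)$ by $$m_i=-2a_{1\dots i-1}+c_{1\dots i-1}\,b_{i\dots n-2}-c_{1\dots n-2}(z_{n-1}+z_n)\quad(1\le i\le n-2),$$ $$m_i=-a_{1\dots n-2}-c_{1\dots n-2}\,z_i\quad(i=n-1,n).$$ **Theorem.** Let $C$ be the Cartan matrix of type $D_n$. 1. Every core has unique coordinates, $Y\mapsto(z_1,\dots,z_n)$ is a bijection $\mathcal C_\Delta\to\mathbb Z^n$, and $(z_1,\dots,z_n)\mapsto(m_1,\dots,m_n)$ is a bijection $\mathbb Z^n\to\mathbb Z^n$. If the core $Y$ corresponds to $\mathbf m=(m_1,\dots,m_n)$ under their composition, then $$\mathbf q^{\mathbf{wt}(Y)}=q_1^{m_1}\cdots q_n^{m_n}\,(q^{1/2})^{\mathbf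 m^\top C\,\mathbf m}.$$ 2. All the exponents of $q_0,\dots,q_n$ in the terms $q_1^{m_1}\cdots q_n^{m_n}(q^{1/2})^{\mathbf m^\top C\mathbf m}$, $\mathbf m\in\mathbb Z^n$, are non-negative integers, and in $\mathbb Z[[q_0,\dots,q_n]]$ (all sums and products converging coefficientwise) $$Z_\Delta(q_0,\dots,q_n)=\sum_{Y\in\mathcal Z_\Delta}\mathbf q^{\mathbf{wt}(Y)}=\frac{\displaystyle\sum_{\mathbf m\in\mathbb Z^n}q_1^{m_1}\cdots q_n^{m_n}(q^{1/2})^{\mathbf m^\top C\,\mathbf m}}{\displaystyle\prod_{m=1}^\infty(1-q^m)^{n+1}} .$$ 3. For every $(z_1,\dots,z_n)\in\mathbb Z^n$ with image $(m_1,\dots,m_n)$, $$\sum_{i=1}^n m_i=-\sum_{i=1}^{n-2}(n-1-i)z_i-(n-1)c\,(z_{n-1}+z_n)-(n-1)b,$$ where $z_1+\dots+z_{n-2}=2a-b$ with $a\in\mathbb Z$, $b\in\{0,1\}$, and $c=2b-1$. -/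

import Mathlib

open scoped MvPowerSeries.WithPiTopology

noncomputable section

namespace DnWall

/-! ### The Young wall pattern of type `D_n` -/

/-- The shapes of blocks: a full unit square, or one of the two triangles into which the
main diagonal (from bottom left to top right) cuts a unit square. -/
inductive Piece where
  | full
  | upper
  | lower

/-- A block: its column (counted from the left, from `0`), its row (counted from the bottom,
from `0`) and its shape. -/
structure Block where
  col : ℕ
  row : ℕ
  piece : Piece

/-- The blocks of the pattern of type `D_n`: the rows whose index is a multiple of `n - 2`
consist of half-blocks, the other rows of full blocks. -/
def InPattern (n : ℕ) (B : Block) : Prop :=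
  B.piece = Piece.full ↔ ¬ (n - 2) ∣ B.row

/-- The grey half-blocks: the lower right half-blocks of the bottom row. -/
def IsGrey (B : Block) : Prop :=
  B.row = 0 ∧ B.piece = Piece.lower

open Classical in
/-- The label of a block, periodic in the row with period `2n - 4`. From the bottom, the labels
in a column are `0/1, 2, …, n-2, (n-1)/n, n-2, …, 2, 0/1, 2, …`. In the even columns the upper
left half-blocks are labelled `0` and `n - 1`, the lower right ones `1` and `n`; in the odd
columns it is the other way round. -/
def label (n : ℕ) (B : Block) : ℕ :=
  let r := B.row % (2 * n - 4)
  if r = 0 then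
    if (Even B.col ↔ B.piece = Piece.upper) then 0 else 1
  else if r = n - 2 then
    if (Even B.col ↔ B.piece = Piece.upper) then n - 1 else n
  else if r < n - 2 then r + 1
  else 2 * n - 3 - r

/-! ### Young walls -/

/-- The number of white (i.e. not grey) blocks and half-blocks in the column `c` of `Y`. -/
def height (Y : Set Block) (c : ℕ) : ℕ :=
  {B | B ∈ Y ∧ ¬ IsGrey B ∧ B.col = c}.ncard

/-- The column `c` of `Y` consists of complete unit squares. For a column without gaps this
says that it has a full block or both half-blocks at its top. -/
def IsFullColumn (n : ℕ) (Y : Set Block) (c : ℕ) : Prop :=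
  ∀ B ∈ Y, B.col = c → ∀ B', InPattern n B' → B'.col = c → B'.row = B.row → B' ∈ Y

/-- The (proper) Young walls of type `D_n`. -/
structure IsYoungWall (n : ℕ) (Y : Set Block) : Prop where
  subset_pattern : ∀ B ∈ Y, InPattern n B
  grey_mem : ∀ B, IsGrey B → B ∈ Y
  finite_white : {B | B ∈ Y ∧ ¬ IsGrey B}.Finite
  /-- no block is placed on top of a missing block or half-block -/
  supported : ∀ B ∈ Y, ∀ B', InPattern n B' → B'.col = B.col → B'.row + 1 = B.row → B' ∈ Y
  /-- no free positions to the left of a block; the two orientations of half-blocks in a row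
  are treated as two parallel rows -/
  left_closed : ∀ B ∈ Y, ∀ B' : Block, B'.col + 1 = B.col → B'.row = B.row →
    B'.piece = B.piece → B' ∈ Y
  /-- no two full columns have the same height -/
  proper : ∀ c c', IsFullColumn n Y c → IsFullColumn n Y c' → height Y c = height Y c' → c = c'

/-- The set of Young walls of type `D_n`, as a type. -/
abbrev YoungWall (n : ℕ) : Type := {Y : Set Block // IsYoungWall n Y}

/-- The multi-weight: the numbers of white blocks of each label `0, …, n`. -/
def weight (n : ℕ) (Y : Set Block) : Fin (n + 1) →₀ ℕ :=
  Finsupp.equivFunOnFinite.symm fun j => {B | B ∈ Y ∧ ¬ IsGrey B ∧ label n B = j}.ncard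

/-! ### Bars and cores -/

/-- The multi-weight `(1, 1, 2, …, 2, 1, 1)` of a bar. -/
def barWeight (n : ℕ) (j : Fin (n + 1)) : ℕ :=
  if 2 ≤ (j : ℕ) ∧ (j : ℕ) + 2 ≤ n then 2 else 1

/-- Two blocks touch if the (closed) unit squares in which they lie meet. -/
def Touch (B B' : Block) : Prop :=
  B.col ≤ B'.col + 1 ∧ B'.col ≤ B.col + 1 ∧ B.row ≤ B'.row + 1 ∧ B'.row ≤ B.row + 1

/-- Connectedness of a set of blocks, through chains of touching blocks. -/
def IsConnectedSet (S : Set Block) : Prop :=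
  ∀ B ∈ S, ∀ B' ∈ S, Relation.ReflTransGen (fun x y => x ∈ S ∧ y ∈ S ∧ Touch x y) B B'

/-- A bar: a connected set of blocks and half-blocks in which each half-block label
`0, 1, n-1, n` occurs once and each full block label `2, …, n-2` occurs twice. -/
def IsBar (n : ℕ) (S : Set Block) : Prop :=
  (∀ B ∈ S, InPattern n B ∧ ¬ IsGrey B) ∧ IsConnectedSet S ∧
    ∀ j : Fin (n + 1), {B | B ∈ S ∧ label n B = j}.ncard = barWeight n j

/-- A core Young wall: no bar can be removed without violating the Young wall rules. -/
def IsCore (n : ℕ) (Y : Set Block) : Prop :=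
  IsYoungWall n Y ∧ ¬ ∃ S, S ⊆ Y ∧ IsBar n S ∧ IsYoungWall n (Y \ S)

/-- The set of core Young walls of type `D_n`, as a type. -/
abbrev CoreWall (n : ℕ) : Type := {Y : Set Block // IsCore n Y}

/-! ### The abacus -/

/-- The number of full columns shorter than the column `c`. -/
def shorterFull (n : ℕ) (Y : Set Block) (c : ℕ) : ℕ :=
  {c' | IsFullColumn n Y c' ∧ height Y c' < height Y c}.ncard

/-- The column `c` ends in a single half-block, of lower right shape (the grey ones are excluded). -/
def EndsInLower (Y : Set Block) (c : ℕ) : Prop :=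
  ∃ r, 0 < r ∧ Block.mk c r Piece.lower ∈ Y ∧ Block.mk c r Piece.upper ∉ Y

/-- The column `c` ends in a single half-block, of upper left shape. -/
def EndsInUpper (Y : Set Block) (c : ℕ) : Prop :=
  ∃ r, 0 < r ∧ Block.mk c r Piece.upper ∈ Y ∧ Block.mk c r Piece.lower ∉ Y

/-- The column `c` gives a white bead. -/
def IsWhiteColumn (n : ℕ) (Y : Set Block) (c : ℕ) : Prop :=
  (EndsInLower Y c ∧ Even (shorterFull n Y c)) ∨ (EndsInUpper Y c ∧ Odd (shorterFull n Y c))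

/-- The column `c` gives a black bead. -/
def IsBlackColumn (n : ℕ) (Y : Set Block) (c : ℕ) : Prop :=
  (EndsInUpper Y c ∧ Even (shorterFull n Y c)) ∨ (EndsInLower Y c ∧ Odd (shorterFull n Y c))

/-- The number of uncoloured beads on the ruler `R_k` of the abacus with `2n - 2` rulers,
where `1 ≤ k < 2n - 2`. -/
def rulerBeads (n : ℕ) (Y : Set Block) (k : ℕ) : ℕ :=
  {c | IsFullColumn n Y c ∧ height Y c % (2 * n - 2) = k}.ncard

/-- The number of white beads at the position `s`. -/
def whiteBeads (n : ℕ) (Y : Set Block) (s : ℕ) : ℕ :=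
  {c | IsWhiteColumn n Y c ∧ height Y c = s}.ncard

/-- The number of black beads at the position `s`. -/
def blackBeads (n : ℕ) (Y : Set Block) (s : ℕ) : ℕ :=
  {c | IsBlackColumn n Y c ∧ height Y c = s}.ncard

/-! ### The coordinates of a core -/

/-- The `k`-th coordinate of `(z_1, …, z_n)`, with `k` counted from `1`. -/
def coord {n : ℕ} (z : Fin n → ℤ) (k : ℕ) : ℤ :=
  if h : 1 ≤ k ∧ k ≤ n then z ⟨k - 1, by omega⟩ else 0

/-- The bijection between integers and pyramids `(p, p-1, …, 2, 1)`: the size `p` of the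
longest row of the pyramid of `z` is `2z` for `z ≥ 0` and `-2z - 1` for `z < 0`, so that the
pyramid has `2z² + z` boxes. -/
def pyramid (z : ℤ) : ℕ :=
  if 0 ≤ z then (2 * z).toNat else (-2 * z - 1).toNat

/-- The core Young wall `Y` has coordinates `z`. For `1 ≤ s ≤ n - 2`, `z_s` is the number of beads
on `R_s` minus the number of beads on `R_{2n-2-s}`. The coloured beads encode the pair of
pyramids of `z_{n-1}` and `z_n`, with rows `p - i` and `p' - i` for `i = 0, 1, …` (truncated
at `0`): for each `i` with a positive sum of the two rows there is one bead at the position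
`(n-1)((p-i) + (p'-i))`, black if `p' - i` is odd and white if it is even. -/
def HasCoordinates (n : ℕ) (Y : Set Block) (z : Fin n → ℤ) : Prop :=
  (∀ s ∈ Finset.Icc 1 (n - 2),
    coord z s = (rulerBeads n Y s : ℤ) - (rulerBeads n Y (2 * n - 2 - s) : ℤ)) ∧
  ∀ u : ℕ, 0 < u →
    blackBeads n Y ((n - 1) * u) =
      {i : ℕ | (pyramid (coord z (n - 1)) - i) + (pyramid (coord z n) - i) = u ∧
        Odd (pyramid (coord z n) - i)}.ncard ∧
    whiteBeads n Y ((n - 1) * u) =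
      {i : ℕ | (pyramid (coord z (n - 1)) - i) + (pyramid (coord z n) - i) = u ∧
        Even (pyramid (coord z n) - i)}.ncard

/-! ### The change of coordinates on `ℤ^n` -/

/-- `b ∈ {0, 1}` in the decomposition `x = 2a - b`. -/
def bPart (x : ℤ) : ℤ := x % 2

/-- `a` in the decomposition `x = 2a - b` with `b ∈ {0, 1}`. -/
def aPart (x : ℤ) : ℤ := (x + bPart x) / 2

/-- `c = 2b - 1`. -/
def cPart (x : ℤ) : ℤ := 2 * bPart x - 1

/-- `z_l + … + z_r`. -/
def zSum {n : ℕ} (z : Fin n → ℤ) (l r : ℕ) : ℤ := ∑ i ∈ Finset.Icc l r, coord z i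

/-- The integral change of coordinates `(z_1, …, z_n) ↦ (m_1, …, m_n)`. -/
def latticeChange (n : ℕ) (z : Fin n → ℤ) : Fin n → ℤ := fun j =>
  let i : ℕ := j + 1
  if i ≤ n - 2 then
    -2 * aPart (zSum z 1 (i - 1)) + cPart (zSum z 1 (i - 1)) * bPart (zSum z i (n - 2))
      - cPart (zSum z 1 (n - 2)) * (coord z (n - 1) + coord z n)
  else
    -aPart (zSum z 1 (n - 2)) - cPart (zSum z 1 (n - 2)) * coord z i

/-! ### Theta exponents and the variable `q` -/

/-- The exponent of `q_i` in `q_1^{m_1} ⋯ q_n^{m_n} (q^{1/2})^{mᵀ C m}`, with `C` the Cartan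
matrix of type `D_n` and `q = q_0 q_1 q_2² ⋯ q_{n-2}² q_{n-1} q_n`. -/
def thetaExponent (n : ℕ) (m : Fin n → ℤ) (i : Fin (n + 1)) : ℚ :=
  (coord m i : ℚ) + (barWeight n i : ℚ) * ((m ⬝ᵥ (CartanMatrix.D n).mulVec m : ℤ) : ℚ) / 2

/-- `q = q_0 q_1 q_2² ⋯ q_{n-2}² q_{n-1} q_n` as a formal power series. -/
def qSeries (n : ℕ) : MvPowerSeries (Fin (n + 1)) ℤ :=
  ∏ i, MvPowerSeries.X i ^ barWeight n i

end DnWall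

end

/-!
A Young wall is determined by the numbers `N x` of columns of height at least `x` and by the shape
of the single half-blocks that end the columns of height `u (n - 1)`, which is the same for all of
these columns (`isYoungWall_wall`, `IsYoungWall.exists_profile`). The heights can be written as the
absolute values of a set of signed *beads* `D ⊂ ℤ` with residues `0, …, n - 1` modulo `2 n - 2`,
together with pairs of beads at the multiples of `n - 1`, counted by `κ`: at a height that is not a
multiple of `n - 1`, at most one column ends, and the residue determines the sign of its bead. At a
multiple of `n - 1` any number of columns may end. Their shape, compared with the parity of the
number of taller columns, gives the sign of the bead if their number is odd, and it tells whether
both signs occur if their number is even and positive. The bead `0` has no column, and is there to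
make the number of beads even. This is a bijection (`IsYoungWall.exists_beads`,
`beadWall_injective`).

Split by residues, `D` becomes `n` finite sets `E k ⊂ ℤ`. Each of them has a *charge*, the number of
its non-negative minus the number of its negative elements, and an *energy*, the sum of the absolute
values. Counting labels height by height shows that the multi-weight depends only on the charges and
on the total energy (`weight_beads`). Shifting the set of all elements of `E k`, read relative to
the negative integers, shows that a finite set is the same as its charge `z` and a set of charge
zero, and that the energy is `z (z - 1) / 2` plus the energy of the latter (`chargeEquiv`). The sum
of the charges is even, which makes the vectors of charges a lattice of type `D_n`; in a basis of
simple roots (`chargeOf`) the sum of the squares of the charges is the quadratic form of the Cartan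
matrix (`dotProduct_cartan`). So the Young walls are parametrized by `m ∈ ℤ^n` and an excitation,
consisting of `n` sets of charge zero and the partition `κ`, and the weight is the theta exponent of
`m` plus one copy of the weight of a bar for each unit of size of the excitation
(`weight_wallOf_eq`, `wallOf_bijective`). Sets of charge zero, like partitions, have the generating
series `∏ (1 - q ^ k)⁻¹` (`IsPartitionLike.tsum_mul_tprod`), which occurs `n + 1` times.

The walls without excitation, the *ground walls*, are cores, since no Young wall has the weight of a
ground wall minus that of a bar (`isCore_groundWall`). Conversely, if `κ` is not zero or some `E k`
does not have the least energy for its charge, then a pair of beads or a bead can move towards the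
origin, or a positive and a negative bead can annihilate. Each such move is the removal of a bar
(`not_isCore_beadWall`, `eq_groundWall_of_isCore`).

For the coordinates, the charges of `latticeChange n z` are computed: they are `z_k` in the residue
classes `1, …, n - 2`, and in the classes `0` and `n - 1` they are `z_{n-1} ± z_n` up to a sign and
a translation that depend on the parity of `z_1 + … + z_{n-2}` (`chargeOf_latticeChange`). The
rulers show the former charges (`rulerBeads_sub`). The coloured beads of a ground wall occupy
initial segments of the even and of the odd multiples of `n - 1`, and so do the sums of the rows of
two pyramids (`exists_pyramid_iff`); on both sides the colours follow the parity of the number of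
coloured beads further out (`isBlackSite_iff`, `pyramid_odd_iff`), and they match
(`site_groundWall`).
-/

noncomputable section

namespace DnWall

/-! ### Walls of given heights and shapes -/

section

/-- The half-blocks: `true` stands for the upper left one, `false` for the lower right one. -/
def halfPiece (b : Bool) : Piece := if b then Piece.upper else Piece.lower

lemma halfPiece_inj {a b : Bool} : halfPiece a = halfPiece b ↔ a = b := by
  cases a <;> cases b <;> simp [halfPiece]

lemma halfPiece_ne_full (b : Bool) : halfPiece b ≠ Piece.full := by
  cases b <;> simp [halfPiece]

lemma piece_cases (p : Piece) (b : Bool) :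
    p = Piece.full ∨ p = halfPiece b ∨ p = halfPiece (!b) := by
  cases p <;> cases b <;> simp [halfPiece]

/-- The height at which the row `r` of a column is completed. The grey half-block of row `0` does
not count, so the white half-blocks of a row `u (n - 2)` have the heights `u (n - 1)` and
`u (n - 1) + 1`, and only the latter for `u = 0`. -/
def rowPos (n r : ℕ) : ℕ := r + r / (n - 2) + 1

/-- The row that the `x`-th white block of a column belongs to. -/
def posRow (n x : ℕ) : ℕ := x - 1 - (x - 1) / (n - 1)

/-- The set of blocks with `N x` columns of height at least `x`, in which single half-blocks
at the top of a column in the row `u (n - 2)` have the shape `σ u`. A block is in the wall if its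
row is completed in its column, or if it is the first half-block of a row that is begun. -/
def wall (n : ℕ) (N : ℕ → ℕ) (σ : ℕ → Bool) : Set Block :=
  {B | InPattern n B ∧ (B.col < N (rowPos n B.row) ∨
    (B.piece = halfPiece (σ (B.row / (n - 2))) ∧
      (B.row = 0 ∨ B.col < N (rowPos n B.row - 1))))}

/-- The conditions on `N` and `σ` under which `wall n N σ` is a Young wall: `N x - N (x + 1)`
columns have height `x`, at most one if `x` is not a multiple of `n - 1`, and the first half-block
of row `0` is the grey lower right one. -/
structure IsProfile (n : ℕ) (N : ℕ → ℕ) (σ : ℕ → Bool) : Prop where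
  anti : Antitone N
  zero : ∃ X, N X = 0
  step : ∀ x, ¬ (n - 1) ∣ x → N x ≤ N (x + 1) + 1
  lower : σ 0 = false

/-- The `x`-th white block of the column `c`, if single half-blocks at the top have the
shapes `σ`. -/
def blk (n : ℕ) (σ : ℕ → Bool) (c x : ℕ) : Block :=
  ⟨c, posRow n x, if x % (n - 1) = 0 then halfPiece (σ (x / (n - 1)))
    else if x % (n - 1) = 1 then halfPiece (!σ (x / (n - 1))) else Piece.full⟩

variable {n : ℕ} {N : ℕ → ℕ} {σ : ℕ → Bool}

lemma pos_cases (hn : 4 ≤ n) {x : ℕ} (hx : 1 ≤ x) :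
    (∃ u, 1 ≤ u ∧ x = u * (n - 1)) ∨ (∃ j, x = j * (n - 1) + 1) ∨
      ∃ j t, 1 ≤ t ∧ t < n - 2 ∧ x = j * (n - 1) + t + 1 := by
  have h := Nat.div_add_mod' x (n - 1)
  have h2 := Nat.mod_lt x (show 0 < n - 1 by omega)
  rcases Nat.lt_or_ge (x % (n - 1)) 2 with h3 | h3
  · rcases Nat.lt_or_ge (x % (n - 1)) 1 with h4 | h4
    · left
      refine ⟨x / (n - 1), Nat.pos_of_ne_zero fun h5 => ?_, by omega⟩
      rw [h5, Nat.zero_mul] at h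
      omega
    · exact Or.inr (Or.inl ⟨x / (n - 1), by rw [show x % (n - 1) = 1 by omega] at h; exact h.symm⟩)
  · exact Or.inr (Or.inr ⟨x / (n - 1), x % (n - 1) - 1, by omega, by omega, by omega⟩)

lemma row_cases (hn : 4 ≤ n) (r : ℕ) :
    (∃ j, r = j * (n - 2)) ∨ ∃ j t, 1 ≤ t ∧ t < n - 2 ∧ r = j * (n - 2) + t := by
  have h := Nat.div_add_mod' r (n - 2)
  have h2 := Nat.mod_lt r (show 0 < n - 2 by omega)
  rcases Nat.eq_zero_or_pos (r % (n - 2)) with h3 | h3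
  · exact Or.inl ⟨r / (n - 2), by omega⟩
  · exact Or.inr ⟨r / (n - 2), r % (n - 2), h3, h2, h.symm⟩

lemma mul_add_div_of_lt {a j t : ℕ} (h : t < a) : (j * a + t) / a = j := by
  rw [Nat.mul_comm, Nat.mul_add_div (by omega), Nat.div_eq_of_lt h, Nat.add_zero]

lemma mul_add_mod_of_lt {a j t : ℕ} (h : t < a) : (j * a + t) % a = t := by
  rw [Nat.mul_comm, Nat.mul_add_mod, Nat.mod_eq_of_lt h]

lemma mul_pred_eq (hn : 4 ≤ n) (j : ℕ) : j * (n - 1) = j * (n - 2) + j := by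
  obtain ⟨m, rfl⟩ : ∃ m, n = m + 2 := ⟨n - 2, by omega⟩
  simp only [Nat.add_sub_cancel, show m + 2 - 1 = m + 1 from rfl]
  ring

lemma rowPos_half (hn : 4 ≤ n) (j : ℕ) : rowPos n (j * (n - 2)) = j * (n - 1) + 1 := by
  rw [rowPos, Nat.mul_div_cancel _ (by omega), mul_pred_eq hn]

lemma rowPos_full (hn : 4 ≤ n) (j : ℕ) {t : ℕ} (ht : t < n - 2) :
    rowPos n (j * (n - 2) + t) = j * (n - 1) + t + 1 := by
  rw [rowPos, mul_add_div_of_lt ht, mul_pred_eq hn]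
  omega

lemma posRow_of (hn : 4 ≤ n) (j : ℕ) {t : ℕ} (ht : t < n - 1) :
    posRow n (j * (n - 1) + t + 1) = j * (n - 2) + t := by
  rw [posRow, Nat.add_sub_cancel, mul_add_div_of_lt ht, mul_pred_eq hn]
  omega

lemma posRow_half (hn : 4 ≤ n) {u : ℕ} (hu : 1 ≤ u) : posRow n (u * (n - 1)) = u * (n - 2) := by
  obtain ⟨j, rfl⟩ : ∃ j, u = j + 1 := ⟨u - 1, by omega⟩
  have := posRow_of hn j (t := n - 2) (by omega)
  rw [show (j + 1) * (n - 1) = j * (n - 1) + (n - 2) + 1 by rw [Nat.succ_mul]; omega, this]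
  rw [Nat.succ_mul]

lemma blk_half (hn : 4 ≤ n) {u : ℕ} (hu : 1 ≤ u) (c : ℕ) :
    blk n σ c (u * (n - 1)) = ⟨c, u * (n - 2), halfPiece (σ u)⟩ := by
  simp [blk, posRow_half hn hu, Nat.mul_div_cancel _ (show 0 < n - 1 by omega)]

lemma blk_half_succ (hn : 4 ≤ n) (j c : ℕ) :
    blk n σ c (j * (n - 1) + 1) = ⟨c, j * (n - 2), halfPiece (!σ j)⟩ := by
  have := posRow_of hn j (t := 0) (by omega)
  simp only [Nat.add_zero] at this
  simp [blk, this, mul_add_div_of_lt (show 1 < n - 1 by omega),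
    mul_add_mod_of_lt (show 1 < n - 1 by omega)]

lemma blk_full (hn : 4 ≤ n) (j c : ℕ) {t : ℕ} (h1 : 1 ≤ t) (ht : t < n - 2) :
    blk n σ c (j * (n - 1) + t + 1) = ⟨c, j * (n - 2) + t, Piece.full⟩ := by
  rw [blk, posRow_of hn j (by omega), Nat.add_assoc, mul_add_mod_of_lt (by omega)]
  simp
  omega

lemma inPattern_half (c j : ℕ) (p : Piece) :
    InPattern n ⟨c, j * (n - 2), p⟩ ↔ p ≠ Piece.full := by
  simp [InPattern]

lemma not_dvd_row (j : ℕ) {t : ℕ} (h1 : 1 ≤ t) (ht : t < n - 2) :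
    ¬ (n - 2) ∣ j * (n - 2) + t := by
  rw [Nat.dvd_add_right (Dvd.intro_left _ rfl)]
  exact Nat.not_dvd_of_pos_of_lt h1 ht

lemma inPattern_full (c j : ℕ) (p : Piece) {t : ℕ} (h1 : 1 ≤ t) (ht : t < n - 2) :
    InPattern n ⟨c, j * (n - 2) + t, p⟩ ↔ p = Piece.full := by
  simp [InPattern, not_dvd_row j h1 ht]

lemma mem_wall_full (hn : 4 ≤ n) (c j : ℕ) (p : Piece) {t : ℕ} (h1 : 1 ≤ t) (ht : t < n - 2) :
    (⟨c, j * (n - 2) + t, p⟩ : Block) ∈ wall n N σ ↔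
      p = Piece.full ∧ c < N (j * (n - 1) + t + 1) := by
  simp only [wall, Set.mem_ofPred_eq, inPattern_full c j p h1 ht, rowPos_full hn j ht]
  constructor
  · rintro ⟨rfl, h | h⟩
    · exact ⟨rfl, h⟩
    · exact absurd h.1.symm (halfPiece_ne_full _)
  · exact fun h => ⟨h.1, Or.inl h.2⟩

lemma mem_wall_half (hn : 4 ≤ n) (c j : ℕ) (b : Bool) :
    (⟨c, j * (n - 2), halfPiece b⟩ : Block) ∈ wall n N σ ↔
      c < N (j * (n - 1) + 1) ∨ (b = σ j ∧ (j = 0 ∨ c < N (j * (n - 1)))) := by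
  have h0 : n - 2 ≠ 0 := by omega
  simp [wall, inPattern_half, halfPiece_ne_full, rowPos_half hn, halfPiece_inj, h0,
    Nat.mul_div_cancel _ (Nat.pos_of_ne_zero h0)]

lemma not_full_half_mem (c j : ℕ) :
    (⟨c, j * (n - 2), Piece.full⟩ : Block) ∉ wall n N σ := by
  simp [wall, inPattern_half]

lemma isGrey_half (hn : 4 ≤ n) (c j : ℕ) (b : Bool) :
    IsGrey ⟨c, j * (n - 2), halfPiece b⟩ ↔ j = 0 ∧ b = false := by
  have h0 : n - 2 ≠ 0 := by omega
  cases b <;> simp [IsGrey, halfPiece, h0]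

lemma not_isGrey_full (c r : ℕ) : ¬ IsGrey ⟨c, r, Piece.full⟩ := by simp [IsGrey]

/-- The white blocks of a wall are the first blocks of its columns, in the order of the
heights. -/
lemma white_wall (hn : 4 ≤ n) (h : Antitone N) (h0 : σ 0 = false) :
    {B | B ∈ wall n N σ ∧ ¬ IsGrey B} =
      (fun p : ℕ × ℕ => blk n σ p.1 p.2) '' {p | 1 ≤ p.2 ∧ p.1 < N p.2} := by
  ext ⟨c, r, p⟩
  constructor
  · rintro ⟨hB, hg⟩
    rcases row_cases hn r with ⟨j, rfl⟩ | ⟨j, t, h1, ht, rfl⟩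
    · rcases piece_cases p (σ j) with rfl | rfl | rfl
      · exact absurd hB (not_full_half_mem c j)
      · rw [mem_wall_half hn] at hB
        rw [isGrey_half hn] at hg
        have hj : 1 ≤ j := by
          by_contra hj
          have : j = 0 := by omega
          subst this
          exact hg ⟨rfl, h0⟩
        refine ⟨(c, j * (n - 1)), ⟨?_, ?_⟩, blk_half hn hj c⟩
        · exact Nat.mul_pos hj (by omega)
        · rcases hB with hB | ⟨-, hB | hB⟩
          · exact lt_of_lt_of_le hB (h (Nat.le_succ _))
          · omega
          · exact hB
      · rw [mem_wall_half hn] at hB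
        refine ⟨(c, j * (n - 1) + 1), ⟨Nat.le_add_left _ _, ?_⟩, blk_half_succ hn j c⟩
        rcases hB with hB | ⟨hB, -⟩
        · exact hB
        · simp at hB
    · rw [mem_wall_full hn c j p h1 ht] at hB
      obtain ⟨rfl, hB⟩ := hB
      exact ⟨(c, j * (n - 1) + t + 1), ⟨Nat.le_add_left _ _, hB⟩, blk_full hn j c h1 ht⟩
  · rintro ⟨⟨c', x⟩, ⟨hx, hc⟩, hB⟩
    simp only at hx hc hB
    rw [← hB]
    rcases pos_cases hn hx with ⟨u, hu, rfl⟩ | ⟨j, rfl⟩ | ⟨j, t, h1, ht, rfl⟩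
    · rw [blk_half hn hu, Set.mem_ofPred_eq, mem_wall_half hn, isGrey_half hn]
      exact ⟨Or.inr ⟨rfl, Or.inr hc⟩, by omega⟩
    · rw [blk_half_succ hn, Set.mem_ofPred_eq, mem_wall_half hn, isGrey_half hn]
      refine ⟨Or.inl hc, ?_⟩
      rintro ⟨rfl, h⟩
      simp [h0] at h
    · rw [blk_full hn j c' h1 ht, Set.mem_ofPred_eq, mem_wall_full hn _ _ _ h1 ht]
      exact ⟨⟨rfl, hc⟩, not_isGrey_full _ _⟩

lemma row_eq_iff {j j' t t' : ℕ} (ht : t < n - 2) (ht' : t' < n - 2) :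
    j * (n - 2) + t = j' * (n - 2) + t' ↔ j = j' ∧ t = t' := by
  refine ⟨fun h => ?_, by rintro ⟨rfl, rfl⟩; rfl⟩
  have h1 := congrArg (· / (n - 2)) h
  have h2 := congrArg (· % (n - 2)) h
  simp only [mul_add_div_of_lt ht, mul_add_div_of_lt ht', mul_add_mod_of_lt ht,
    mul_add_mod_of_lt ht'] at h1 h2
  exact ⟨h1, h2⟩

lemma blk_injOn (hn : 4 ≤ n) :
    Set.InjOn (fun p : ℕ × ℕ => blk n σ p.1 p.2) {p | 1 ≤ p.2} := by
  rintro ⟨c, x⟩ hx ⟨c', x'⟩ hx' h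
  simp only [Set.mem_ofPred_eq] at hx hx' h
  have hc : c = c' := congrArg Block.col h
  subst hc
  have hp : 0 < n - 2 := by omega
  rcases pos_cases hn hx with ⟨u, hu, rfl⟩ | ⟨j, rfl⟩ | ⟨j, t, h1, ht, rfl⟩ <;>
  rcases pos_cases hn hx' with ⟨u', hu', rfl⟩ | ⟨j', rfl⟩ | ⟨j', t', h1', ht', rfl⟩ <;>
  simp only [blk_half hn, blk_half_succ hn, blk_full hn, *, Block.mk.injEq, true_and] at h
  · rw [Nat.eq_of_mul_eq_mul_right hp h.1]
  · obtain rfl := Nat.eq_of_mul_eq_mul_right hp h.1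
    simp [halfPiece_inj] at h
  · exact absurd h.2 (halfPiece_ne_full _)
  · obtain rfl := Nat.eq_of_mul_eq_mul_right hp h.1
    simp [halfPiece_inj] at h
  · rw [Nat.eq_of_mul_eq_mul_right hp h.1]
  · exact absurd h.2 (halfPiece_ne_full _)
  · exact absurd h.2.symm (halfPiece_ne_full _)
  · exact absurd h.2.symm (halfPiece_ne_full _)
  · obtain ⟨rfl, rfl⟩ := (row_eq_iff ht ht').1 h.1
    rfl

end

/-! ### Young walls and their profiles -/

section

variable {n : ℕ} {N : ℕ → ℕ} {σ : ℕ → Bool}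

/-- The height of the column `c`, if `N x` columns have height at least `x`. -/
def colHeight (N : ℕ → ℕ) (c : ℕ) : ℕ := {x | 1 ≤ x ∧ c < N x}.ncard

lemma lt_iff_le_colHeight (h : Antitone N) (hz : ∃ X, N X = 0) {c x : ℕ} (hx : 1 ≤ x) :
    c < N x ↔ x ≤ colHeight N c := by
  classical
  have hex : ∃ y, N (y + 1) ≤ c := by
    obtain ⟨X, hX⟩ := hz
    exact ⟨X, by have := h (Nat.le_succ X); simp only [Nat.succ_eq_add_one] at this; omega⟩
  have key : ∀ y, 1 ≤ y → (c < N y ↔ y ≤ Nat.find hex) := by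
    intro y hy
    constructor
    · intro hc
      by_contra hlt
      have := h (show Nat.find hex + 1 ≤ y by omega)
      have := Nat.find_spec hex
      omega
    · intro hle
      have := Nat.find_min hex (m := y - 1) (by omega)
      rw [Nat.sub_add_cancel hy] at this
      omega
  have hset : {y | 1 ≤ y ∧ c < N y} = ↑(Finset.Icc 1 (Nat.find hex)) := by
    ext y
    simp only [Set.mem_ofPred_eq, Finset.coe_Icc, Set.mem_Icc]
    exact ⟨fun hy => ⟨hy.1, (key y hy.1).1 hy.2⟩, fun hy => ⟨hy.1, (key y hy.1).2 hy.2⟩⟩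
  rw [key x hx, colHeight, hset, Set.ncard_coe_finset]
  simp

lemma height_wall (hn : 4 ≤ n) (h : Antitone N) (h0 : σ 0 = false) (c : ℕ) :
    height (wall n N σ) c = colHeight N c := by
  have : {B | B ∈ wall n N σ ∧ ¬ IsGrey B ∧ B.col = c} =
      blk n σ c '' {x | 1 ≤ x ∧ c < N x} := by
    ext B
    have hw := Set.ext_iff.1 (white_wall (N := N) (σ := σ) hn h h0) B
    constructor
    · rintro ⟨h1, h2, rfl⟩
      obtain ⟨⟨c, x⟩, hx, rfl⟩ := hw.1 ⟨h1, h2⟩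
      exact ⟨x, hx, rfl⟩
    · rintro ⟨x, hx, rfl⟩
      have := hw.2 ⟨(c, x), hx, rfl⟩
      exact ⟨this.1, this.2, rfl⟩
  rw [height, this, colHeight, Set.InjOn.ncard_image]
  intro x hx y hy hxy
  have := blk_injOn (σ := σ) hn (show (c, x) ∈ {p : ℕ × ℕ | 1 ≤ p.2} from hx.1)
    (show (c, y) ∈ {p : ℕ × ℕ | 1 ≤ p.2} from hy.1) hxy
  exact congrArg Prod.snd this

lemma colHeight_eq_iff (h : Antitone N) (hz : ∃ X, N X = 0) {c s : ℕ} (hs : 1 ≤ s) :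
    colHeight N c = s ↔ N (s + 1) ≤ c ∧ c < N s := by
  rw [lt_iff_le_colHeight h hz hs, ← not_lt, lt_iff_le_colHeight h hz (by omega)]
  omega

lemma colHeight_eq_zero_iff (h : Antitone N) (hz : ∃ X, N X = 0) {c : ℕ} :
    colHeight N c = 0 ↔ N 1 ≤ c := by
  rw [← not_lt, lt_iff_le_colHeight h hz le_rfl]
  omega

lemma isFullColumn_wall (hn : 4 ≤ n) (h : Antitone N) (hz : ∃ X, N X = 0)
    (c : ℕ) : IsFullColumn n (wall n N σ) c ↔ ¬ (n - 1) ∣ colHeight N c := by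
  constructor
  · rintro hf ⟨u, hu⟩
    rw [mul_comm] at hu
    have hin : (⟨c, u * (n - 2), halfPiece (σ u)⟩ : Block) ∈ wall n N σ := by
      rw [mem_wall_half hn]
      refine Or.inr ⟨rfl, ?_⟩
      rcases Nat.eq_zero_or_pos u with hu0 | hu0
      · exact Or.inl hu0
      · right
        rw [lt_iff_le_colHeight h hz (Nat.mul_pos hu0 (by omega)), hu]
    have hout := hf _ hin rfl ⟨c, u * (n - 2), halfPiece (!σ u)⟩
      (by rw [inPattern_half]; exact halfPiece_ne_full _) rfl rfl
    rw [mem_wall_half hn, lt_iff_le_colHeight h hz (by omega), hu] at hout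
    simp at hout
  · rintro hd ⟨c', r, p⟩ hB hc ⟨c'', r', p'⟩ hB' hc' hr
    simp only at hc hc' hr
    subst hc hc' hr
    rcases row_cases hn r' with ⟨j, rfl⟩ | ⟨j, t, h1, ht, rfl⟩
    · have hlt : c'' < N (j * (n - 1) + 1) := by
        by_contra hlt
        apply hd
        rcases piece_cases p (σ j) with rfl | rfl | rfl
        · exact absurd hB (not_full_half_mem _ _)
        · rw [mem_wall_half hn] at hB
          rcases Nat.eq_zero_or_pos j with rfl | hj
          · rw [(colHeight_eq_zero_iff h hz).2 (by simpa using hlt)]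
            exact dvd_zero _
          · rw [(colHeight_eq_iff h hz (s := j * (n - 1)) (Nat.mul_pos hj (by omega))).2
              ⟨by omega, by omega⟩]
            exact Dvd.intro_left _ rfl
        · rw [mem_wall_half hn] at hB
          simp [hlt] at hB
      rcases piece_cases p' (σ j) with rfl | rfl | rfl
      · exact absurd rfl ((inPattern_half _ _ _).1 hB')
      · exact (mem_wall_half hn _ _ _).2 (Or.inl hlt)
      · exact (mem_wall_half hn _ _ _).2 (Or.inl hlt)
    · rw [inPattern_full _ _ _ h1 ht] at hB'
      rw [mem_wall_full hn _ _ _ h1 ht] at hB ⊢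
      exact ⟨hB', hB.2⟩

lemma rowPos_lt (r : ℕ) {r' : ℕ} (h : r' < r) : rowPos n r' ≤ rowPos n r - 1 := by
  have : r' / (n - 2) ≤ r / (n - 2) := Nat.div_le_div_right h.le
  simp only [rowPos]
  omega

lemma eq_of_full_of_colHeight (hN : IsProfile n N σ) {c c' : ℕ}
    (hd : ¬ (n - 1) ∣ colHeight N c) (he : colHeight N c = colHeight N c') : c = c' := by
  have hs : 1 ≤ colHeight N c := by
    by_contra h
    rw [show colHeight N c = 0 by omega] at hd
    exact hd (dvd_zero _)
  have h1 := (colHeight_eq_iff hN.anti hN.zero hs).1 rfl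
  have h2 := (colHeight_eq_iff hN.anti hN.zero hs).1 he.symm
  have := hN.step _ hd
  omega

lemma finite_white_wall (hn : 4 ≤ n) (h : Antitone N) (hz : ∃ X, N X = 0) (h0 : σ 0 = false) :
    {B | B ∈ wall n N σ ∧ ¬ IsGrey B}.Finite := by
  rw [white_wall hn h h0]
  obtain ⟨X, hX⟩ := hz
  refine Set.Finite.image _ ((Set.finite_Iio (N 0)).prod (Set.finite_Iio X) |>.subset ?_)
  rintro ⟨c, x⟩ ⟨-, hc⟩
  simp only at hc
  refine ⟨lt_of_lt_of_le hc (h (Nat.zero_le x)), ?_⟩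
  by_contra hx
  have := h (show X ≤ x by simpa using hx)
  omega

theorem isYoungWall_wall (hn : 4 ≤ n) (hN : IsProfile n N σ) : IsYoungWall n (wall n N σ) where
  subset_pattern := fun B hB => hB.1
  grey_mem := by
    rintro ⟨c, r, p⟩ ⟨hr, hp⟩
    simp only at hr hp
    subst hr hp
    have := (mem_wall_half (N := N) (σ := σ) hn c 0 false).2 (Or.inr ⟨hN.lower.symm, Or.inl rfl⟩)
    simpa [halfPiece] using this
  finite_white := finite_white_wall hn hN.anti hN.zero hN.lower
  supported := by
    rintro B hB B' hp hc hr
    refine ⟨hp, Or.inl ?_⟩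
    have h1 : B.col < N (rowPos n B.row - 1) := by
      rcases hB.2 with h | ⟨-, h | h⟩
      · exact lt_of_lt_of_le h (hN.anti (Nat.sub_le _ _))
      · omega
      · exact h
    rw [hc]
    exact lt_of_lt_of_le h1 (hN.anti (rowPos_lt _ (by omega)))
  left_closed := by
    rintro ⟨c, r, p⟩ hB ⟨c', r', p'⟩ hc hr hp
    simp only at hc hr hp
    subst hr hp hc
    refine ⟨hB.1, ?_⟩
    rcases hB.2 with h | ⟨h1, h | h⟩
    · exact Or.inl (lt_trans (Nat.lt_succ_self _) h)
    · exact Or.inr ⟨h1, Or.inl h⟩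
    · exact Or.inr ⟨h1, Or.inr (lt_trans (Nat.lt_succ_self _) h)⟩
  proper := by
    intro c c' hc hc' he
    rw [isFullColumn_wall hn hN.anti hN.zero] at hc
    rw [height_wall hn hN.anti hN.lower, height_wall hn hN.anti hN.lower] at he
    exact eq_of_full_of_colHeight hN hc he

/-- The columns of `Y` that contain `x` white blocks, if `Y` is a Young wall, read off from the row
that the `x`-th block belongs to: at `x = u (n - 1)` one half-block suffices, at the next height
both are needed. -/
def colSet (n : ℕ) (Y : Set Block) (x : ℕ) : Set ℕ :=
  {c | if x % (n - 1) = 0 then ∃ b, ⟨c, posRow n x, halfPiece b⟩ ∈ Y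
    else if x % (n - 1) = 1 then ∀ b, ⟨c, posRow n x, halfPiece b⟩ ∈ Y
    else ⟨c, posRow n x, Piece.full⟩ ∈ Y}

lemma mem_colSet_half (hn : 4 ≤ n) {Y : Set Block} {u : ℕ} (hu : 1 ≤ u) (c : ℕ) :
    c ∈ colSet n Y (u * (n - 1)) ↔ ∃ b, ⟨c, u * (n - 2), halfPiece b⟩ ∈ Y := by
  simp [colSet, posRow_half hn hu]

lemma mem_colSet_half_succ (hn : 4 ≤ n) {Y : Set Block} (j c : ℕ) :
    c ∈ colSet n Y (j * (n - 1) + 1) ↔ ∀ b, ⟨c, j * (n - 2), halfPiece b⟩ ∈ Y := by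
  have := posRow_of hn j (t := 0) (by omega)
  simp only [Nat.add_zero] at this
  simp [colSet, this, mul_add_mod_of_lt (show 1 < n - 1 by omega)]

lemma mem_colSet_full (hn : 4 ≤ n) {Y : Set Block} (j c : ℕ) {t : ℕ} (h1 : 1 ≤ t)
    (ht : t < n - 2) :
    c ∈ colSet n Y (j * (n - 1) + t + 1) ↔ ⟨c, j * (n - 2) + t, Piece.full⟩ ∈ Y := by
  rw [colSet, posRow_of hn j (by omega), Nat.add_assoc, mul_add_mod_of_lt (by omega)]
  simp [show t ≠ 0 by omega]

lemma mem_colSet_wall (hn : 4 ≤ n) (h : Antitone N) {x : ℕ} (hx : 1 ≤ x) (c : ℕ) :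
    c ∈ colSet n (wall n N σ) x ↔ c < N x := by
  rcases pos_cases hn hx with ⟨u, hu, rfl⟩ | ⟨j, rfl⟩ | ⟨j, t, h1, ht, rfl⟩
  · rw [mem_colSet_half hn hu]
    simp only [mem_wall_half hn, show u ≠ 0 by omega, false_or]
    constructor
    · rintro ⟨b, hb | hb⟩
      · exact lt_of_lt_of_le hb (h (Nat.le_succ _))
      · exact hb.2
    · exact fun hc => ⟨σ u, Or.inr ⟨rfl, hc⟩⟩
  · rw [mem_colSet_half_succ hn]
    simp only [mem_wall_half hn]
    constructor
    · intro hb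
      rcases hb (!σ j) with hb | hb
      · exact hb
      · simp at hb
    · exact fun hc b => Or.inl hc
  · rw [mem_colSet_full hn _ _ h1 ht, mem_wall_full hn _ _ _ h1 ht]
    simp

lemma profile_eq_of_wall_eq (hn : 4 ≤ n) {N' : ℕ → ℕ} {σ' : ℕ → Bool} (h : Antitone N)
    (h' : Antitone N') (he : wall n N σ = wall n N' σ') {x : ℕ} (hx : 1 ≤ x) : N x = N' x := by
  have : ∀ c, c < N x ↔ c < N' x := fun c => by
    rw [← mem_colSet_wall (σ := σ) hn h hx, he, mem_colSet_wall hn h' hx]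
  exact le_antisymm (le_of_not_gt fun hlt => lt_irrefl _ ((this _).1 hlt))
    (le_of_not_gt fun hlt => lt_irrefl _ ((this _).2 hlt))

lemma shape_eq_of_wall_eq (hn : 4 ≤ n) {N' : ℕ → ℕ} {σ' : ℕ → Bool} (h : Antitone N)
    (h' : Antitone N') (he : wall n N σ = wall n N' σ') {u : ℕ}
    (hlt : N (u * (n - 1) + 1) < N (u * (n - 1))) : σ u = σ' u := by
  have hin : (⟨N (u * (n - 1) + 1), u * (n - 2), halfPiece (σ u)⟩ : Block) ∈ wall n N σ :=
    (mem_wall_half hn _ _ _).2 (Or.inr ⟨rfl, Or.inr hlt⟩)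
  rw [he, mem_wall_half hn, ← profile_eq_of_wall_eq hn h h' he (by omega)] at hin
  rcases hin with hin | hin
  · exact absurd hin (lt_irrefl _)
  · exact hin.1

lemma mem_iff_lt_ncard {S : Set ℕ} (hf : S.Finite) (hS : ∀ c ∈ S, ∀ c' ≤ c, c' ∈ S) (c : ℕ) :
    c ∈ S ↔ c < S.ncard := by
  classical
  have hex : ∃ y, y ∉ S := by
    by_contra hall
    push Not at hall
    exact Set.infinite_univ (hf.subset fun x _ => hall x)
  have : S = ↑(Finset.range (Nat.find hex)) := by
    ext y
    simp only [Finset.coe_range, Set.mem_Iio]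
    constructor
    · intro hy
      by_contra hlt
      exact Nat.find_spec hex (hS y hy _ (by omega))
    · intro hy
      by_contra hn
      exact Nat.find_min hex hy hn
  rw [this, Set.ncard_coe_finset]
  simp

section Profile
variable {Y : Set Block}

lemma IsYoungWall.mem_of_le (hY : IsYoungWall n Y) {c c' r : ℕ} {p : Piece} (hc : c' ≤ c)
    (h : (⟨c, r, p⟩ : Block) ∈ Y) : (⟨c', r, p⟩ : Block) ∈ Y := by
  induction c, hc using Nat.le_induction with
  | base => exact h
  | succ k _ ih => exact ih (hY.left_closed _ h ⟨k, r, p⟩ rfl rfl rfl)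

lemma IsYoungWall.colSet_down (hY : IsYoungWall n Y) (x : ℕ) :
    ∀ c ∈ colSet n Y x, ∀ c' ≤ c, c' ∈ colSet n Y x := by
  intro c hc c' hle
  simp only [colSet, Set.mem_ofPred_eq] at hc ⊢
  split_ifs at hc ⊢
  · obtain ⟨b, hb⟩ := hc
    exact ⟨b, hY.mem_of_le hle hb⟩
  · exact fun b => hY.mem_of_le hle (hc b)
  · exact hY.mem_of_le hle hc

lemma IsYoungWall.colSet_finite (hn : 4 ≤ n) (hY : IsYoungWall n Y) {x : ℕ} (hx : 1 ≤ x) :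
    (colSet n Y x).Finite := by
  refine (hY.finite_white.image Block.col).subset fun c hc => ?_
  rcases pos_cases hn hx with ⟨u, hu, rfl⟩ | ⟨j, rfl⟩ | ⟨j, t, h1, ht, rfl⟩
  · obtain ⟨b, hb⟩ := (mem_colSet_half hn hu c).1 hc
    exact ⟨_, ⟨hb, by rw [isGrey_half hn]; omega⟩, rfl⟩
  · exact ⟨_, ⟨(mem_colSet_half_succ hn j c).1 hc true, by rw [isGrey_half hn]; simp⟩, rfl⟩
  · exact ⟨_, ⟨(mem_colSet_full hn j c h1 ht).1 hc, not_isGrey_full _ _⟩, rfl⟩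

lemma IsYoungWall.colSet_succ (hn : 4 ≤ n) (hY : IsYoungWall n Y) {x : ℕ} (hx : 1 ≤ x) :
    colSet n Y (x + 1) ⊆ colSet n Y x := by
  intro c hc
  rcases pos_cases hn hx with ⟨u, hu, rfl⟩ | ⟨j, rfl⟩ | ⟨j, t, h1, ht, rfl⟩
  · rw [mem_colSet_half_succ hn] at hc
    rw [mem_colSet_half hn hu]
    exact ⟨true, hc true⟩
  · rw [mem_colSet_full hn j c le_rfl (by omega)] at hc
    rw [mem_colSet_half_succ hn]
    exact fun b => hY.supported _ hc _ (by rw [inPattern_half]; exact halfPiece_ne_full _) rfl rfl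
  · rw [mem_colSet_full hn j c h1 ht]
    rcases Nat.lt_or_ge (t + 1) (n - 2) with h2 | h2
    · rw [show j * (n - 1) + t + 1 + 1 = j * (n - 1) + (t + 1) + 1 by omega,
        mem_colSet_full hn j c (by omega) h2] at hc
      exact hY.supported _ hc _ ((inPattern_full _ _ _ h1 ht).2 rfl) rfl (by simp; omega)
    · rw [show j * (n - 1) + t + 1 + 1 = (j + 1) * (n - 1) by rw [Nat.succ_mul]; omega,
        mem_colSet_half hn (by omega)] at hc
      obtain ⟨b, hb⟩ := hc
      exact hY.supported _ hb _ ((inPattern_full _ _ _ h1 ht).2 rfl) rfl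
        (by simp only [Nat.succ_mul]; omega)

/-- The shapes in a row of half-blocks are well defined because the two orientations cannot both
occur singly: of two columns, the left one contains the half-block of the right one. -/
theorem IsYoungWall.exists_profile (hn : 4 ≤ n) (hY : IsYoungWall n Y) :
    ∃ N σ, IsProfile n N σ ∧ Y = wall n N σ := by
  classical
  let N : ℕ → ℕ := fun x => (colSet n Y (max x 1)).ncard
  let σ : ℕ → Bool := fun u => decide (u ≠ 0 ∧ ∃ c, ⟨c, u * (n - 2), halfPiece true⟩ ∈ Y ∧
    ⟨c, u * (n - 2), halfPiece false⟩ ∉ Y)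
  have hmem : ∀ x, 1 ≤ x → ∀ c, c < N x ↔ c ∈ colSet n Y x := by
    intro x hx c
    rw [mem_iff_lt_ncard (hY.colSet_finite hn hx) (hY.colSet_down x)]
    simp [N, max_eq_left hx]
  have hanti : Antitone N := by
    refine antitone_nat_of_succ_le fun x => ?_
    rcases Nat.eq_zero_or_pos x with rfl | hx
    · simp [N]
    · simp only [N, max_eq_left (show 1 ≤ x from hx), max_eq_left (show 1 ≤ x + 1 by omega)]
      exact Set.ncard_le_ncard (hY.colSet_succ hn hx) (hY.colSet_finite hn hx)
  have hzero : ∃ X, N X = 0 := by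
    obtain ⟨R, hR⟩ := (hY.finite_white.image Block.row).bddAbove
    refine ⟨(R + 1) * (n - 1) + 1 + 1, Nat.eq_zero_of_not_pos fun hpos => ?_⟩
    have := (hmem _ (by omega) _).1 hpos
    rw [mem_colSet_full hn _ _ le_rfl (by omega)] at this
    have h2 := hR ⟨_, ⟨this, not_isGrey_full _ _⟩, rfl⟩
    have h3 : R + 1 ≤ (R + 1) * (n - 2) := Nat.le_mul_of_pos_right _ (by omega)
    simp only at h2
    omega
  have hlow : σ 0 = false := by simp [σ]
  -- if one column has only the upper half-block of a row, then no column has only the lower one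
  have hcross : ∀ j c c', (⟨c, j * (n - 2), halfPiece true⟩ : Block) ∈ Y →
      (⟨c, j * (n - 2), halfPiece false⟩ : Block) ∉ Y →
      (⟨c', j * (n - 2), halfPiece false⟩ : Block) ∈ Y →
      (⟨c', j * (n - 2), halfPiece true⟩ : Block) ∈ Y := by
    intro j c c' h1 h2 h3
    rcases le_total c c' with hle | hle
    · exact absurd (hY.mem_of_le hle h3) h2
    · exact hY.mem_of_le hle h1
  have hwall : Y = wall n N σ := by
    ext ⟨c, r, p⟩
    rcases row_cases hn r with ⟨j, rfl⟩ | ⟨j, t, h1, ht, rfl⟩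
    · rcases piece_cases p true with rfl | hp
      · refine ⟨fun h => absurd rfl ((inPattern_half _ _ _).1 (hY.subset_pattern _ h)),
          fun h => absurd h (not_full_half_mem _ _)⟩
      · obtain ⟨b, rfl⟩ : ∃ b, p = halfPiece b := by
          rcases hp with hp | hp <;> exact ⟨_, hp⟩
        rw [mem_wall_half hn, hmem _ (by omega), mem_colSet_half_succ hn]
        rcases Nat.eq_zero_or_pos j with rfl | hj
        · have hg : (⟨c, 0 * (n - 2), halfPiece false⟩ : Block) ∈ Y :=
            hY.grey_mem _ ((isGrey_half hn _ _ _).2 ⟨rfl, rfl⟩)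
          cases b
          · simp only [hg, hlow, true_or, and_self, or_true]
          · rw [Nat.zero_mul] at hg ⊢
            simp [hlow, hg, Bool.forall_bool]
        · rw [hmem _ (Nat.mul_pos hj (by omega)), mem_colSet_half hn hj]
          have hσ : σ j = true ↔ ∃ c, (⟨c, j * (n - 2), halfPiece true⟩ : Block) ∈ Y ∧
              (⟨c, j * (n - 2), halfPiece false⟩ : Block) ∉ Y := by
            simp [σ, show j ≠ 0 by omega]
          have hj0 : j ≠ 0 := by omega
          by_cases ht : (⟨c, j * (n - 2), halfPiece true⟩ : Block) ∈ Y <;>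
          by_cases hf : (⟨c, j * (n - 2), halfPiece false⟩ : Block) ∈ Y
          · cases b <;> simp [ht, hf, Bool.forall_bool]
          · have : σ j = true := hσ.2 ⟨c, ht, hf⟩
            cases b <;> simp [ht, hf, Bool.forall_bool, this]
          · have : σ j = false := by
              rw [← Bool.not_eq_true, hσ]
              rintro ⟨c', h1, h2⟩
              exact ht (hcross j c' c h1 h2 hf)
            cases b <;> simp [ht, hf, Bool.forall_bool, this]
          · cases b <;> simp [ht, hf, Bool.forall_bool, hj0]
    · rw [mem_wall_full hn _ _ _ h1 ht, hmem _ (by omega), mem_colSet_full hn _ _ h1 ht]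
      constructor
      · intro h
        have := (inPattern_full _ _ _ h1 ht).1 (hY.subset_pattern _ h)
        subst this
        exact ⟨rfl, h⟩
      · rintro ⟨rfl, h⟩
        exact h
  refine ⟨N, σ, ⟨hanti, hzero, fun x hx => ?_, hlow⟩, hwall⟩
  by_contra hlt
  have hx1 : 1 ≤ x := Nat.pos_of_ne_zero fun h => hx (h ▸ dvd_zero _)
  have e1 := (colHeight_eq_iff hanti hzero (c := N (x + 1)) hx1).2 ⟨le_rfl, by omega⟩
  have e2 := (colHeight_eq_iff hanti hzero (c := N (x + 1) + 1) hx1).2 ⟨by omega, by omega⟩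
  have := hY.proper (N (x + 1)) (N (x + 1) + 1)
  rw [hwall, isFullColumn_wall hn hanti hzero, isFullColumn_wall hn hanti hzero,
    height_wall hn hanti hlow, height_wall hn hanti hlow, e1, e2] at this
  have := this hx hx rfl
  omega

end Profile

end

/-! ### Removal of bars -/

section

variable {n : ℕ} {N N' : ℕ → ℕ} {σ σ' : ℕ → Bool}

lemma posRow_succ (hn : 4 ≤ n) {x : ℕ} (hx : 1 ≤ x) :
    posRow n x ≤ posRow n (x + 1) ∧ posRow n (x + 1) ≤ posRow n x + 1 := by
  have h1 : (x - 1) / (n - 1) ≤ x / (n - 1) := Nat.div_le_div_right (by omega)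
  have h2 : x / (n - 1) ≤ (x - 1) / (n - 1) + 1 := by
    rw [← Nat.add_div_right _ (show 0 < n - 1 by omega)]
    exact Nat.div_le_div_right (by omega)
  have h3 := Nat.div_le_self (x - 1) (n - 1)
  have h4 := Nat.div_le_self x (n - 1)
  simp only [posRow, Nat.add_sub_cancel]
  omega

/-- Where the shapes differ, the smaller wall is still contained in the larger one, if its columns
that reach the row of half-blocks have both half-blocks in the larger wall. -/
lemma wall_subset (hn : 4 ≤ n) (hle : ∀ x, 1 ≤ x → N' x ≤ N x) (h0 : σ 0 = false)
    (h0' : σ' 0 = false)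
    (H : ∀ u, 1 ≤ u → N' (u * (n - 1)) ≤ N (u * (n - 1) + 1) ∨ σ' u = σ u) :
    wall n N' σ' ⊆ wall n N σ := by
  rintro ⟨c, r, p⟩ hB
  rcases row_cases hn r with ⟨j, rfl⟩ | ⟨j, t, h1, ht, rfl⟩
  · rcases piece_cases p (σ' j) with rfl | hp
    · exact absurd hB (not_full_half_mem _ _)
    · obtain ⟨b, rfl⟩ : ∃ b, p = halfPiece b := by
        rcases hp with hp | hp <;> exact ⟨_, hp⟩
      rw [mem_wall_half hn] at hB ⊢
      rcases hB with hB | ⟨rfl, hB⟩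
      · exact Or.inl (lt_of_lt_of_le hB (hle _ (by omega)))
      · rcases Nat.eq_zero_or_pos j with rfl | hj
        · exact Or.inr ⟨by rw [h0, h0'], Or.inl rfl⟩
        · have hB : c < N' (j * (n - 1)) := by
            rcases hB with hB | hB
            · omega
            · exact hB
          rcases H j hj with h | h
          · exact Or.inl (lt_of_lt_of_le hB h)
          · exact Or.inr ⟨h, Or.inr (lt_of_lt_of_le hB (hle _ (Nat.mul_pos hj (by omega))))⟩
  · rw [mem_wall_full hn _ _ _ h1 ht] at hB ⊢
    exact ⟨hB.1, lt_of_lt_of_le hB.2 (hle _ (by omega))⟩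

/-- A block of the larger wall outside the smaller one lies in the row of a height that its column
reaches only in the larger wall. The block need not be the one of that height, as shapes may
differ. -/
lemma exists_pos_of_mem_sdiff (hn : 4 ≤ n) (h0 : σ 0 = false) (h0' : σ' 0 = false)
    (H : ∀ u, 1 ≤ u → N' (u * (n - 1)) ≤ N (u * (n - 1) + 1) ∨ σ' u = σ u) {B : Block}
    (hB : B ∈ wall n N σ \ wall n N' σ') :
    ∃ x, 1 ≤ x ∧ B.row = posRow n x ∧ N' x ≤ B.col ∧ B.col < N x := by
  obtain ⟨c, r, p⟩ := B
  obtain ⟨hB, hB'⟩ := hB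
  rcases row_cases hn r with ⟨j, rfl⟩ | ⟨j, t, h1, ht, rfl⟩
  · rcases piece_cases p (σ j) with rfl | hp
    · exact absurd hB (not_full_half_mem _ _)
    · obtain ⟨b, rfl⟩ : ∃ b, p = halfPiece b := by
        rcases hp with hp | hp <;> exact ⟨_, hp⟩
      rw [mem_wall_half hn] at hB hB'
      push Not at hB'
      have hrow : j * (n - 2) = posRow n (j * (n - 1) + 1) := by
        have := posRow_of hn j (t := 0) (by omega)
        simpa using this.symm
      by_cases hc : c < N (j * (n - 1) + 1)
      · exact ⟨_, Nat.le_add_left _ _, hrow, hB'.1, hc⟩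
      · obtain ⟨hb, hc'⟩ := hB.resolve_left hc
        subst hb
        rcases Nat.eq_zero_or_pos j with rfl | hj
        · exact absurd rfl (hB'.2 (by rw [h0, h0'])).1
        · have hlt := hc'.resolve_left (by omega)
          refine ⟨j * (n - 1), Nat.mul_pos hj (by omega), (posRow_half hn hj).symm, ?_, hlt⟩
          rcases H j hj with h | h
          · simp only; omega
          · exact (hB'.2 h.symm).2
  · rw [mem_wall_full hn _ _ _ h1 ht] at hB hB'
    refine ⟨j * (n - 1) + t + 1, by omega, (posRow_of hn j (by omega)).symm, ?_, hB.2⟩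
    by_contra h
    exact hB' ⟨hB.1, by simpa using h⟩

lemma exists_mem_sdiff_of_pos (hn : 4 ≤ n) (h : Antitone N') {x c : ℕ} (hx : 1 ≤ x)
    (h1 : N' x ≤ c) (h2 : c < N x) :
    ∃ p, ⟨c, posRow n x, p⟩ ∈ wall n N σ \ wall n N' σ' := by
  rcases pos_cases hn hx with ⟨u, hu, rfl⟩ | ⟨j, rfl⟩ | ⟨j, t, ht1, ht, rfl⟩
  · refine ⟨halfPiece (σ u), ?_⟩
    rw [posRow_half hn hu, Set.mem_sdiff, mem_wall_half hn, mem_wall_half hn]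
    have := h (Nat.le_succ (u * (n - 1)))
    simp only [Nat.succ_eq_add_one] at this
    refine ⟨Or.inr ⟨rfl, Or.inr h2⟩, ?_⟩
    rintro (h3 | ⟨-, h3 | h3⟩) <;> omega
  · refine ⟨halfPiece (!σ' j), ?_⟩
    have := posRow_of hn j (t := 0) (by omega)
    simp only [Nat.add_zero] at this
    rw [this, Set.mem_sdiff, mem_wall_half hn, mem_wall_half hn]
    refine ⟨Or.inl h2, ?_⟩
    rintro (h3 | ⟨h3, -⟩)
    · omega
    · simp at h3
  · refine ⟨Piece.full, ?_⟩
    rw [posRow_of hn j (by omega), Set.mem_sdiff, mem_wall_full hn _ _ _ ht1 ht,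
      mem_wall_full hn _ _ _ ht1 ht]
    exact ⟨⟨rfl, h2⟩, fun h3 => by omega⟩

/-- The lost squares form a zigzag path: at each of the heights from `lo + 1` to `hi` one or two
columns are lost, and consecutive heights are linked because at most one column of the larger
wall ends at each of the heights in between. -/
theorem isConnectedSet_sdiff (hn : 4 ≤ n) (h' : Antitone N') (h0 : σ 0 = false)
    (h0' : σ' 0 = false)
    (H : ∀ u, 1 ≤ u → N' (u * (n - 1)) ≤ N (u * (n - 1) + 1) ∨ σ' u = σ u) {lo hi : ℕ}
    (hin : ∀ x, lo < x → x ≤ hi → N' x < N x ∧ N x ≤ N' x + 2)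
    (hout : ∀ x, 1 ≤ x → N' x < N x → lo < x ∧ x ≤ hi)
    (hstep : ∀ x, lo < x → x < hi → N (x + 1) ≤ N x ∧ N x ≤ N (x + 1) + 1) :
    IsConnectedSet (wall n N σ \ wall n N' σ') := by
  set S := wall n N σ \ wall n N' σ' with hS
  set R := Relation.ReflTransGen (fun x y => x ∈ S ∧ y ∈ S ∧ Touch x y) with hR
  have hsymm : ∀ {a b}, R a b → R b a := by
    intro a b hab
    induction hab with
    | refl => exact Relation.ReflTransGen.refl
    | tail _ h ih => exact ih.head ⟨h.2.1, h.1, h.2.2.2.1, h.2.2.1, h.2.2.2.2.2, h.2.2.2.2.1⟩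
  -- The rightmost lost block at the height `x` represents this height.
  have hex : ∀ x, ∃ p, lo < x → x ≤ hi → ⟨N x - 1, posRow n x, p⟩ ∈ S := by
    intro x
    by_cases hx : lo < x ∧ x ≤ hi
    · obtain ⟨p, hp⟩ := exists_mem_sdiff_of_pos (N := N) (σ := σ) (σ' := σ') hn h' (x := x)
        (c := N x - 1) (by omega) (by have := hin x hx.1 hx.2; omega)
        (by have := hin x hx.1 hx.2; omega)
      exact ⟨p, fun _ _ => hp⟩
    · exact ⟨Piece.full, fun h1 h2 => absurd ⟨h1, h2⟩ hx⟩
  choose q hq using hex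
  let rep : ℕ → Block := fun x => ⟨N x - 1, posRow n x, q x⟩
  have hrep : ∀ B ∈ S, ∀ x, lo < x → x ≤ hi → B.row = posRow n x → N' x ≤ B.col →
      B.col < N x → R B (rep x) := by
    intro B hB x h1 h2 h3 h4 h5
    have := hin x h1 h2
    refine Relation.ReflTransGen.single ⟨hB, hq x h1 h2, ?_, ?_, ?_, ?_⟩ <;>
      simp only [rep] <;> omega
  -- The leftmost lost block at the height `x` touches the rightmost one at the height `x + 1`.
  have hnext : ∀ x, lo < x → x < hi → R (rep x) (rep (x + 1)) := by
    intro x h1 h2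
    have e1 := hin x h1 h2.le
    have e2 := hin (x + 1) (by omega) h2
    have e3 := hstep x h1 h2
    have e4 := posRow_succ hn (show 1 ≤ x by omega)
    obtain ⟨p, hp⟩ := exists_mem_sdiff_of_pos (N := N) (σ := σ) (σ' := σ') hn h' (x := x)
        (c := N' x) (by omega) le_rfl e1.1
    refine (hsymm (hrep _ hp x h1 h2.le rfl le_rfl e1.1)).trans ?_
    refine Relation.ReflTransGen.single ⟨hp, hq _ (by omega) h2, ?_, ?_, ?_, ?_⟩ <;>
      simp only [rep] <;> omega
  have hall : ∀ x, lo + 1 ≤ x → x ≤ hi → R (rep (lo + 1)) (rep x) := by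
    intro x hx
    induction x, hx using Nat.le_induction with
    | base => exact fun _ => Relation.ReflTransGen.refl
    | succ k hk ih => exact fun h => (ih (by omega)).trans (hnext k (by omega) (by omega))
  have hfin : ∀ B ∈ S, R (rep (lo + 1)) B := by
    intro B hB
    obtain ⟨x, h1, h2, h3, h4⟩ := exists_pos_of_mem_sdiff hn h0 h0' H hB
    obtain ⟨h5, h6⟩ := hout x h1 (by omega)
    exact (hall x h5 h6).trans (hsymm (hrep B hB x h5 h6 h2 h3 h4))
  exact fun B hB B' hB' => (hsymm (hfin B hB)).trans (hfin B' hB')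

lemma weight_apply (n : ℕ) (Y : Set Block) (j : Fin (n + 1)) :
    weight n Y j = {B | B ∈ Y ∧ ¬ IsGrey B ∧ label n B = j}.ncard := rfl

lemma ncard_label_sdiff {Y Y' : Set Block} (hY : IsYoungWall n Y) (hY' : IsYoungWall n Y')
    (hsub : Y' ⊆ Y) (j : Fin (n + 1)) :
    {B | B ∈ Y \ Y' ∧ label n B = j}.ncard + weight n Y' j = weight n Y j := by
  have hset : {B | B ∈ Y \ Y' ∧ label n B = j} =
      {B | B ∈ Y ∧ ¬ IsGrey B ∧ label n B = j} \ {B | B ∈ Y' ∧ ¬ IsGrey B ∧ label n B = j} := by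
    ext B
    constructor
    · rintro ⟨⟨h1, h2⟩, h3⟩
      exact ⟨⟨h1, fun h => h2 (hY'.grey_mem _ h), h3⟩, fun h => h2 h.1⟩
    · rintro ⟨⟨h1, h2, h3⟩, h4⟩
      exact ⟨⟨h1, fun h => h4 ⟨h, h2, h3⟩⟩, h3⟩
  rw [weight_apply, weight_apply, hset]
  refine Set.ncard_sdiff_add_ncard_of_subset ?_ ?_
  · exact fun B hB => ⟨hsub hB.1, hB.2⟩
  · exact hY.finite_white.subset fun B hB => ⟨hB.1, hB.2.1⟩

/-- The blocks outside a smaller Young wall form a bar, if they have the weight of a bar and if one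
or two columns are lost at each height of an interval and none at the other heights. -/
theorem not_isCore_wall (hn : 4 ≤ n) (hN : IsProfile n N σ) (hN' : IsProfile n N' σ')
    (hw : ∀ j, weight n (wall n N σ) j = weight n (wall n N' σ') j + barWeight n j)
    (H : ∀ u, 1 ≤ u → N' (u * (n - 1)) ≤ N (u * (n - 1) + 1) ∨ σ' u = σ u) {lo hi : ℕ}
    (hle : ∀ x, 1 ≤ x → N' x ≤ N x)
    (hin : ∀ x, lo < x → x ≤ hi → N' x < N x ∧ N x ≤ N' x + 2)
    (hout : ∀ x, 1 ≤ x → N' x < N x → lo < x ∧ x ≤ hi)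
    (hstep : ∀ x, lo < x → x < hi → N x ≤ N (x + 1) + 1) :
    ¬ IsCore n (wall n N σ) := by
  have hY := isYoungWall_wall hn hN
  have hY' := isYoungWall_wall hn hN'
  have hsub := wall_subset hn hle hN.lower hN'.lower H
  rintro ⟨-, hcore⟩
  refine hcore ⟨wall n N σ \ wall n N' σ', Set.sdiff_subset, ⟨?_, ?_, ?_⟩, ?_⟩
  · exact fun B hB => ⟨hY.subset_pattern _ hB.1, fun h => hB.2 (hY'.grey_mem _ h)⟩
  · exact isConnectedSet_sdiff hn hN'.anti hN.lower hN'.lower H hin hout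
      fun x h1 h2 => ⟨hN.anti (Nat.le_succ x), hstep x h1 h2⟩
  · intro j
    have h1 := ncard_label_sdiff hY hY' hsub j
    have h2 := hw j
    omega
  · rw [Set.sdiff_sdiff_cancel_left hsub]
    exact hY'

end

/-! ### The labels of a wall -/

section

variable {n : ℕ} {N N' : ℕ → ℕ} {σ σ' : ℕ → Bool}

lemma row_even_mod (hn : 4 ≤ n) (i : ℕ) {t : ℕ} (ht : t < n - 2) :
    (2 * i * (n - 2) + t) % (2 * n - 4) = t := by
  rw [show 2 * i * (n - 2) = i * (2 * (n - 2)) by ring, show 2 * n - 4 = 2 * (n - 2) by omega]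
  exact mul_add_mod_of_lt (by omega)

lemma row_odd_mod (hn : 4 ≤ n) (i : ℕ) {t : ℕ} (ht : t < n - 2) :
    ((2 * i + 1) * (n - 2) + t) % (2 * n - 4) = n - 2 + t := by
  rw [show (2 * i + 1) * (n - 2) + t = i * (2 * (n - 2)) + (n - 2 + t) by ring,
    show 2 * n - 4 = 2 * (n - 2) by omega]
  exact mul_add_mod_of_lt (by omega)

lemma label_half_even (hn : 4 ≤ n) (c i : ℕ) (b : Bool) :
    label n ⟨c, 2 * i * (n - 2), halfPiece b⟩ = if (Even c ↔ b = true) then 0 else 1 := by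
  have := row_even_mod hn i (t := 0) (by omega)
  simp only [Nat.add_zero] at this
  cases b <;> simp [label, this, halfPiece]

lemma label_half_odd (hn : 4 ≤ n) (c i : ℕ) (b : Bool) :
    label n ⟨c, (2 * i + 1) * (n - 2), halfPiece b⟩ =
      if (Even c ↔ b = true) then n - 1 else n := by
  have := row_odd_mod hn i (t := 0) (by omega)
  simp only [Nat.add_zero] at this
  have h0 : n - 2 ≠ 0 := by omega
  cases b <;> simp [label, this, halfPiece, h0]

lemma label_full_even (hn : 4 ≤ n) (c i : ℕ) (p : Piece) {t : ℕ} (h1 : 1 ≤ t)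
    (ht : t < n - 2) : label n ⟨c, 2 * i * (n - 2) + t, p⟩ = t + 1 := by
  simp only [label, row_even_mod hn i ht]
  rw [if_neg (by omega), if_neg (by omega), if_pos ht]

lemma label_full_odd (hn : 4 ≤ n) (c i : ℕ) (p : Piece) {t : ℕ} (h1 : 1 ≤ t)
    (ht : t < n - 2) : label n ⟨c, (2 * i + 1) * (n - 2) + t, p⟩ = n - 1 - t := by
  simp only [label, row_odd_mod hn i ht]
  rw [if_neg (by omega), if_neg (by omega), if_neg (by omega)]
  omega

lemma pos_even_mod (hn : 4 ≤ n) (i : ℕ) {t : ℕ} (ht : t < 2 * n - 2) :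
    (2 * i * (n - 1) + t) % (2 * n - 2) = t := by
  rw [show 2 * i * (n - 1) = i * (2 * (n - 1)) by ring, show 2 * n - 2 = 2 * (n - 1) by omega]
  exact mul_add_mod_of_lt (by omega)

lemma pos_odd_eq (hn : 4 ≤ n) (i t : ℕ) :
    (2 * i + 1) * (n - 1) + t = 2 * i * (n - 1) + (n - 1 + t) := by
  have := hn
  ring

/-- The labels of the blocks at a given height alternate between two values, or are the same in all
columns. In terms of heights, they are periodic with period `2 n - 2`. -/
lemma label_blk (hn : 4 ≤ n) (σ : ℕ → Bool) {x : ℕ} (hx : 1 ≤ x) :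
    (∃ b, ((x - 1) % (2 * n - 2) = 0 ∨ (x - 1) % (2 * n - 2) = 2 * n - 3) ∧
      ∀ c, label n (blk n σ c x) = if (Even c ↔ b = true) then 0 else 1) ∨
    (∃ b, ((x - 1) % (2 * n - 2) = n - 2 ∨ (x - 1) % (2 * n - 2) = n - 1) ∧
      ∀ c, label n (blk n σ c x) = if (Even c ↔ b = true) then n - 1 else n) ∨
    ∃ l, 2 ≤ l ∧ l ≤ n - 2 ∧
      ((x - 1) % (2 * n - 2) = l - 1 ∨ (x - 1) % (2 * n - 2) = 2 * n - 2 - l) ∧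
      ∀ c, label n (blk n σ c x) = l := by
  rcases pos_cases hn hx with ⟨u, hu, rfl⟩ | ⟨j, rfl⟩ | ⟨j, t, h1, ht, rfl⟩
  · obtain ⟨i, rfl | rfl⟩ := Nat.even_or_odd' u
    · refine Or.inl ⟨σ (2 * i), Or.inr ?_, fun c => ?_⟩
      · obtain ⟨k, rfl⟩ : ∃ k, i = k + 1 := ⟨i - 1, by omega⟩
        have := pos_even_mod hn k (t := 2 * n - 3) (by omega)
        rwa [show 2 * k * (n - 1) + (2 * n - 3) = 2 * (k + 1) * (n - 1) - 1 by
          rw [show 2 * (k + 1) * (n - 1) = 2 * k * (n - 1) + 2 * (n - 1) by ring]; omega] at this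
      · rw [blk_half hn hu, label_half_even hn]
    · refine Or.inr (Or.inl ⟨σ (2 * i + 1), Or.inl ?_, fun c => ?_⟩)
      · have := pos_even_mod hn i (t := n - 2) (by omega)
        rwa [show 2 * i * (n - 1) + (n - 2) = (2 * i + 1) * (n - 1) - 1 by
          rw [show (2 * i + 1) * (n - 1) = 2 * i * (n - 1) + (n - 1) by ring]; omega] at this
      · rw [blk_half hn hu, label_half_odd hn]
  · rw [Nat.add_sub_cancel]
    obtain ⟨i, rfl | rfl⟩ := Nat.even_or_odd' j
    · refine Or.inl ⟨!σ (2 * i), Or.inl (pos_even_mod hn i (t := 0) (by omega)), fun c => ?_⟩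
      rw [blk_half_succ hn, label_half_even hn]
    · refine Or.inr (Or.inl ⟨!σ (2 * i + 1), Or.inr ?_, fun c => ?_⟩)
      · have := pos_odd_eq hn i 0
        simp only [Nat.add_zero] at this
        rw [this, pos_even_mod hn i (by omega)]
      · rw [blk_half_succ hn, label_half_odd hn]
  · rw [Nat.add_sub_cancel]
    obtain ⟨i, rfl | rfl⟩ := Nat.even_or_odd' j
    · refine Or.inr (Or.inr ⟨t + 1, by omega, by omega, Or.inl ?_, fun c => ?_⟩)
      · rw [pos_even_mod hn i (by omega), Nat.add_sub_cancel]
      · rw [blk_full hn _ _ h1 ht, label_full_even hn _ _ _ h1 ht]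
    · refine Or.inr (Or.inr ⟨n - 1 - t, by omega, by omega, Or.inr ?_, fun c => ?_⟩)
      · rw [pos_odd_eq hn, pos_even_mod hn i (by omega)]
        omega
      · rw [blk_full hn _ _ h1 ht, label_full_odd hn _ _ _ h1 ht]

open Classical in
/-- The number of blocks with the label `l` among the first `k` blocks at the height `x`. -/
def labelCount (n : ℕ) (σ : ℕ → Bool) (x k l : ℕ) : ℕ :=
  ((Finset.range k).filter fun c => label n (blk n σ c x) = l).card

lemma weight_wall (hn : 4 ≤ n) (h : Antitone N) (h0 : σ 0 = false) {X : ℕ} (hX : N X = 0)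
    (j : Fin (n + 1)) :
    weight n (wall n N σ) j = ∑ x ∈ Finset.Ico 1 X, labelCount n σ x (N x) j := by
  classical
  have hset : {B | B ∈ wall n N σ ∧ ¬ IsGrey B ∧ label n B = j} =
      (fun p : ℕ × ℕ => blk n σ p.1 p.2) ''
        {p | 1 ≤ p.2 ∧ p.1 < N p.2 ∧ label n (blk n σ p.1 p.2) = j} := by
    ext B
    have hw := Set.ext_iff.1 (white_wall (N := N) (σ := σ) hn h h0) B
    constructor
    · rintro ⟨h1, h2, h3⟩
      obtain ⟨p, hp, rfl⟩ := hw.1 ⟨h1, h2⟩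
      exact ⟨p, ⟨hp.1, hp.2, h3⟩, rfl⟩
    · rintro ⟨p, hp, rfl⟩
      have := hw.2 ⟨p, ⟨hp.1, hp.2.1⟩, rfl⟩
      exact ⟨this.1, this.2, hp.2.2⟩
  have hset2 : {p : ℕ × ℕ | 1 ≤ p.2 ∧ p.1 < N p.2 ∧ label n (blk n σ p.1 p.2) = j} =
      (fun s : (_ : ℕ) × ℕ => (s.2, s.1)) '' ↑((Finset.Ico 1 X).sigma fun x =>
        (Finset.range (N x)).filter fun c => label n (blk n σ c x) = j) := by
    ext ⟨c, x⟩
    simp only [Set.mem_ofPred_eq, Set.mem_image, SetLike.mem_coe, Finset.mem_sigma,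
      Finset.mem_Ico, Finset.mem_filter, Finset.mem_range, Prod.mk.injEq]
    constructor
    · rintro ⟨h1, h2, h3⟩
      refine ⟨⟨x, c⟩, ⟨⟨h1, ?_⟩, h2, h3⟩, rfl, rfl⟩
      by_contra hlt
      have := h (show X ≤ x by simpa using hlt)
      omega
    · rintro ⟨⟨x', c'⟩, ⟨⟨h1, -⟩, h2, h3⟩, rfl, rfl⟩
      exact ⟨h1, h2, h3⟩
  rw [weight_apply, hset, Set.InjOn.ncard_image, hset2, Set.InjOn.ncard_image,
    Set.ncard_coe_finset, Finset.card_sigma]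
  · rfl
  · rintro ⟨a, b⟩ - ⟨a', b'⟩ - hab
    simp only [Prod.mk.injEq] at hab
    obtain ⟨rfl, rfl⟩ := hab
    rfl
  · exact (blk_injOn hn).mono fun p hp => hp.1

/-- The sign `1` of the upper left and `-1` of the lower right half-blocks. -/
def shapeSign (b : Bool) : ℤ := if b then 1 else -1

lemma card_alternating (k : ℕ) (b : Bool) :
    (((Finset.range k).filter fun c => (Even c ↔ b = true)).card : ℤ) -
      ((Finset.range k).filter fun c => ¬ (Even c ↔ b = true)).card =
        shapeSign b * (k % 2 : ℕ) := by
  induction k with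
  | zero => simp
  | succ k ih =>
    rw [Finset.range_add_one, Finset.filter_insert, Finset.filter_insert]
    rcases Nat.even_or_odd k with hk | hk
    · have h1 : k % 2 = 0 := Nat.even_iff.1 hk
      have h2 : (k + 1) % 2 = 1 := by omega
      rw [h1] at ih
      rw [h2]
      cases b <;> simp [hk, shapeSign] at ih ⊢ <;> omega
    · have h1 : k % 2 = 1 := Nat.odd_iff.1 hk
      have h2 : (k + 1) % 2 = 0 := by omega
      have h3 : ¬ Even k := Nat.not_even_iff_odd.2 hk
      rw [h1] at ih
      rw [h2]
      cases b <;> simp [h3, shapeSign] at ih ⊢ <;> omega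

lemma labelCount_eq {x k l p q : ℕ} {b : Bool} (hpq : p ≠ q)
    (h : ∀ c, label n (blk n σ c x) = if (Even c ↔ b = true) then p else q) :
    labelCount n σ x k l =
      if l = p then ((Finset.range k).filter fun c => (Even c ↔ b = true)).card
      else if l = q then ((Finset.range k).filter fun c => ¬ (Even c ↔ b = true)).card else 0 := by
  classical
  rw [labelCount]
  simp only [h]
  split_ifs with h1 h2
  · subst h1
    congr 1
    ext c
    simp only [Finset.mem_filter]
    have := hpq.symm
    split_ifs <;> simp_all
  · subst h2
    congr 1
    ext c
    simp only [Finset.mem_filter]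
    split_ifs <;> simp_all
  · rw [Finset.card_eq_zero, Finset.filter_eq_empty_iff]
    intro c _
    split_ifs <;> omega

lemma labelCount_eq_zero {x k l p q : ℕ} {b : Bool} (h1 : l ≠ p) (h2 : l ≠ q)
    (h : ∀ c, label n (blk n σ c x) = if (Even c ↔ b = true) then p else q) :
    labelCount n σ x k l = 0 := by
  classical
  rw [labelCount, Finset.card_eq_zero, Finset.filter_eq_empty_iff]
  intro c _
  rw [h]
  split_ifs <;> omega

lemma labelCount_const {x k l l' : ℕ} (h : ∀ c, label n (blk n σ c x) = l') :
    labelCount n σ x k l = if l = l' then k else 0 := by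
  classical
  rw [labelCount]
  simp only [h]
  split_ifs with h1
  · simp [h1]
  · simp [Ne.symm h1]

/-- The heights at which the blocks have the labels `0` and `1` (for `l = 1`), the label `l`
(for `2 ≤ l ≤ n - 2`), or the labels `n - 1` and `n` (for `l = n - 1`). -/
def AtLevel (n l x : ℕ) : Prop :=
  (x - 1) % (2 * n - 2) = l - 1 ∨ (x - 1) % (2 * n - 2) = 2 * n - 2 - l

instance (n l : ℕ) : DecidablePred (AtLevel n l) := fun _ => inferInstanceAs (Decidable (_ ∨ _))

lemma labelCount_bot (hn : 4 ≤ n) {x : ℕ} (hx : 1 ≤ x) (k : ℕ) :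
    labelCount n σ x k 0 + labelCount n σ x k 1 = if AtLevel n 1 x then k else 0 := by
  rcases label_blk hn σ hx with ⟨b, h1, h2⟩ | ⟨b, h1, h2⟩ | ⟨l, h1, h3, h4, h2⟩
  · rw [if_pos (show AtLevel n 1 x by unfold AtLevel; omega), labelCount_eq (by omega) h2,
      labelCount_eq (by omega) h2]
    simp [Finset.card_filter_add_card_filter_not]
  · rw [if_neg (show ¬ AtLevel n 1 x by unfold AtLevel; omega), labelCount_eq_zero _ _ h2,
      labelCount_eq_zero _ _ h2] <;> omega
  · rw [if_neg (show ¬ AtLevel n 1 x by unfold AtLevel; omega), labelCount_const h2,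
      labelCount_const h2, if_neg (by omega), if_neg (by omega)]

lemma labelCount_top (hn : 4 ≤ n) {x : ℕ} (hx : 1 ≤ x) (k : ℕ) :
    labelCount n σ x k (n - 1) + labelCount n σ x k n = if AtLevel n (n - 1) x then k else 0 := by
  rcases label_blk hn σ hx with ⟨b, h1, h2⟩ | ⟨b, h1, h2⟩ | ⟨l, h1, h3, h4, h2⟩
  · rw [if_neg (show ¬ AtLevel n (n - 1) x by unfold AtLevel; omega), labelCount_eq_zero _ _ h2,
      labelCount_eq_zero _ _ h2] <;> omega
  · rw [if_pos (show AtLevel n (n - 1) x by unfold AtLevel; omega), labelCount_eq (by omega) h2,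
      labelCount_eq (by omega) h2]
    simp [show n ≠ n - 1 by omega, Finset.card_filter_add_card_filter_not]
  · rw [if_neg (show ¬ AtLevel n (n - 1) x by unfold AtLevel; omega), labelCount_const h2,
      labelCount_const h2, if_neg (by omega), if_neg (by omega)]

lemma labelCount_mid (hn : 4 ≤ n) {x l : ℕ} (hx : 1 ≤ x) (hl : 2 ≤ l) (hl' : l ≤ n - 2)
    (k : ℕ) : labelCount n σ x k l = if AtLevel n l x then k else 0 := by
  rcases label_blk hn σ hx with ⟨b, h1, h2⟩ | ⟨b, h1, h2⟩ | ⟨l', h1, h3, h4, h2⟩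
  · rw [if_neg (show ¬ AtLevel n l x by unfold AtLevel; omega), labelCount_eq_zero _ _ h2] <;>
      omega
  · rw [if_neg (show ¬ AtLevel n l x by unfold AtLevel; omega), labelCount_eq_zero _ _ h2] <;>
      omega
  · rw [labelCount_const h2]
    congr 1
    apply propext
    unfold AtLevel
    omega

/-- The number of blocks at the heights of level `l`. -/
def levelSum (n : ℕ) (N : ℕ → ℕ) (X l : ℕ) : ℕ :=
  ∑ x ∈ Finset.Ico 1 X, if AtLevel n l x then N x else 0

lemma weight_bot (hn : 4 ≤ n) (h : Antitone N) (h0 : σ 0 = false) {X : ℕ} (hX : N X = 0) :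
    weight n (wall n N σ) ⟨0, by omega⟩ + weight n (wall n N σ) ⟨1, by omega⟩ =
      levelSum n N X 1 := by
  rw [weight_wall hn h h0 hX, weight_wall hn h h0 hX, ← Finset.sum_add_distrib, levelSum]
  exact Finset.sum_congr rfl fun x hx => labelCount_bot hn (Finset.mem_Ico.1 hx).1 _

lemma weight_top (hn : 4 ≤ n) (h : Antitone N) (h0 : σ 0 = false) {X : ℕ} (hX : N X = 0) :
    weight n (wall n N σ) ⟨n - 1, by omega⟩ + weight n (wall n N σ) ⟨n, by omega⟩ =
      levelSum n N X (n - 1) := by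
  rw [weight_wall hn h h0 hX, weight_wall hn h h0 hX, ← Finset.sum_add_distrib, levelSum]
  exact Finset.sum_congr rfl fun x hx => labelCount_top hn (Finset.mem_Ico.1 hx).1 _

lemma weight_mid (hn : 4 ≤ n) (h : Antitone N) (h0 : σ 0 = false) {X : ℕ} (hX : N X = 0)
    (j : Fin (n + 1)) (hj : 2 ≤ (j : ℕ)) (hj' : (j : ℕ) ≤ n - 2) :
    weight n (wall n N σ) j = levelSum n N X j := by
  rw [weight_wall hn h h0 hX, levelSum]
  exact Finset.sum_congr rfl fun x hx => labelCount_mid hn (Finset.mem_Ico.1 hx).1 hj hj' _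

/-- The contribution of the half-block row `u (n - 2)` to the difference of the numbers of blocks
with its two labels, `0` minus `1` for even `u`, and `n - 1` minus `n` for odd `u`. Along a row the
labels alternate, so only the parities of the numbers of columns matter. -/
def rowDefect (n : ℕ) (N : ℕ → ℕ) (σ : ℕ → Bool) (u : ℕ) : ℤ :=
  (if u = 0 then 0 else shapeSign (σ u) * (N (u * (n - 1)) % 2 : ℕ)) -
    shapeSign (σ u) * (N (u * (n - 1) + 1) % 2 : ℕ)

lemma sum_range_mul_eq (g : ℕ → ℤ) (U m : ℕ) :
    ∑ x ∈ Finset.range (U * m), g x =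
      ∑ u ∈ Finset.range U, ∑ t ∈ Finset.range m, g (u * m + t) := by
  induction U with
  | zero => simp
  | succ U ih => rw [Nat.succ_mul, Finset.sum_range_add, ih, Finset.sum_range_succ]

/-- Summing over heights a function that is supported on the blocks of half-block rows. -/
lemma sum_heights_eq (hn : 4 ≤ n) (g : ℕ → ℤ)
    (hg : ∀ j t, 1 ≤ t → t < n - 2 → g (j * (n - 1) + t + 1) = 0) {U : ℕ} (hU : 1 ≤ U) :
    ∑ x ∈ Finset.Ico 1 (U * (n - 1)), g x = ∑ u ∈ Finset.range U,
      ((if u = 0 then 0 else g (u * (n - 1))) + g (u * (n - 1) + 1)) := by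
  have h1 : ∑ x ∈ Finset.Ico 1 (U * (n - 1)), g x =
      ∑ x ∈ Finset.range (U * (n - 1)), if x = 0 then 0 else g x := by
    have : 0 < U * (n - 1) := Nat.mul_pos hU (by omega)
    rw [Finset.range_eq_Ico, Finset.sum_eq_sum_Ico_succ_bot this]
    simp only [if_pos, zero_add]
    exact Finset.sum_congr rfl fun x hx => by
      rw [if_neg (by have := (Finset.mem_Ico.1 hx).1; omega)]
  rw [h1, sum_range_mul_eq]
  refine Finset.sum_congr rfl fun u _ => ?_
  obtain ⟨m, hm⟩ : ∃ m, n - 1 = m + 2 := ⟨n - 3, by omega⟩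
  rw [hm, Finset.sum_range_succ', Finset.sum_range_succ', ← hm]
  have h0 : ∀ t ∈ Finset.range m, (if u * (n - 1) + (t + 1 + 1) = 0 then 0
      else g (u * (n - 1) + (t + 1 + 1))) = 0 := by
    intro t ht
    rw [if_neg (by omega), ← add_assoc]
    exact hg u (t + 1) (by omega) (by have := Finset.mem_range.1 ht; omega)
  rw [Finset.sum_eq_zero h0]
  rcases Nat.eq_zero_or_pos u with rfl | hu
  · simp
  · have : u * (n - 1) ≠ 0 := (Nat.mul_pos hu (by omega)).ne'
    have hu0 : u ≠ 0 := by omega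
    have hn1 : n - 1 ≠ 0 := by omega
    simp [hu0, hn1]
    ring

lemma labelCount_sub {x k p q : ℕ} {b : Bool} (hpq : p ≠ q)
    (h : ∀ c, label n (blk n σ c x) = if (Even c ↔ b = true) then p else q) :
    (labelCount n σ x k p : ℤ) - labelCount n σ x k q = shapeSign b * (k % 2 : ℕ) := by
  rw [labelCount_eq hpq h, labelCount_eq hpq h, if_pos rfl, if_neg hpq.symm, if_pos rfl,
    card_alternating]

lemma weight_bot_sub (hn : 4 ≤ n) (h : Antitone N) (h0 : σ 0 = false) {U : ℕ} (hU : 1 ≤ U)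
    (hX : N (U * (n - 1)) = 0) :
    (weight n (wall n N σ) ⟨0, by omega⟩ : ℤ) - weight n (wall n N σ) ⟨1, by omega⟩ =
      ∑ u ∈ Finset.range U, if Even u then rowDefect n N σ u else 0 := by
  rw [weight_wall hn h h0 hX, weight_wall hn h h0 hX, Nat.cast_sum, Nat.cast_sum,
    ← Finset.sum_sub_distrib]
  dsimp only
  rw [sum_heights_eq hn _ _ hU]
  · refine Finset.sum_congr rfl fun u _ => ?_
    obtain ⟨i, rfl | rfl⟩ := Nat.even_or_odd' u
    · rw [if_pos (even_two_mul i), rowDefect, labelCount_sub (x := 2 * i * (n - 1) + 1)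
        (b := !σ (2 * i)) (by omega) (fun c => by rw [blk_half_succ hn, label_half_even hn])]
      split_ifs with hu
      · cases σ (2 * i) <;> simp [shapeSign]
      · rw [labelCount_sub (x := 2 * i * (n - 1)) (b := σ (2 * i)) (by omega)
          (fun c => by rw [blk_half hn (by omega), label_half_even hn])]
        cases σ (2 * i) <;> simp [shapeSign]
        ring
    · have e1 : ∀ c, label n (blk n σ c ((2 * i + 1) * (n - 1) + 1)) = _ := fun c => by
        rw [blk_half_succ hn, label_half_odd hn]
      have e2 : ∀ c, label n (blk n σ c ((2 * i + 1) * (n - 1))) = _ := fun c => by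
        rw [blk_half hn (by omega), label_half_odd hn]
      rw [if_neg (by simp), labelCount_eq_zero (by omega) (by omega) e1,
        labelCount_eq_zero (by omega) (by omega) e1, labelCount_eq_zero (by omega) (by omega) e2,
        labelCount_eq_zero (by omega) (by omega) e2]
      simp
  · intro j t h1 ht
    obtain ⟨i, rfl | rfl⟩ := Nat.even_or_odd' j
    · rw [labelCount_const (l' := t + 1) (fun c => by
        rw [blk_full hn _ _ h1 ht, label_full_even hn _ _ _ h1 ht]),
        labelCount_const (l' := t + 1) (fun c => by
        rw [blk_full hn _ _ h1 ht, label_full_even hn _ _ _ h1 ht])]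
      rw [if_neg (by simp), if_neg (by omega)]
      simp
    · rw [labelCount_const (l' := n - 1 - t) (fun c => by
        rw [blk_full hn _ _ h1 ht, label_full_odd hn _ _ _ h1 ht]),
        labelCount_const (l' := n - 1 - t) (fun c => by
        rw [blk_full hn _ _ h1 ht, label_full_odd hn _ _ _ h1 ht])]
      rw [if_neg (by omega), if_neg (by omega)]
      simp

lemma weight_top_sub (hn : 4 ≤ n) (h : Antitone N) (h0 : σ 0 = false) {U : ℕ} (hU : 1 ≤ U)
    (hX : N (U * (n - 1)) = 0) :
    (weight n (wall n N σ) ⟨n - 1, by omega⟩ : ℤ) - weight n (wall n N σ) ⟨n, by omega⟩ =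
      ∑ u ∈ Finset.range U, if Even u then 0 else rowDefect n N σ u := by
  rw [weight_wall hn h h0 hX, weight_wall hn h h0 hX, Nat.cast_sum, Nat.cast_sum,
    ← Finset.sum_sub_distrib]
  dsimp only
  rw [sum_heights_eq hn _ _ hU]
  · refine Finset.sum_congr rfl fun u _ => ?_
    obtain ⟨i, rfl | rfl⟩ := Nat.even_or_odd' u
    · have e1 : ∀ c, label n (blk n σ c (2 * i * (n - 1) + 1)) = _ := fun c => by
        rw [blk_half_succ hn, label_half_even hn]
      rw [if_pos (even_two_mul i), labelCount_eq_zero (by omega) (by omega) e1,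
        labelCount_eq_zero (by omega) (by omega) e1]
      split_ifs with hu
      · simp
      · have e2 : ∀ c, label n (blk n σ c (2 * i * (n - 1))) = _ := fun c => by
          rw [blk_half hn (by omega), label_half_even hn]
        rw [labelCount_eq_zero (by omega) (by omega) e2,
          labelCount_eq_zero (by omega) (by omega) e2]
        simp
    · rw [if_neg (show ¬ Even (2 * i + 1) by simp), rowDefect,
        labelCount_sub (x := (2 * i + 1) * (n - 1) + 1)
        (b := !σ (2 * i + 1)) (by omega)
        (fun c => by rw [blk_half_succ hn, label_half_odd hn]),
        if_neg (show ¬ 2 * i + 1 = 0 by omega), if_neg (show ¬ 2 * i + 1 = 0 by omega),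
        labelCount_sub (x := (2 * i + 1) * (n - 1)) (b := σ (2 * i + 1))
          (by omega) (fun c => by rw [blk_half hn (by omega), label_half_odd hn])]
      cases σ (2 * i + 1) <;> simp [shapeSign]
      ring
  · intro j t h1 ht
    obtain ⟨i, rfl | rfl⟩ := Nat.even_or_odd' j
    · rw [labelCount_const (l' := t + 1) (fun c => by
        rw [blk_full hn _ _ h1 ht, label_full_even hn _ _ _ h1 ht]),
        labelCount_const (l' := t + 1) (fun c => by
        rw [blk_full hn _ _ h1 ht, label_full_even hn _ _ _ h1 ht])]
      rw [if_neg (by omega), if_neg (by omega)]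
      simp
    · rw [labelCount_const (l' := n - 1 - t) (fun c => by
        rw [blk_full hn _ _ h1 ht, label_full_odd hn _ _ _ h1 ht]),
        labelCount_const (l' := n - 1 - t) (fun c => by
        rw [blk_full hn _ _ h1 ht, label_full_odd hn _ _ _ h1 ht])]
      rw [if_neg (by omega), if_neg (by omega)]
      simp

end

/-! ### Walls of beads -/

section

variable {n : ℕ} {D : Finset ℤ} {κ : ℕ →₀ ℕ}

/-- The number of beads at positions `≥ x`, for one bead at `|y|` for each `y ∈ D` and `2 κ i`
beads at `(i + 1) (n - 1)`. -/
def tailCount (n : ℕ) (D : Finset ℤ) (κ : ℕ →₀ ℕ) (x : ℕ) : ℕ :=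
  (D.filter fun y => x ≤ y.natAbs).card +
    2 * κ.sum fun i m => if x ≤ (i + 1) * (n - 1) then m else 0

/-- The shape of the beads at the position `u (n - 1)`. If only one of `± u (n - 1)` is in `D`,
the shape is such that the `rowDefect` is the sign of that element. If none of them or both of them
are in `D`, there is an even number of beads, whose shape does not affect the weight and records
which of the two cases occurs. -/
def beadShape (n : ℕ) (D : Finset ℤ) (κ : ℕ →₀ ℕ) (u : ℕ) : Bool :=
  if u = 0 then false
  else if ((u * (n - 1) : ℕ) : ℤ) ∈ D then
    if -((u * (n - 1) : ℕ) : ℤ) ∈ D then true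
    else decide (Even (tailCount n D κ (u * (n - 1) + 1)))
  else if -((u * (n - 1) : ℕ) : ℤ) ∈ D then decide (Odd (tailCount n D κ (u * (n - 1) + 1)))
    else false

/-- The wall with one column of height `|y|` for each `y ∈ D`, and `2 κ i` further columns of height
`(i + 1) (n - 1)`. -/
def beadWall (n : ℕ) (D : Finset ℤ) (κ : ℕ →₀ ℕ) : Set Block :=
  wall n (tailCount n D κ) (beadShape n D κ)

lemma card_filter_natAbs_eq (D : Finset ℤ) {x : ℕ} (hx : 1 ≤ x) :
    (D.filter fun y => y.natAbs = x).card =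
      (if (x : ℤ) ∈ D then 1 else 0) + if -(x : ℤ) ∈ D then 1 else 0 := by
  have h : (D.filter fun y => y.natAbs = x) =
      (D.filter fun y => y = (x : ℤ)) ∪ D.filter fun y => y = -(x : ℤ) := by
    ext y
    simp only [Finset.mem_filter, Finset.mem_union, ← and_or_left]
    refine and_congr_right fun _ => ?_
    omega
  rw [h, Finset.card_union_of_disjoint, Finset.filter_eq', Finset.filter_eq']
  · split_ifs <;> simp
  · rw [Finset.disjoint_filter]
    intro y _ h1 h2
    omega

lemma tailCount_eq (hn : 4 ≤ n) {x : ℕ} (hx : 1 ≤ x) :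
    tailCount n D κ x = tailCount n D κ (x + 1) + (if (x : ℤ) ∈ D then 1 else 0) +
      (if -(x : ℤ) ∈ D then 1 else 0) +
      if (n - 1) ∣ x then 2 * κ (x / (n - 1) - 1) else 0 := by
  have h1 : (D.filter fun y => x ≤ y.natAbs).card =
      (D.filter fun y => x + 1 ≤ y.natAbs).card + (D.filter fun y => y.natAbs = x).card := by
    rw [← Finset.card_union_of_disjoint]
    · congr 1
      ext y
      simp only [Finset.mem_filter, Finset.mem_union, ← and_or_left]
      refine and_congr_right fun _ => ?_
      omega
    · rw [Finset.disjoint_filter]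
      intro y _ h1 h2
      omega
  have h2 : (κ.sum fun i m => if x ≤ (i + 1) * (n - 1) then m else 0) =
      (κ.sum fun i m => if x + 1 ≤ (i + 1) * (n - 1) then m else 0) +
        if (n - 1) ∣ x then κ (x / (n - 1) - 1) else 0 := by
    have h3 : (if (n - 1) ∣ x then κ (x / (n - 1) - 1) else 0) =
        κ.sum fun i m => if x = (i + 1) * (n - 1) then m else 0 := by
      split_ifs with hd
      · obtain ⟨u, rfl⟩ := hd
        have hu : 1 ≤ u := Nat.pos_of_ne_zero (by rintro rfl; simp at hx)
        rw [Nat.mul_div_cancel_left _ (by omega), Finsupp.sum,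
          Finset.sum_eq_single (u - 1)]
        · rw [if_pos (by rw [Nat.sub_add_cancel hu, mul_comm])]
        · intro i _ hi
          rw [if_neg]
          rw [mul_comm]
          intro h
          have := Nat.eq_of_mul_eq_mul_right (show 0 < n - 1 by omega) h
          omega
        · intro h
          rw [Finsupp.notMem_support_iff.1 h]
          simp
      · rw [Finsupp.sum, Finset.sum_eq_zero]
        intro i _
        rw [if_neg]
        rintro rfl
        exact hd (Dvd.intro_left _ rfl)
    rw [h3, Finsupp.sum, Finsupp.sum, Finsupp.sum, ← Finset.sum_add_distrib]
    refine Finset.sum_congr rfl fun i _ => ?_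
    split_ifs <;> omega
  rw [tailCount, tailCount, h1, h2, card_filter_natAbs_eq D hx]
  split_ifs <;> ring

lemma tailCount_half (hn : 4 ≤ n) {u : ℕ} (hu : 1 ≤ u) :
    tailCount n D κ (u * (n - 1)) = tailCount n D κ (u * (n - 1) + 1) +
      (if ((u * (n - 1) : ℕ) : ℤ) ∈ D then 1 else 0) +
      (if -((u * (n - 1) : ℕ) : ℤ) ∈ D then 1 else 0) + 2 * κ (u - 1) := by
  rw [tailCount_eq hn (Nat.mul_pos hu (by omega)), if_pos (Dvd.intro_left _ rfl),
    Nat.mul_div_cancel _ (by omega)]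

/-- The residues of the beads: each class `± k` modulo `2 n - 2` is represented once, except
for the classes `0` and `n - 1`, which are their own negatives. -/
def IsReduced (n : ℕ) (D : Finset ℤ) : Prop := ∀ y ∈ D, y % (2 * n - 2) < n

lemma mod_two_mul_of_dvd (hn : 4 ≤ n) {y : ℤ} (hd : ((n - 1 : ℕ) : ℤ) ∣ y) :
    y % (2 * n - 2) = 0 ∨ y % (2 * n - 2) = n - 1 := by
  obtain ⟨c, rfl⟩ := hd
  have hc : ((n - 1 : ℕ) : ℤ) = n - 1 := by omega
  rw [hc]
  rcases Int.even_or_odd' c with ⟨k, rfl | rfl⟩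
  · left
    rw [show ((n : ℤ) - 1) * (2 * k) = (2 * n - 2) * k by ring, Int.mul_emod_right]
  · right
    rw [show ((n : ℤ) - 1) * (2 * k + 1) = (n - 1) + (2 * n - 2) * k by ring,
      Int.add_mul_emod_self_left, Int.emod_eq_of_lt (by omega) (by omega)]

lemma dvd_of_mod_two_mul (hn : 4 ≤ n) {y : ℤ}
    (h : y % (2 * n - 2) = 0 ∨ y % (2 * n - 2) = n - 1) : ((n - 1 : ℕ) : ℤ) ∣ y := by
  have hc : ((n - 1 : ℕ) : ℤ) = n - 1 := by omega
  have := Int.emod_add_mul_ediv y (2 * n - 2)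
  rw [hc]
  rcases h with h | h
  · exact ⟨2 * (y / (2 * n - 2)), by conv_lhs => rw [← this, h]
                                     ring⟩
  · exact ⟨2 * (y / (2 * n - 2)) + 1, by conv_lhs => rw [← this, h]
                                         ring⟩

lemma neg_emod_of (hn : 4 ≤ n) {y : ℤ} (h : y % (2 * n - 2) ≠ 0) :
    (-y) % (2 * n - 2) = 2 * n - 2 - y % (2 * n - 2) := by
  have h0 := Int.emod_nonneg y (show (2 * n - 2 : ℤ) ≠ 0 by omega)
  have h1 := Int.emod_lt_of_pos y (show (0 : ℤ) < 2 * n - 2 by omega)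
  have := Int.emod_add_mul_ediv y (2 * n - 2)
  rw [show -y = (2 * n - 2 - y % (2 * n - 2)) + (2 * n - 2) * (-(y / (2 * n - 2)) - 1) by
    conv_lhs => rw [← this]
    ring, Int.add_mul_emod_self_left, Int.emod_eq_of_lt (by omega) (by omega)]

lemma IsReduced.neg_notMem (hn : 4 ≤ n) (hD : IsReduced n D) {y : ℤ} (hy : y ∈ D)
    (hd : ¬ ((n - 1 : ℕ) : ℤ) ∣ y) : -y ∉ D := by
  intro h
  have h1 := hD y hy
  have h2 := hD _ h
  have h3 : y % (2 * n - 2) ≠ 0 := fun h => hd (dvd_of_mod_two_mul hn (Or.inl h))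
  have h4 : y % (2 * n - 2) ≠ n - 1 := fun h => hd (dvd_of_mod_two_mul hn (Or.inr h))
  rw [neg_emod_of hn h3] at h2
  omega

lemma tailCount_antitone : Antitone (tailCount n D κ) := by
  intro x y hxy
  unfold tailCount
  refine Nat.add_le_add (Finset.card_le_card fun z hz => ?_)
    (Nat.mul_le_mul_left _ (Finset.sum_le_sum fun i _ => ?_))
  · rw [Finset.mem_filter] at hz ⊢
    exact ⟨hz.1, hxy.trans hz.2⟩
  · dsimp only
    split_ifs <;> omega

lemma exists_tailCount_eq_zero (D : Finset ℤ) (κ : ℕ →₀ ℕ) :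
    ∃ X, tailCount n D κ X = 0 := by
  refine ⟨D.sup Int.natAbs + (κ.support.sup id + 1) * (n - 1) + 1, ?_⟩
  rw [tailCount, Nat.add_eq_zero_iff]
  constructor
  · rw [Finset.card_eq_zero, Finset.filter_eq_empty_iff]
    intro y hy h
    have := Finset.le_sup (f := Int.natAbs) hy
    omega
  · rw [Finsupp.sum, Finset.sum_eq_zero, Nat.mul_zero]
    intro i hi
    have h1 : i ≤ κ.support.sup id := Finset.le_sup (f := id) hi
    have h2 : (i + 1) * (n - 1) ≤ (κ.support.sup id + 1) * (n - 1) :=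
      Nat.mul_le_mul_right _ (by omega)
    rw [if_neg (by omega)]

theorem isProfile_beads (hn : 4 ≤ n) (hD : IsReduced n D) (κ : ℕ →₀ ℕ) :
    IsProfile n (tailCount n D κ) (beadShape n D κ) where
  anti := tailCount_antitone
  zero := exists_tailCount_eq_zero D κ
  step := by
    intro x hx
    have hx1 : 1 ≤ x := Nat.pos_of_ne_zero fun h => hx (h ▸ dvd_zero _)
    rw [tailCount_eq hn hx1, if_neg hx]
    by_cases h : (x : ℤ) ∈ D
    · have := hD.neg_notMem hn h (by rwa [Int.natCast_dvd_natCast])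
      simp [h, this]
    · simp only [h, if_false]
      split_ifs <;> omega
  lower := by simp [beadShape]

theorem isYoungWall_beadWall (hn : 4 ≤ n) (hD : IsReduced n D) (κ : ℕ →₀ ℕ) :
    IsYoungWall n (beadWall n D κ) :=
  isYoungWall_wall hn (isProfile_beads hn hD κ)

lemma rowDefect_beads (hn : 4 ≤ n) {u : ℕ} (hu : 1 ≤ u) :
    rowDefect n (tailCount n D κ) (beadShape n D κ) u =
      (if ((u * (n - 1) : ℕ) : ℤ) ∈ D then 1 else 0) -
      (if -((u * (n - 1) : ℕ) : ℤ) ∈ D then 1 else 0) := by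
  have h0 : u ≠ 0 := by omega
  rw [rowDefect, if_neg h0, tailCount_half hn hu, beadShape, if_neg h0]
  generalize tailCount n D κ (u * (n - 1) + 1) = t
  generalize κ (u - 1) = k
  rcases Nat.even_or_odd t with ht | ht
  · have h1 := Nat.even_iff.1 ht
    have h2 : ¬ Odd t := Nat.not_odd_iff_even.2 ht
    have e1 : (t + 1 + 2 * k) % 2 = 1 := by omega
    have e2 : (t + 2 * k) % 2 = 0 := by omega
    split_ifs <;> simp [ht, h2, shapeSign, h1, e1, e2, -Nat.cast_mul]
    omega
  · have h1 := Nat.odd_iff.1 ht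
    have h2 : ¬ Even t := Nat.not_even_iff_odd.2 ht
    have e1 : (t + 1 + 2 * k) % 2 = 0 := by omega
    have e2 : (t + 2 * k) % 2 = 1 := by omega
    split_ifs <;> simp [ht, h2, shapeSign, h1, e1, e2, -Nat.cast_mul]
    omega

lemma tailCount_one_add :
    (tailCount n D κ 1 + if (0 : ℤ) ∈ D then 1 else 0) % 2 = D.card % 2 := by
  have h := Finset.card_filter_add_card_filter_not (s := D) fun y => 1 ≤ y.natAbs
  have h2 : (D.filter fun y => ¬ 1 ≤ y.natAbs).card = if (0 : ℤ) ∈ D then 1 else 0 := by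
    rw [show (D.filter fun y => ¬ 1 ≤ y.natAbs) = D.filter fun y => y = 0 from
      Finset.filter_congr fun y _ => by omega, Finset.filter_eq']
    split_ifs <;> simp
  rw [← h2, tailCount]
  omega

/-- In the row `0`, only the upper left half-blocks count. The parity of their number is recorded by
the bead `0`, since the number of beads is even. -/
lemma rowDefect_beads_zero (hD : Even D.card) :
    rowDefect n (tailCount n D κ) (beadShape n D κ) 0 = if (0 : ℤ) ∈ D then 1 else 0 := by
  have h := tailCount_one_add (n := n) (κ := κ) (D := D)
  rw [Nat.even_iff.1 hD] at h
  have h' : tailCount n D κ 1 % 2 = if (0 : ℤ) ∈ D then 1 else 0 := by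
    split_ifs at h ⊢ <;> omega
  simp only [rowDefect, beadShape, shapeSign, Nat.zero_mul, Nat.zero_add, h']
  by_cases hz : (0 : ℤ) ∈ D <;> simp [hz]

/-- The number of heights of level `l` up to `s`, which is the contribution of one column of height
`s` to `levelSum`. -/
def levelCount (n l s : ℕ) : ℕ := ((Finset.Ico 1 (s + 1)).filter (AtLevel n l)).card

lemma levelSum_beads {X : ℕ} (hX : tailCount n D κ X = 0) (l : ℕ) :
    levelSum n (tailCount n D κ) X l = ∑ y ∈ D, levelCount n l y.natAbs +
      2 * κ.sum fun i m => m * levelCount n l ((i + 1) * (n - 1)) := by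
  have hX0 : (D.filter fun y => X ≤ y.natAbs).card = 0 ∧
      (κ.sum fun i m => if X ≤ (i + 1) * (n - 1) then m else 0) = 0 := by
    rw [tailCount] at hX
    omega
  have hD : ∀ y ∈ D, y.natAbs < X := by
    intro y hy
    have := Finset.filter_eq_empty_iff.1 (Finset.card_eq_zero.1 hX0.1) hy
    omega
  have hκ : ∀ i ∈ κ.support, (i + 1) * (n - 1) < X := by
    intro i hi
    have := (Finset.sum_eq_zero_iff.1 hX0.2) i hi
    by_contra h
    dsimp only at this
    rw [if_pos (by omega)] at this
    exact Finsupp.mem_support_iff.1 hi this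
  have key : ∀ s, s < X → levelCount n l s =
      ∑ x ∈ Finset.Ico 1 X, if AtLevel n l x then (if x ≤ s then 1 else 0) else 0 := by
    intro s hs
    rw [← Finset.sum_filter, ← Finset.sum_filter, ← Finset.card_eq_sum_ones, levelCount]
    congr 1
    ext x
    simp only [Finset.mem_filter, Finset.mem_Ico]
    constructor
    · rintro ⟨h1, h2⟩
      exact ⟨⟨⟨h1.1, by omega⟩, h2⟩, by omega⟩
    · rintro ⟨⟨h1, h2⟩, h3⟩
      exact ⟨⟨h1.1, by omega⟩, h2⟩
  have h1 : ∑ y ∈ D, levelCount n l y.natAbs = ∑ x ∈ Finset.Ico 1 X, if AtLevel n l x then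
      (D.filter fun y => x ≤ y.natAbs).card else 0 := by
    rw [Finset.sum_congr rfl fun y hy => key _ (hD y hy), Finset.sum_comm]
    refine Finset.sum_congr rfl fun x _ => ?_
    split_ifs
    · rw [Finset.card_filter]
    · simp
  have h2 : (κ.sum fun i m => m * levelCount n l ((i + 1) * (n - 1))) =
      ∑ x ∈ Finset.Ico 1 X, if AtLevel n l x then
        (κ.sum fun i m => if x ≤ (i + 1) * (n - 1) then m else 0) else 0 := by
    rw [Finsupp.sum, Finset.sum_congr rfl fun i hi => by rw [key _ (hκ i hi), Finset.mul_sum],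
      Finset.sum_comm]
    refine Finset.sum_congr rfl fun x _ => ?_
    split_ifs
    · rw [Finsupp.sum]
      refine Finset.sum_congr rfl fun i _ => ?_
      split_ifs <;> simp
    · simp
  rw [h1, h2, levelSum, Finset.mul_sum, ← Finset.sum_add_distrib]
  refine Finset.sum_congr rfl fun x _ => ?_
  split_ifs <;> simp [tailCount]

lemma levelCount_eq (hn : 4 ≤ n) {l : ℕ} (hl : 1 ≤ l) (hl' : l ≤ n - 1) (s : ℕ) :
    levelCount n l s = 2 * (s / (2 * n - 2)) + (if l ≤ s % (2 * n - 2) then 1 else 0) +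
      if 2 * n - 2 - l < s % (2 * n - 2) then 1 else 0 := by
  have h1 : levelCount n l s = ((Finset.range s).filter fun z =>
      z % (2 * n - 2) = l - 1 ∨ z % (2 * n - 2) = 2 * n - 2 - l).card := by
    rw [levelCount, ← Finset.card_map (s := (Finset.range s).filter _) (addRightEmbedding 1)]
    congr 1
    ext x
    simp only [Finset.mem_filter, Finset.mem_Ico, Finset.mem_map, Finset.mem_range,
      addRightEmbedding_apply, AtLevel]
    constructor
    · rintro ⟨h1, h2⟩
      exact ⟨x - 1, ⟨by omega, h2⟩, by omega⟩
    · rintro ⟨z, ⟨h1, h2⟩, rfl⟩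
      exact ⟨by omega, by simpa using h2⟩
  have h2 : ∀ v, v < 2 * n - 2 → ((Finset.range s).filter fun z => z % (2 * n - 2) = v).card =
      s / (2 * n - 2) + if v < s % (2 * n - 2) then 1 else 0 := by
    intro v hv
    have := Nat.count_modEq_card s (show 0 < 2 * n - 2 by omega) v
    rw [Nat.count_eq_card_filter_range, Nat.mod_eq_of_lt hv] at this
    rw [← this]
    congr 1
    refine Finset.filter_congr fun z _ => ?_
    rw [Nat.ModEq, Nat.mod_eq_of_lt hv]
  rw [h1, Finset.filter_or, Finset.card_union_of_disjoint, h2 _ (by omega), h2 _ (by omega)]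
  · have : (l - 1 < s % (2 * n - 2)) ↔ l ≤ s % (2 * n - 2) := by omega
    simp only [this]
    ring
  · rw [Finset.disjoint_filter]
    intro z _ h3 h4
    omega

/-- The sign of a bead, with `0` counted as positive. -/
def beadSign (d : ℤ) : ℤ := if 0 ≤ d then 1 else -1

/-- A column of height `|d (2 n - 2) + k|` has two blocks of each level for each unit of `|d|`, and
one more or less, according to the sign, of the levels up to `k`. -/
lemma levelCount_bead (hn : 4 ≤ n) {l k : ℕ} (hl : 1 ≤ l) (hl' : l ≤ n - 1) (hk : k < n)
    (d : ℤ) : (levelCount n l (d * (2 * n - 2) + k).natAbs : ℤ) =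
      2 * d.natAbs + if l ≤ k then beadSign d else 0 := by
  rw [levelCount_eq hn hl hl', beadSign]
  rcases le_or_gt 0 d with h | h
  · obtain ⟨i, rfl⟩ := Int.eq_ofNat_of_zero_le h
    have e : ((i : ℤ) * (2 * n - 2) + k).natAbs = i * (2 * n - 2) + k := by
      zify [show 2 ≤ 2 * n by omega]
      rw [abs_of_nonneg]
      have : (0 : ℤ) ≤ i * (2 * n - 2) := mul_nonneg (by omega) (by omega)
      omega
    rw [e, mul_add_div_of_lt (by omega), mul_add_mod_of_lt (by omega),
      if_neg (show ¬ 2 * n - 2 - l < k by omega)]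
    simp
  · obtain ⟨i, rfl⟩ : ∃ i : ℕ, d = -(i + 1 : ℤ) := ⟨(-d - 1).toNat, by omega⟩
    have e : (-(i + 1 : ℤ) * (2 * n - 2) + k).natAbs = i * (2 * n - 2) + (2 * n - 2 - k) := by
      zify [show 2 ≤ 2 * n by omega, show k ≤ 2 * n - 2 by omega]
      have : (0 : ℤ) ≤ i * (2 * n - 2) := mul_nonneg (by omega) (by omega)
      rw [show -(i + 1 : ℤ) * (2 * n - 2) + k = -(i * (2 * n - 2) + (2 * n - 2 - k)) by ring,
        abs_neg, abs_of_nonneg (add_nonneg this (by omega))]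
    have e2 : (-(i + 1 : ℤ)).natAbs = i + 1 := by omega
    rw [e, e2, if_neg (show ¬ (0 : ℤ) ≤ -(i + 1) by omega)]
    rcases Nat.eq_zero_or_pos k with rfl | hk0
    · rw [Nat.sub_zero, ← Nat.succ_mul, Nat.mul_div_cancel _ (by omega), Nat.mul_mod_left,
        if_neg (show ¬ l ≤ 0 by omega), if_neg (show ¬ 2 * n - 2 - l < 0 by omega)]
      push_cast
      omega
    · rw [mul_add_div_of_lt (by omega), mul_add_mod_of_lt (by omega)]
      split_ifs <;> push_cast <;> omega

lemma levelCount_half (hn : 4 ≤ n) {l : ℕ} (hl : 1 ≤ l) (hl' : l ≤ n - 1) (u : ℕ) :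
    levelCount n l (u * (n - 1)) = u := by
  rw [levelCount_eq hn hl hl']
  obtain ⟨i, rfl | rfl⟩ := Nat.even_or_odd' u
  · rw [show 2 * i * (n - 1) = i * (2 * (n - 1)) by ring, show 2 * n - 2 = 2 * (n - 1) by omega,
      Nat.mul_div_cancel _ (by omega), Nat.mul_mod_left, if_neg (by omega), if_neg (by omega)]
    omega
  · rw [show (2 * i + 1) * (n - 1) = i * (2 * (n - 1)) + (n - 1) by ring,
      show 2 * n - 2 = 2 * (n - 1) by omega, mul_add_div_of_lt (by omega),
      mul_add_mod_of_lt (by omega), if_pos (by omega), if_neg (by omega)]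

end

/-! ### Charge, energy and weight -/

section

variable {n : ℕ} {E : Fin n → Finset ℤ} {κ : ℕ →₀ ℕ}

/-- The set of all integers `d (2 n - 2) + k` with `d ∈ E k`. -/
def beads (n : ℕ) (E : Fin n → Finset ℤ) : Finset ℤ :=
  Finset.univ.biUnion fun k => (E k).image fun d => d * (2 * n - 2) + (k : ℕ)

/-- The number of non-negative elements minus the number of negative ones. -/
def charge (F : Finset ℤ) : ℤ := ∑ d ∈ F, beadSign d

/-- The sum of the absolute values. -/
def energy (F : Finset ℤ) : ℕ := ∑ d ∈ F, d.natAbs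

lemma bead_div_mod (hn : 4 ≤ n) (d : ℤ) {k : ℕ} (hk : k < n) :
    (d * (2 * n - 2) + k) / (2 * n - 2) = d ∧ (d * (2 * n - 2) + k) % (2 * n - 2) = k := by
  rw [Int.add_comm, Int.add_mul_ediv_right _ _ (by omega), Int.add_mul_emod_self_right,
    Int.ediv_eq_zero_of_lt (by omega) (by omega), Int.emod_eq_of_lt (by omega) (by omega)]
  simp

lemma bead_injective (hn : 4 ≤ n) {d d' : ℤ} {k k' : ℕ} (hk : k < n) (hk' : k' < n)
    (h : d * (2 * n - 2) + k = d' * (2 * n - 2) + k') : d = d' ∧ k = k' := by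
  have h1 := bead_div_mod hn d hk
  have h2 := bead_div_mod hn d' hk'
  rw [h] at h1
  exact ⟨h1.1.symm.trans h2.1, by exact_mod_cast h1.2.symm.trans h2.2⟩

lemma mem_beads_iff {y : ℤ} :
    y ∈ beads n E ↔ ∃ k : Fin n, ∃ d ∈ E k, d * (2 * n - 2) + (k : ℕ) = y := by
  simp [beads]

lemma mem_beads (hn : 4 ≤ n) (k : Fin n) (d : ℤ) :
    d * (2 * n - 2) + (k : ℕ) ∈ beads n E ↔ d ∈ E k := by
  rw [mem_beads_iff]
  constructor
  · rintro ⟨k', d', h, he⟩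
    obtain ⟨rfl, hk⟩ := bead_injective hn k'.2 k.2 he
    rwa [Fin.ext hk] at h
  · exact fun h => ⟨k, d, h, rfl⟩

lemma isReduced_beads (hn : 4 ≤ n) (E : Fin n → Finset ℤ) : IsReduced n (beads n E) := by
  intro y hy
  obtain ⟨k, d, -, rfl⟩ := mem_beads_iff.1 hy
  rw [(bead_div_mod hn d k.2).2]
  exact_mod_cast k.2

lemma sum_beads (hn : 4 ≤ n) {M : Type*} [AddCommMonoid M] (g : ℤ → M) :
    ∑ y ∈ beads n E, g y = ∑ k : Fin n, ∑ d ∈ E k, g (d * (2 * n - 2) + (k : ℕ)) := by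
  rw [beads, Finset.sum_biUnion]
  · refine Finset.sum_congr rfl fun k _ => ?_
    rw [Finset.sum_image]
    exact fun d _ d' _ h => (bead_injective hn k.2 k.2 h).1
  · intro k _ k' _ hk
    rw [Function.onFun, Finset.disjoint_left]
    intro y h1 h2
    obtain ⟨d, -, rfl⟩ := Finset.mem_image.1 h1
    obtain ⟨d', -, h⟩ := Finset.mem_image.1 h2
    exact hk (Fin.ext (bead_injective hn k'.2 k.2 h).2).symm

lemma even_charge_iff (F : Finset ℤ) : Even (charge F) ↔ Even (F.card : ℤ) := by
  rw [← Int.even_sub, charge, Finset.card_eq_sum_ones, Nat.cast_sum, ← Finset.sum_sub_distrib]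
  refine Finset.even_sum _ fun d _ => ?_
  rw [beadSign]
  split_ifs
  · simp
  · exact ⟨-1, by norm_num⟩

lemma even_card_beads (hn : 4 ≤ n) :
    Even (beads n E).card ↔ Even (∑ k, charge (E k)) := by
  have h : ((beads n E).card : ℤ) = ∑ k, ((E k).card : ℤ) := by
    rw [Finset.card_eq_sum_ones, sum_beads hn]
    simp
  rw [← Int.even_coe_nat, h, ← Int.even_sub, ← Finset.sum_sub_distrib]
  refine Finset.even_sum _ fun k _ => ?_
  rw [Int.even_sub, even_charge_iff]

/-- The energy of the beads `E`, plus the size of the partition with `κ i` parts `i + 1`. -/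
def totalEnergy (E : Fin n → Finset ℤ) (κ : ℕ →₀ ℕ) : ℕ :=
  ∑ k, energy (E k) + κ.sum fun i m => m * (i + 1)

lemma levelSum_eq (hn : 4 ≤ n) {X : ℕ} (hX : tailCount n (beads n E) κ X = 0) {l : ℕ}
    (hl : 1 ≤ l) (hl' : l ≤ n - 1) :
    (levelSum n (tailCount n (beads n E) κ) X l : ℤ) =
      2 * totalEnergy E κ + ∑ k : Fin n, if l ≤ (k : ℕ) then charge (E k) else 0 := by
  rw [levelSum_beads hX, sum_beads hn]
  simp only [levelCount_half hn hl hl']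
  push_cast [totalEnergy]
  have h : ∀ k : Fin n, ∑ d ∈ E k, (levelCount n l (d * (2 * n - 2) + (k : ℕ)).natAbs : ℤ) =
      2 * (energy (E k) : ℤ) + if l ≤ (k : ℕ) then charge (E k) else 0 := by
    intro k
    rw [Finset.sum_congr rfl fun d _ => levelCount_bead hn hl hl' k.2 d, Finset.sum_add_distrib,
      ← Finset.mul_sum, energy, Nat.cast_sum]
    congr 1
    split_ifs
    · rfl
    · simp
  rw [Finset.sum_congr rfl fun k _ => h k, Finset.sum_add_distrib, ← Finset.mul_sum]
  ring

lemma sum_range_two_mul (g : ℕ → ℤ) (K : ℕ) :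
    ∑ u ∈ Finset.range (2 * K), g u = ∑ i ∈ Finset.range K, (g (2 * i) + g (2 * i + 1)) := by
  induction K with
  | zero => simp
  | succ K ih =>
    rw [show 2 * (K + 1) = 2 * K + 1 + 1 by ring, Finset.sum_range_succ, Finset.sum_range_succ, ih,
      Finset.sum_range_succ]
    ring

/-- The charge as a sum over the pairs of elements `i` and `-1 - i`, which in the residue class
`n - 1` are the beads of opposite sign at the same position. -/
lemma charge_eq_sum_range {F : Finset ℤ} {K : ℕ} (hF : ∀ d ∈ F, -(K : ℤ) ≤ d ∧ d < K) :
    charge F = ∑ i ∈ Finset.range K,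
      ((if (i : ℤ) ∈ F then 1 else 0) - if -(i + 1 : ℤ) ∈ F then 1 else 0) := by
  have h1 : (F.filter fun d => 0 ≤ d) =
      ((Finset.range K).filter fun i : ℕ => (i : ℤ) ∈ F).image (fun i : ℕ => (i : ℤ)) := by
    ext d
    simp only [Finset.mem_filter, Finset.mem_image, Finset.mem_range]
    constructor
    · rintro ⟨h1, h2⟩
      obtain ⟨i, rfl⟩ := Int.eq_ofNat_of_zero_le h2
      exact ⟨i, ⟨by have := hF _ h1; omega, h1⟩, rfl⟩
    · rintro ⟨i, ⟨-, h⟩, rfl⟩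
      exact ⟨h, by omega⟩
  have h2 : (F.filter fun d => ¬ 0 ≤ d) =
      ((Finset.range K).filter fun i : ℕ => -(i + 1 : ℤ) ∈ F).image
        (fun i : ℕ => -(i + 1 : ℤ)) := by
    ext d
    simp only [Finset.mem_filter, Finset.mem_image, Finset.mem_range]
    constructor
    · rintro ⟨h1, h2⟩
      obtain ⟨i, rfl⟩ : ∃ i : ℕ, d = -(i + 1 : ℤ) := ⟨(-d - 1).toNat, by omega⟩
      exact ⟨i, ⟨by have := hF _ h1; omega, h1⟩, rfl⟩
    · rintro ⟨i, ⟨-, h⟩, rfl⟩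
      exact ⟨h, by omega⟩
  rw [charge]
  simp only [beadSign]
  rw [Finset.sum_ite, h1, h2, Finset.sum_sub_distrib, Finset.sum_image, Finset.sum_image,
    ← Finset.sum_filter, ← Finset.sum_filter]
  · simp
    ring
  · intro a _ b _ h
    simp only at h
    omega
  · intro a _ b _ h
    simpa using h

lemma half_even_eq (hn : 4 ≤ n) (i : ℕ) :
    ((2 * i * (n - 1) : ℕ) : ℤ) = (i : ℤ) * (2 * n - 2) := by
  push_cast [show 1 ≤ n by omega]
  ring

lemma half_odd_eq (hn : 4 ≤ n) (i : ℕ) :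
    (((2 * i + 1) * (n - 1) : ℕ) : ℤ) = (i : ℤ) * (2 * n - 2) + (n - 1 : ℕ) := by
  push_cast [show 1 ≤ n by omega]
  ring

lemma half_even_mem (hn : 4 ≤ n) (i : ℕ) :
    ((2 * i * (n - 1) : ℕ) : ℤ) ∈ beads n E ↔ (i : ℤ) ∈ E ⟨0, by omega⟩ := by
  rw [← mem_beads hn, half_even_eq hn]
  simp

lemma neg_half_even_mem (hn : 4 ≤ n) (i : ℕ) :
    -((2 * i * (n - 1) : ℕ) : ℤ) ∈ beads n E ↔ -(i : ℤ) ∈ E ⟨0, by omega⟩ := by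
  rw [← mem_beads hn, half_even_eq hn]
  simp

lemma half_odd_mem (hn : 4 ≤ n) (i : ℕ) :
    (((2 * i + 1) * (n - 1) : ℕ) : ℤ) ∈ beads n E ↔ (i : ℤ) ∈ E ⟨n - 1, by omega⟩ := by
  rw [← mem_beads hn, half_odd_eq hn]

lemma neg_half_odd_mem (hn : 4 ≤ n) (i : ℕ) :
    -(((2 * i + 1) * (n - 1) : ℕ) : ℤ) ∈ beads n E ↔ -(i + 1 : ℤ) ∈ E ⟨n - 1, by omega⟩ := by
  rw [← mem_beads hn, half_odd_eq hn]
  have : -((i : ℤ) * (2 * n - 2) + (n - 1 : ℕ)) = -(i + 1 : ℤ) * (2 * n - 2) + (n - 1 : ℕ) := by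
    push_cast [show 1 ≤ n by omega]
    ring
  rw [this]

lemma natAbs_lt_of_tailCount {D : Finset ℤ} {X : ℕ} (hX : tailCount n D κ X = 0) {y : ℤ}
    (hy : y ∈ D) : y.natAbs < X := by
  rw [tailCount, Nat.add_eq_zero_iff] at hX
  have := Finset.filter_eq_empty_iff.1 (Finset.card_eq_zero.1 hX.1) hy
  omega

lemma abs_lt_of_tailCount (hn : 4 ≤ n) {K : ℕ}
    (hX : tailCount n (beads n E) κ (2 * K * (n - 1)) = 0) (k : Fin n) {d : ℤ} (hd : d ∈ E k) :
    -(K : ℤ) ≤ d ∧ d < K ∧ ((k : ℕ) = 0 → d ≠ -(K : ℤ)) := by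
  have h := natAbs_lt_of_tailCount hX ((mem_beads hn k d).2 hd)
  have e := half_even_eq hn K
  have h2 : |d * (2 * n - 2) + (k : ℕ)| < (K : ℤ) * (2 * n - 2) := by
    rw [← e]
    zify at h ⊢
    exact h
  rw [abs_lt] at h2
  have hk : ((k : ℕ) : ℤ) < n := by exact_mod_cast k.2
  have hp : (0 : ℤ) < 2 * n - 2 := by omega
  refine ⟨?_, ?_, ?_⟩
  · by_contra hlt
    have : (d + 1) * (2 * n - 2) ≤ -(K : ℤ) * (2 * n - 2) :=
      mul_le_mul_of_nonneg_right (by omega) hp.le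
    nlinarith
  · by_contra hlt
    have : (K : ℤ) * (2 * n - 2) ≤ d * (2 * n - 2) := mul_le_mul_of_nonneg_right (by omega) hp.le
    omega
  · rintro h0 rfl
    rw [h0] at h2
    have := h2.1
    push_cast at this
    nlinarith

/-- The multi-weight of the wall of `E` and `κ` depends only on the total energy and the charges.
The numbers of blocks of each level are given by `levelSum_eq`; the blocks with label `0` and `1`,
and those with label `n - 1` and `n`, are separated by the sums of the `rowDefect`, which are the
charges of the residue classes `0` and `n - 1`. -/
theorem weight_beads (hn : 4 ≤ n) (hE : Even (∑ k, charge (E k))) :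
    (2 * weight n (beadWall n (beads n E) κ) ⟨0, by omega⟩ : ℤ) =
      2 * totalEnergy E κ + ∑ k, charge (E k) ∧
    (2 * weight n (beadWall n (beads n E) κ) ⟨1, by omega⟩ : ℤ) =
      2 * totalEnergy E κ + ∑ k, charge (E k) - 2 * charge (E ⟨0, by omega⟩) ∧
    (∀ j : Fin (n + 1), 2 ≤ (j : ℕ) → (j : ℕ) ≤ n - 2 →
      (weight n (beadWall n (beads n E) κ) j : ℤ) =
      2 * totalEnergy E κ + ∑ k : Fin n, if (j : ℕ) ≤ (k : ℕ) then charge (E k) else 0) ∧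
    (weight n (beadWall n (beads n E) κ) ⟨n - 1, by omega⟩ : ℤ) =
      totalEnergy E κ + charge (E ⟨n - 1, by omega⟩) ∧
    (weight n (beadWall n (beads n E) κ) ⟨n, by omega⟩ : ℤ) = totalEnergy E κ := by
  have hanti : Antitone (tailCount n (beads n E) κ) := tailCount_antitone
  have h0 : beadShape n (beads n E) κ 0 = false := by simp [beadShape]
  obtain ⟨K, hK, hX⟩ : ∃ K, 1 ≤ K ∧ tailCount n (beads n E) κ (2 * K * (n - 1)) = 0 := by
    obtain ⟨X, hX⟩ := exists_tailCount_eq_zero (n := n) (beads n E) κ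
    refine ⟨X + 1, by omega, Nat.le_zero.1 (hX ▸ hanti ?_)⟩
    calc X ≤ 2 * (X + 1) := by omega
      _ ≤ 2 * (X + 1) * (n - 1) := Nat.le_mul_of_pos_right _ (by omega)
  have hcard := (even_card_beads hn).2 hE
  -- In the class `0`, the beads `i` and `-i` share a row, and the row `0` has the bead `0` only.
  have e0 : ∑ u ∈ Finset.range (2 * K), (if Even u then
      rowDefect n (tailCount n (beads n E) κ) (beadShape n (beads n E) κ) u else 0) =
      charge (E ⟨0, by omega⟩) := by
    rw [sum_range_two_mul, charge_eq_sum_range fun d hd =>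
      ⟨(abs_lt_of_tailCount hn hX _ hd).1, (abs_lt_of_tailCount hn hX _ hd).2.1⟩]
    have hi : ∀ i, rowDefect n (tailCount n (beads n E) κ) (beadShape n (beads n E) κ) (2 * i) =
        (if (i : ℤ) ∈ E ⟨0, by omega⟩ then 1 else 0) - if i = 0 then 0 else
          if -(i : ℤ) ∈ E ⟨0, by omega⟩ then 1 else 0 := by
      intro i
      rcases Nat.eq_zero_or_pos i with rfl | hi
      · rw [Nat.mul_zero, rowDefect_beads_zero hcard]
        have := half_even_mem (E := E) hn 0
        simp only [Nat.mul_zero, Nat.zero_mul, Nat.cast_zero] at this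
        simp [this]
      · rw [rowDefect_beads hn (by omega), if_neg (show i ≠ 0 by omega)]
        simp only [half_even_mem hn, neg_half_even_mem hn]
    simp only [even_two_mul, if_true, Nat.not_even_two_mul_add_one, if_false, add_zero, hi,
      Finset.sum_sub_distrib]
    congr 1
    obtain ⟨K', rfl⟩ : ∃ K', K = K' + 1 := ⟨K - 1, by omega⟩
    rw [Finset.sum_range_succ', Finset.sum_range_succ]
    have hlast : -((K' : ℤ) + 1) ∉ E ⟨0, by omega⟩ := fun h =>
      (abs_lt_of_tailCount hn hX _ h).2.2 rfl (by push_cast; ring)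
    rw [if_neg hlast]
    simp
  have e1 : ∑ u ∈ Finset.range (2 * K), (if Even u then 0 else
      rowDefect n (tailCount n (beads n E) κ) (beadShape n (beads n E) κ) u) =
      charge (E ⟨n - 1, by omega⟩) := by
    rw [sum_range_two_mul, charge_eq_sum_range fun d hd =>
      ⟨(abs_lt_of_tailCount hn hX _ hd).1, (abs_lt_of_tailCount hn hX _ hd).2.1⟩]
    refine Finset.sum_congr rfl fun i _ => ?_
    rw [if_pos (even_two_mul i), if_neg (Nat.not_even_two_mul_add_one i),
      rowDefect_beads hn (by omega)]
    simp only [half_odd_mem hn, neg_half_odd_mem hn, zero_add]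
  have b1 := weight_bot hn hanti h0 hX
  have b2 := weight_bot_sub hn hanti h0 (show 1 ≤ 2 * K by omega) hX
  have t1 := weight_top hn hanti h0 hX
  have t2 := weight_top_sub hn hanti h0 (show 1 ≤ 2 * K by omega) hX
  have l1 := levelSum_eq hn hX (l := 1) le_rfl (by omega)
  have l2 := levelSum_eq hn hX (l := n - 1) (by omega) le_rfl
  rw [e0] at b2
  rw [e1] at t2
  have s1 : ∑ k, charge (E k) = charge (E ⟨0, by omega⟩) +
      ∑ k : Fin n, if 1 ≤ (k : ℕ) then charge (E k) else 0 := by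
    rw [← Finset.add_sum_erase _ _ (Finset.mem_univ (⟨0, by omega⟩ : Fin n)),
      ← Finset.add_sum_erase _ _ (Finset.mem_univ (⟨0, by omega⟩ : Fin n))]
    simp only [show ¬ 1 ≤ 0 by omega, if_false, zero_add]
    congr 1
    refine Finset.sum_congr rfl fun k hk => ?_
    have : (k : ℕ) ≠ 0 := fun h => (Finset.mem_erase.1 hk).1 (Fin.ext h)
    rw [if_pos (by omega)]
  have s2 : (∑ k : Fin n, if n - 1 ≤ (k : ℕ) then charge (E k) else 0) =
      charge (E ⟨n - 1, by omega⟩) := by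
    rw [Finset.sum_eq_single (⟨n - 1, by omega⟩ : Fin n)]
    · simp
    · intro k _ hk
      rw [if_neg]
      intro h
      exact hk (Fin.ext (by have := k.2; simp only; omega))
    · simp
  rw [s2] at l2
  rw [beadWall]
  refine ⟨by omega, by omega, ?_, by omega, by omega⟩
  intro j hj hj'
  rw [weight_mid hn hanti h0 hX j hj hj', levelSum_eq hn hX (by omega) (by omega)]

end

/-! ### The beads of a Young wall -/

section

variable {n : ℕ} {D : Finset ℤ} {κ : ℕ →₀ ℕ}

/-- The condition for `y` to belong to the set of beads, in terms of the profile. It is meant for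
`y ≠ 0` with residue at most `n - 1` modulo `2 n - 2`. -/
def IsBead (n : ℕ) (N : ℕ → ℕ) (σ : ℕ → Bool) (y : ℤ) : Prop :=
  if (n - 1) ∣ y.natAbs then
    (Odd (N y.natAbs - N (y.natAbs + 1)) ∧
      (0 < y ↔ (σ (y.natAbs / (n - 1)) = true ↔ Even (N (y.natAbs + 1))))) ∨
    (Even (N y.natAbs - N (y.natAbs + 1)) ∧ 0 < N y.natAbs - N (y.natAbs + 1) ∧
      σ (y.natAbs / (n - 1)) = true)
  else N y.natAbs - N (y.natAbs + 1) = 1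

lemma isBead_half (hn : 4 ≤ n) {N : ℕ → ℕ} {σ : ℕ → Bool} {u : ℕ} (hu : 1 ≤ u) {f : ℕ}
    (hf : N (u * (n - 1)) = N (u * (n - 1) + 1) + f) :
    (IsBead n N σ ((u * (n - 1) : ℕ) : ℤ) ↔
      (Odd f ∧ (σ u = true ↔ Even (N (u * (n - 1) + 1)))) ∨ (Even f ∧ 0 < f ∧ σ u = true)) ∧
    (IsBead n N σ (-((u * (n - 1) : ℕ) : ℤ)) ↔
      (Odd f ∧ ¬ (σ u = true ↔ Even (N (u * (n - 1) + 1)))) ∨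
        (Even f ∧ 0 < f ∧ σ u = true)) := by
  have hp : 0 < u * (n - 1) := Nat.mul_pos hu (by omega)
  have h1 : ((u * (n - 1) : ℕ) : ℤ).natAbs = u * (n - 1) := Int.natAbs_natCast _
  have h2 : (-((u * (n - 1) : ℕ) : ℤ)).natAbs = u * (n - 1) := by
    rw [Int.natAbs_neg, Int.natAbs_natCast]
  have h3 : (0 : ℤ) < ((u * (n - 1) : ℕ) : ℤ) := by exact_mod_cast hp
  have h4 : ¬ (0 : ℤ) < -((u * (n - 1) : ℕ) : ℤ) := by omega
  have h5 : N (u * (n - 1)) - N (u * (n - 1) + 1) = f := by omega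
  unfold IsBead
  rw [h1, h2, h5, if_pos (Dvd.intro_left _ rfl), if_pos (Dvd.intro_left _ rfl),
    Nat.mul_div_cancel _ (by omega)]
  simp only [h3, h4, true_iff, false_iff, and_self]

lemma mem_iff_isBead (hn : 4 ≤ n) (hD : IsReduced n D) {y : ℤ} (hy : y ≠ 0)
    (hr : y % (2 * n - 2) < n) :
    y ∈ D ↔ IsBead n (tailCount n D κ) (beadShape n D κ) y := by
  by_cases hd : (n - 1) ∣ y.natAbs
  · obtain ⟨u, hu⟩ := hd
    rw [mul_comm] at hu
    have hu1 : 1 ≤ u := Nat.pos_of_ne_zero (by rintro rfl; simp at hu; exact hy hu)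
    have hf := tailCount_half (D := D) (κ := κ) hn hu1
    rw [add_assoc, add_assoc] at hf
    have hB := isBead_half (σ := beadShape n D κ) hn hu1 hf
    have h0 : u ≠ 0 := by omega
    have hs : beadShape n D κ u = if ((u * (n - 1) : ℕ) : ℤ) ∈ D then
        if -((u * (n - 1) : ℕ) : ℤ) ∈ D then true
        else decide (Even (tailCount n D κ (u * (n - 1) + 1)))
      else if -((u * (n - 1) : ℕ) : ℤ) ∈ D then decide (Odd (tailCount n D κ (u * (n - 1) + 1)))
      else false := by rw [beadShape, if_neg h0]
    rw [hs] at hB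
    rcases Int.natAbs_eq y with h | h <;> rw [h, hu]
    · rw [hB.1]
      by_cases ha : ((u * (n - 1) : ℕ) : ℤ) ∈ D <;>
      by_cases hb : -((u * (n - 1) : ℕ) : ℤ) ∈ D <;>
      simp only [ha, hb, if_true, if_false, true_iff, false_iff, decide_eq_true_eq]
      · exact Or.inr ⟨⟨1 + κ (u - 1), by ring⟩, by omega, trivial⟩
      · exact Or.inl ⟨⟨κ (u - 1), by ring⟩, trivial⟩
      · rintro (⟨-, h⟩ | ⟨h, -⟩)
        · rw [← Nat.not_even_iff_odd] at h
          tauto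
        · rw [Nat.even_iff] at h
          omega
      · rintro (⟨h, -⟩ | ⟨-, -, h⟩)
        · rw [Nat.odd_iff] at h
          omega
        · simp at h
    · rw [hB.2]
      by_cases ha : ((u * (n - 1) : ℕ) : ℤ) ∈ D <;>
      by_cases hb : -((u * (n - 1) : ℕ) : ℤ) ∈ D <;>
      simp only [ha, hb, if_true, if_false, true_iff, false_iff, decide_eq_true_eq]
      · exact Or.inr ⟨⟨1 + κ (u - 1), by ring⟩, by omega, trivial⟩
      · rintro (⟨-, h⟩ | ⟨h, -⟩)
        · exact h trivial
        · rw [Nat.even_iff] at h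
          omega
      · refine Or.inl ⟨⟨κ (u - 1), by ring⟩, ?_⟩
        rw [← Nat.not_even_iff_odd]
        tauto
      · rintro (⟨h, -⟩ | ⟨-, -, h⟩)
        · rw [Nat.odd_iff] at h
          omega
        · simp at h
  · have hs : 1 ≤ y.natAbs := by omega
    have hf := tailCount_eq (D := D) (κ := κ) hn hs
    rw [if_neg hd, add_zero] at hf
    rw [IsBead, if_neg hd]
    have hd' : ¬ ((n - 1 : ℕ) : ℤ) ∣ y := by rwa [Int.natCast_dvd]
    have hneg : -y ∉ D := by
      intro h
      have h2 := hD _ h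
      have h3 : y % (2 * n - 2) ≠ 0 := fun h => hd' (dvd_of_mod_two_mul hn (Or.inl h))
      have h4 : y % (2 * n - 2) ≠ n - 1 := fun h => hd' (dvd_of_mod_two_mul hn (Or.inr h))
      rw [neg_emod_of hn h3] at h2
      omega
    rcases Int.natAbs_eq y with h | h
    · rw [← h] at hf
      by_cases hm : y ∈ D <;> simp only [hm, hneg, if_true, if_false] at hf ⊢ <;> simp <;> omega
    · have h' : (y.natAbs : ℤ) = -y := by omega
      rw [h', neg_neg] at hf
      by_cases hm : y ∈ D <;> simp only [hm, hneg, if_true, if_false] at hf ⊢ <;> simp <;> omega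

lemma isBead_congr (hn : 4 ≤ n) {N N' : ℕ → ℕ} {σ σ' : ℕ → Bool}
    (hN : ∀ x, 1 ≤ x → N x = N' x)
    (hσ : ∀ u, 1 ≤ u → N (u * (n - 1) + 1) < N (u * (n - 1)) → σ u = σ' u) {y : ℤ}
    (hy : y ≠ 0) : IsBead n N σ y ↔ IsBead n N' σ' y := by
  unfold IsBead
  rw [← hN y.natAbs (by omega), ← hN (y.natAbs + 1) (by omega)]
  by_cases hf : 0 < N y.natAbs - N (y.natAbs + 1)
  · split_ifs with hd
    · obtain ⟨u, hu⟩ := hd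
      rw [mul_comm] at hu
      have hu1 : 1 ≤ u := Nat.pos_of_ne_zero (by rintro rfl; simp at hu; exact hy hu)
      rw [hu] at hf ⊢
      rw [Nat.mul_div_cancel _ (by omega), hσ u hu1 (by omega)]
    · rfl
  · rw [show N y.natAbs - N (y.natAbs + 1) = 0 by omega]
    simp

theorem beadWall_injective (hn : 4 ≤ n) {D' : Finset ℤ} {κ' : ℕ →₀ ℕ} (hD : IsReduced n D)
    (hD' : IsReduced n D') (hc : Even D.card) (hc' : Even D'.card)
    (h : beadWall n D κ = beadWall n D' κ') : D = D' ∧ κ = κ' := by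
  have hN : ∀ x, 1 ≤ x → tailCount n D κ x = tailCount n D' κ' x := fun x hx =>
    profile_eq_of_wall_eq hn tailCount_antitone tailCount_antitone h hx
  have hσ : ∀ u, 1 ≤ u → tailCount n D κ (u * (n - 1) + 1) < tailCount n D κ (u * (n - 1)) →
      beadShape n D κ u = beadShape n D' κ' u := fun u _ hlt =>
    shape_eq_of_wall_eq hn tailCount_antitone tailCount_antitone h hlt
  have hDD : D = D' := by
    ext y
    by_cases hy : y = 0
    · subst hy
      have h1 := tailCount_one_add (n := n) (κ := κ) (D := D)
      have h2 := tailCount_one_add (n := n) (κ := κ') (D := D')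
      rw [Nat.even_iff.1 hc, hN 1 le_rfl] at h1
      rw [Nat.even_iff.1 hc'] at h2
      by_cases h3 : (0 : ℤ) ∈ D <;> by_cases h4 : (0 : ℤ) ∈ D' <;>
        simp only [h3, h4, if_true, if_false] at h1 h2 ⊢ <;> omega
    · by_cases hr : y % (2 * n - 2) < n
      · rw [mem_iff_isBead (κ := κ) hn hD hy hr, mem_iff_isBead (κ := κ') hn hD' hy hr,
          isBead_congr hn hN hσ hy]
      · exact ⟨fun h => absurd (hD y h) hr, fun h => absurd (hD' y h) hr⟩
  subst hDD
  refine ⟨rfl, Finsupp.ext fun i => ?_⟩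
  have h1 := tailCount_half (D := D) (κ := κ) hn (show 1 ≤ i + 1 by omega)
  have h2 := tailCount_half (D := D) (κ := κ') hn (show 1 ≤ i + 1 by omega)
  rw [hN _ (Nat.mul_pos (by omega) (by omega)), hN _ (by omega)] at h1
  simp only [Nat.add_sub_cancel] at h1 h2
  omega

lemma wall_congr (hn : 4 ≤ n) {N N' : ℕ → ℕ} {σ σ' : ℕ → Bool}
    (hN : ∀ x, 1 ≤ x → N x = N' x) (h0 : σ 0 = false) (h0' : σ' 0 = false)
    (hσ : ∀ u, 1 ≤ u → N (u * (n - 1) + 1) < N (u * (n - 1)) → σ u = σ' u) :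
    wall n N σ = wall n N' σ' := by
  have h : ∀ u, 1 ≤ u → N (u * (n - 1)) = N' (u * (n - 1)) ∧
      N (u * (n - 1) + 1) = N' (u * (n - 1) + 1) := fun u hu =>
    ⟨hN _ (Nat.mul_pos hu (by omega)), hN _ (by omega)⟩
  refine Set.Subset.antisymm (wall_subset hn (fun x hx => (hN x hx).le) h0' h0 fun u hu => ?_)
    (wall_subset hn (fun x hx => (hN x hx).ge) h0 h0' fun u hu => ?_)
  · have := h u hu
    by_cases hlt : N (u * (n - 1) + 1) < N (u * (n - 1))
    · exact Or.inr (hσ u hu hlt)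
    · left; omega
  · have := h u hu
    by_cases hlt : N (u * (n - 1) + 1) < N (u * (n - 1))
    · exact Or.inr (hσ u hu hlt).symm
    · left; omega

/-- The beads are read off by `IsBead`, the bead `0` from the parity of the number of columns. What
is left at the multiples of `n - 1` comes in pairs. -/
theorem IsYoungWall.exists_beads (hn : 4 ≤ n) {Y : Set Block} (hY : IsYoungWall n Y) :
    ∃ D κ, IsReduced n D ∧ Even D.card ∧ Y = beadWall n D κ := by
  classical
  obtain ⟨N, σ, hN, rfl⟩ := hY.exists_profile hn
  obtain ⟨X, hX⟩ := hN.zero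
  have hX' : ∀ x, X ≤ x → N x = 0 := fun x hx => Nat.le_zero.1 (hX ▸ hN.anti hx)
  let D : Finset ℤ := (Finset.Icc (-(X : ℤ)) X).filter fun y =>
    y % (2 * n - 2) < n ∧ if y = 0 then Odd (N 1) else IsBead n N σ y
  have hD : IsReduced n D := fun y hy => (Finset.mem_filter.1 hy).2.1
  have hDmem : ∀ y : ℤ, y ≠ 0 → (y ∈ D ↔ y % (2 * n - 2) < n ∧ IsBead n N σ y) := by
    intro y hy
    simp only [D, Finset.mem_filter, Finset.mem_Icc, hy, if_false]
    refine ⟨fun h => h.2, fun h => ⟨?_, h⟩⟩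
    by_contra hlt
    have h2 := h.2
    rw [IsBead, hX' y.natAbs (by omega), hX' (y.natAbs + 1) (by omega)] at h2
    simp at h2
  have h0mem : (0 : ℤ) ∈ D ↔ Odd (N 1) := by
    simp [D]
    omega
  let κ : ℕ →₀ ℕ := Finsupp.onFinset (Finset.range X) (fun i =>
    (N ((i + 1) * (n - 1)) - N ((i + 1) * (n - 1) + 1)) / 2 -
      if (((i + 1) * (n - 1) : ℕ) : ℤ) ∈ D ∧ -(((i + 1) * (n - 1) : ℕ) : ℤ) ∈ D then 1 else 0) (by
    intro i hi
    rw [Finset.mem_range]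
    by_contra hlt
    apply hi
    have : i + 1 ≤ (i + 1) * (n - 1) := Nat.le_mul_of_pos_right _ (by omega)
    rw [hX' ((i + 1) * (n - 1)) (by omega)]
    simp)
  have hκ : ∀ u, 1 ≤ u → κ (u - 1) = (N (u * (n - 1)) - N (u * (n - 1) + 1)) / 2 -
      if ((u * (n - 1) : ℕ) : ℤ) ∈ D ∧ -((u * (n - 1) : ℕ) : ℤ) ∈ D then 1 else 0 := by
    intro u hu
    simp only [κ, Finsupp.onFinset_apply, Nat.sub_add_cancel hu]

  have hhalf : ∀ u, 1 ≤ u → ∀ f, N (u * (n - 1)) = N (u * (n - 1) + 1) + f →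
      ((((u * (n - 1) : ℕ) : ℤ) ∈ D ↔
        (Odd f ∧ (σ u = true ↔ Even (N (u * (n - 1) + 1)))) ∨ (Even f ∧ 0 < f ∧ σ u = true)) ∧
      (-((u * (n - 1) : ℕ) : ℤ) ∈ D ↔
        (Odd f ∧ ¬ (σ u = true ↔ Even (N (u * (n - 1) + 1)))) ∨
          (Even f ∧ 0 < f ∧ σ u = true))) := by
    intro u hu f hf
    have hp : 0 < u * (n - 1) := Nat.mul_pos hu (by omega)
    have hB := isBead_half (σ := σ) hn hu hf
    have hd : ((n - 1 : ℕ) : ℤ) ∣ ((u * (n - 1) : ℕ) : ℤ) :=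
      Int.natCast_dvd_natCast.2 (Dvd.intro_left _ rfl)
    have r1 : ((u * (n - 1) : ℕ) : ℤ) % (2 * n - 2) < n := by
      have := mod_two_mul_of_dvd hn hd
      omega
    have r2 : (-((u * (n - 1) : ℕ) : ℤ)) % (2 * n - 2) < n := by
      have := mod_two_mul_of_dvd hn ((dvd_neg).2 hd)
      omega
    rw [hDmem _ (by omega), hDmem _ (by omega), hB.1, hB.2]
    simp only [r1, r2, true_and, and_self]
  have hanti : ∀ x, N (x + 1) ≤ N x := fun x => hN.anti (Nat.le_succ x)
  have hstep : ∀ x, 1 ≤ x → N x = N (x + 1) + (if (x : ℤ) ∈ D then 1 else 0) +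
      (if -(x : ℤ) ∈ D then 1 else 0) + if (n - 1) ∣ x then 2 * κ (x / (n - 1) - 1) else 0 := by
    intro x hx
    have hle := hanti x
    by_cases hd : (n - 1) ∣ x
    · rw [if_pos hd]
      obtain ⟨u, rfl⟩ := hd
      rw [mul_comm (n - 1) u] at *
      have hu : 1 ≤ u := Nat.pos_of_ne_zero (by rintro rfl; simp at hx)
      obtain ⟨f, hf⟩ := Nat.exists_eq_add_of_le hle
      rw [Nat.mul_div_cancel _ (by omega), hκ u hu]
      have hh := hhalf u hu f hf
      rcases Nat.even_or_odd f with he | ho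
      · have h1 := Nat.even_iff.1 he
        have h2 : ¬ Odd f := Nat.not_odd_iff_even.2 he
        by_cases hq : 0 < f ∧ σ u = true
        · have ha := hh.1.2 (Or.inr ⟨he, hq⟩)
          have hb := hh.2.2 (Or.inr ⟨he, hq⟩)
          rw [if_pos ha, if_pos hb, if_pos ⟨ha, hb⟩]
          omega
        · have ha : ((u * (n - 1) : ℕ) : ℤ) ∉ D := fun h => by
            rcases hh.1.1 h with h | h
            · exact h2 h.1
            · exact hq h.2
          have hb : -((u * (n - 1) : ℕ) : ℤ) ∉ D := fun h => by
            rcases hh.2.1 h with h | h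
            · exact h2 h.1
            · exact hq h.2
          rw [if_neg ha, if_neg hb, if_neg fun h => ha h.1]
          omega
      · have h1 := Nat.odd_iff.1 ho
        have h2 : ¬ Even f := Nat.not_even_iff_odd.2 ho
        simp only [ho, h2, true_and, false_and, or_false] at hh
        by_cases hq : σ u = true ↔ Even (N (u * (n - 1) + 1))
        · have ha := hh.1.2 hq
          have hb : -((u * (n - 1) : ℕ) : ℤ) ∉ D := fun h => hh.2.1 h hq
          rw [if_pos ha, if_neg hb, if_neg fun h => hb h.2]
          omega
        · have ha : ((u * (n - 1) : ℕ) : ℤ) ∉ D := fun h => hq (hh.1.1 h)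
          have hb := hh.2.2 hq
          rw [if_neg ha, if_pos hb, if_neg fun h => ha h.1]
          omega
    · rw [if_neg hd, add_zero]
      have hs := hN.step x hd
      have hd' : ¬ ((n - 1 : ℕ) : ℤ) ∣ (x : ℤ) := by rwa [Int.natCast_dvd_natCast]
      have h3 : (x : ℤ) % (2 * n - 2) ≠ 0 := fun h => hd' (dvd_of_mod_two_mul hn (Or.inl h))
      have h4 : (x : ℤ) % (2 * n - 2) ≠ n - 1 := fun h =>
        hd' (dvd_of_mod_two_mul hn (Or.inr h))
      have h5 := neg_emod_of hn h3
      have b1 : IsBead n N σ (x : ℤ) ↔ N x - N (x + 1) = 1 := by simp [IsBead, hd]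
      have b2 : IsBead n N σ (-(x : ℤ)) ↔ N x - N (x + 1) = 1 := by simp [IsBead, hd]
      rw [← b1] at b2
      have m1 := hDmem (x : ℤ) (by omega)
      have m2 := hDmem (-(x : ℤ)) (by omega)
      rw [b2, b1, h5] at m2
      rw [b1] at m1
      by_cases hf : N x - N (x + 1) = 1
      · simp only [hf, and_true] at m1 m2
        by_cases hr : (x : ℤ) % (2 * n - 2) < n
        · rw [if_pos (m1.2 hr), if_neg fun h => by have := m2.1 h; omega]
          omega
        · rw [if_neg fun h => hr (m1.1 h), if_pos (m2.2 (by omega))]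
          omega
      · simp only [hf, and_false, iff_false] at m1 m2
        rw [if_neg m1, if_neg m2]
        omega
  have hNeq : ∀ x, 1 ≤ x → N x = tailCount n D κ x := by
    obtain ⟨X2, hX2⟩ := exists_tailCount_eq_zero (n := n) D κ
    have hZ : N (X + X2) = tailCount n D κ (X + X2) := by
      rw [hX' _ (by omega)]
      exact (Nat.le_zero.1 (hX2 ▸ tailCount_antitone (by omega))).symm
    have hind : ∀ m x, 1 ≤ x → x + m = X + X2 → N x = tailCount n D κ x := by
      intro m
      induction m with
      | zero =>
        intro x _ h
        rw [Nat.add_zero] at h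
        rw [h, hZ]
      | succ m ih =>
        intro x hx h
        rw [hstep x hx, tailCount_eq hn hx, ih (x + 1) (by omega) (by omega)]
    intro x hx
    rcases Nat.le_total x (X + X2) with h | h
    · exact hind (X + X2 - x) x hx (by omega)
    · rw [hX' x (by omega)]
      exact (Nat.le_zero.1 (hX2 ▸ tailCount_antitone (by omega))).symm
  refine ⟨D, κ, hD, ?_, ?_⟩
  · have h := tailCount_one_add (n := n) (κ := κ) (D := D)
    rw [← hNeq 1 le_rfl] at h
    rw [Nat.even_iff, ← h]
    by_cases ho : Odd (N 1)
    · rw [if_pos (h0mem.2 ho)]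
      have := Nat.odd_iff.1 ho
      omega
    · rw [if_neg fun h => ho (h0mem.1 h)]
      rw [Nat.odd_iff] at ho
      omega
  · refine wall_congr hn hNeq hN.lower (by simp [beadShape]) fun u hu hlt => ?_
    obtain ⟨f, hf⟩ := Nat.exists_eq_add_of_le hlt.le
    have hh := hhalf u hu f hf
    rw [beadShape, if_neg (by omega), ← hNeq (u * (n - 1) + 1) (by omega)]
    rcases Nat.even_or_odd f with he | ho
    · have h2 : ¬ Odd f := Nat.not_odd_iff_even.2 he
      have hf0 : 0 < f := by omega
      simp only [he, h2, false_and, false_or, true_and, hf0] at hh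
      cases hs : σ u <;> simp only [hs, Bool.false_eq_true, iff_true, iff_false] at hh
      · rw [if_neg hh.1, if_neg hh.2]
      · rw [if_pos hh.1, if_pos hh.2]
    · have h2 : ¬ Even f := Nat.not_even_iff_odd.2 ho
      simp only [ho, h2, true_and, false_and, or_false] at hh
      by_cases hq : σ u = true ↔ Even (N (u * (n - 1) + 1))
      · rw [if_pos (hh.1.2 hq), if_neg fun h => hh.2.1 h hq]
        rw [Bool.eq_iff_iff, decide_eq_true_eq]
        exact hq
      · rw [if_neg fun h => hq (hh.1.1 h), if_pos (hh.2.2 hq)]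
        rw [Bool.eq_iff_iff, decide_eq_true_eq, ← Nat.not_even_iff_odd]
        tauto

lemma IsReduced.exists_beads_eq (hn : 4 ≤ n) (hD : IsReduced n D) :
    ∃ E : Fin n → Finset ℤ, beads n E = D := by
  refine ⟨fun k => (D.filter fun y : ℤ => y % (2 * n - 2) = ((k : ℕ) : ℤ)).image
    fun y : ℤ => y / (2 * n - 2), ?_⟩
  ext y
  have e := Int.ediv_mul_add_emod y (2 * n - 2)
  constructor
  · intro h
    obtain ⟨k, d, hd, rfl⟩ := mem_beads_iff.1 h
    obtain ⟨z, hz, hzd⟩ := Finset.mem_image.1 hd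
    obtain ⟨hz1, hz2⟩ := Finset.mem_filter.1 hz
    rw [← hzd, ← hz2]
    simpa only [Int.ediv_mul_add_emod] using hz1
  · intro h
    have h1 := Int.emod_nonneg y (show (2 * n - 2 : ℤ) ≠ 0 by omega)
    have h2 := hD y h
    refine mem_beads_iff.2 ⟨⟨(y % (2 * n - 2)).toNat, by omega⟩, y / (2 * n - 2), ?_, ?_⟩
    · refine Finset.mem_image.2 ⟨y, Finset.mem_filter.2 ⟨h, ?_⟩, rfl⟩
      exact (Int.toNat_of_nonneg h1).symm
    · simp only [Int.toNat_of_nonneg h1, e]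

lemma beads_injective (hn : 4 ≤ n) : Function.Injective (beads n) := by
  intro E E' h
  funext k
  ext d
  rw [← mem_beads hn, h, mem_beads hn]

end

/-! ### Shifts of finite sets of integers -/

section

/-- The shift by one, of sets of integers read relative to the negative integers: `F` stands for the
symmetric difference of `F` with `(-∞, 0)`, and its shift for the translate of this by one. -/
def shift : Equiv.Perm (Finset ℤ) where
  toFun F := symmDiff (F.map (Equiv.addRight (1 : ℤ)).toEmbedding) {0}
  invFun F := (symmDiff F {0}).map (Equiv.addRight (-1 : ℤ)).toEmbedding
  left_inv F := by
    ext d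
    simp
  right_inv F := by
    ext d
    simp only [Finset.mem_symmDiff, Finset.mem_map_equiv, Finset.mem_singleton]
    simp
    tauto

lemma mem_shift {F : Finset ℤ} {d : ℤ} : d ∈ shift F ↔ (d - 1 ∈ F ↔ d ≠ 0) := by
  simp only [shift, Equiv.coe_fn_mk, Finset.mem_symmDiff, Finset.mem_map_equiv,
    Finset.mem_singleton]
  simp [sub_eq_add_neg]
  tauto

lemma mem_shift_symm {F : Finset ℤ} {d : ℤ} : d ∈ shift⁻¹ F ↔ (d + 1 ∈ F ↔ d ≠ -1) := by
  conv_rhs => rw [← Equiv.apply_symm_apply shift F, mem_shift]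
  rw [Equiv.Perm.inv_def]
  simp only [add_sub_cancel_right, ne_eq]
  have : d + 1 = 0 ↔ d = -1 := by omega
  rw [this]
  tauto

lemma mem_shift_zpow (z : ℤ) {F : Finset ℤ} {d : ℤ} :
    d ∈ (shift ^ z) F ↔ (d - z ∈ F ↔ (0 ≤ d ↔ z ≤ d)) := by
  induction z generalizing d with
  | zero => simp
  | succ k ih =>
    rw [add_comm, zpow_add, zpow_one, Equiv.Perm.mul_apply, mem_shift, ih,
      show d - 1 - (k : ℤ) = d - (1 + k) by ring]
    have : (0 ≤ d ↔ 1 + (k : ℤ) ≤ d) ↔ ((0 ≤ d - 1 ↔ (k : ℤ) ≤ d - 1) ↔ d ≠ 0) := by omega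
    rw [this]
    generalize ((0 : ℤ) ≤ d - 1 ↔ (k : ℤ) ≤ d - 1) = p
    by_cases d - (1 + (k : ℤ)) ∈ F <;> by_cases p <;> by_cases d ≠ 0 <;> simp_all
  | pred k ih =>
    rw [sub_eq_add_neg, add_comm, zpow_add, zpow_neg_one, Equiv.Perm.mul_apply, mem_shift_symm, ih,
      show d + 1 - -(k : ℤ) = d - (-1 + -k) by ring]
    have : (0 ≤ d ↔ -1 + -(k : ℤ) ≤ d) ↔ ((0 ≤ d + 1 ↔ -(k : ℤ) ≤ d + 1) ↔ d ≠ -1) := by omega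
    rw [this]
    generalize ((0 : ℤ) ≤ d + 1 ↔ -(k : ℤ) ≤ d + 1) = p
    by_cases d - (-1 + -(k : ℤ)) ∈ F <;> by_cases p <;> by_cases d ≠ -1 <;> simp_all

lemma sum_shift_add {M : Type*} [AddCommGroup M] (g : ℤ → M) (F : Finset ℤ) :
    ∑ d ∈ shift F, g d = ∑ d ∈ F, (if d = -1 then -g 0 else g (d + 1)) + g 0 := by
  have e : ∑ d ∈ F, (if d = -1 then -g 0 else g (d + 1)) =
      ∑ d ∈ F, g (d + 1) - (if -1 ∈ F then g 0 else 0) - (if -1 ∈ F then g 0 else 0) := by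
    have h : ∀ d, (if d = -1 then -g 0 else g (d + 1)) =
        g (d + 1) - (if d = -1 then g 0 else 0) - (if d = -1 then g 0 else 0) := by
      intro d
      split_ifs with h
      · subst h
        simp
      · simp
    simp only [h, Finset.sum_sub_distrib, Finset.sum_ite_eq']
  have hs : ∑ d ∈ F.map (Equiv.addRight (1 : ℤ)).toEmbedding, g d = ∑ d ∈ F, g (d + 1) := by
    simp
  rw [e, ← hs]
  by_cases h : (-1 : ℤ) ∈ F
  · have h0 : (0 : ℤ) ∈ F.map (Equiv.addRight (1 : ℤ)).toEmbedding := by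
      rw [Finset.mem_map_equiv]
      simpa using h
    have : shift F = (F.map (Equiv.addRight (1 : ℤ)).toEmbedding).erase 0 := by
      simp only [shift, Equiv.coe_fn_mk]
      ext d
      by_cases hd : d = 0 <;> simp_all [Finset.mem_symmDiff]
    rw [this, ← Finset.add_sum_erase _ _ h0]
    simp [h]
  · have h0 : (0 : ℤ) ∉ F.map (Equiv.addRight (1 : ℤ)).toEmbedding := by
      rw [Finset.mem_map_equiv]
      simpa using h
    have : shift F = insert 0 (F.map (Equiv.addRight (1 : ℤ)).toEmbedding) := by
      simp only [shift, Equiv.coe_fn_mk]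
      ext d
      by_cases hd : d = 0 <;> simp_all [Finset.mem_symmDiff]
    rw [this, Finset.sum_insert h0]
    simp [h, add_comm]

lemma charge_shift (F : Finset ℤ) : charge (shift F) = charge F + 1 := by
  rw [charge, sum_shift_add]
  congr 1
  refine Finset.sum_congr rfl fun d _ => ?_
  simp only [beadSign]
  split_ifs <;> omega

lemma energy_shift (F : Finset ℤ) : (energy (shift F) : ℤ) = energy F + charge F := by
  rw [energy, Nat.cast_sum, sum_shift_add, energy, charge, Nat.cast_sum, ← Finset.sum_add_distrib]
  simp only [Int.natAbs_zero, Nat.cast_zero, add_zero, neg_zero]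
  refine Finset.sum_congr rfl fun d _ => ?_
  simp only [beadSign]
  split_ifs <;> omega

lemma charge_shift_zpow (z : ℤ) (F : Finset ℤ) : charge ((shift ^ z) F) = charge F + z := by
  induction z with
  | zero => simp
  | succ k ih =>
    rw [add_comm, zpow_add, zpow_one, Equiv.Perm.mul_apply, charge_shift, ih]
    ring
  | pred k ih =>
    have := charge_shift ((shift ^ (-(k : ℤ) - 1)) F)
    rw [← Equiv.Perm.mul_apply, ← zpow_one_add, show 1 + (-(k : ℤ) - 1) = -k by ring, ih] at this
    omega

lemma energy_shift_zpow (z : ℤ) (F : Finset ℤ) :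
    (2 * energy ((shift ^ z) F) : ℤ) = 2 * energy F + 2 * z * charge F + z * (z - 1) := by
  induction z with
  | zero => simp
  | succ k ih =>
    rw [add_comm, zpow_add, zpow_one, Equiv.Perm.mul_apply, energy_shift, mul_add, ih,
      charge_shift_zpow]
    ring
  | pred k ih =>
    have := energy_shift ((shift ^ (-(k : ℤ) - 1)) F)
    rw [← Equiv.Perm.mul_apply, ← zpow_one_add, show 1 + (-(k : ℤ) - 1) = -k by ring,
      charge_shift_zpow] at this
    linarith

/-- The finite sets of integers of charge zero. -/
abbrev ChargeZero : Type := {F : Finset ℤ // charge F = 0}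

/-- A finite set of integers amounts to its charge and the set of charge zero that it is shifted
to. -/
def chargeEquiv : Finset ℤ ≃ ℤ × ChargeZero where
  toFun F := (charge F, ⟨(shift ^ (-charge F)) F, by rw [charge_shift_zpow]; ring⟩)
  invFun p := (shift ^ p.1) p.2.1
  left_inv F := by
    simp only [zpow_neg]
    exact (shift ^ charge F).apply_symm_apply F
  right_inv := by
    rintro ⟨z, F, hF⟩
    simp [charge_shift_zpow, hF]

lemma charge_chargeEquiv_symm (z : ℤ) (F : ChargeZero) : charge (chargeEquiv.symm (z, F)) = z := by
  simp [chargeEquiv, charge_shift_zpow, F.2]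

lemma energy_chargeEquiv_symm (z : ℤ) (F : ChargeZero) :
    (2 * energy (chargeEquiv.symm (z, F)) : ℤ) = 2 * energy F.1 + z * (z - 1) := by
  simp [chargeEquiv, energy_shift_zpow, F.2]

/-- The interval `[0, z)` for `z ≥ 0` and `[z, 0)` for `z < 0`, which has minimal energy among the
sets of charge `z`. -/
def vacuum (z : ℤ) : Finset ℤ := (shift ^ z) ∅

lemma mem_vacuum {z d : ℤ} : d ∈ vacuum z ↔ (0 ≤ d ∧ d < z) ∨ (d < 0 ∧ z ≤ d) := by
  rw [vacuum, mem_shift_zpow]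
  simp only [Finset.notMem_empty, false_iff]
  omega

lemma charge_vacuum (z : ℤ) : charge (vacuum z) = z := by
  rw [vacuum, charge_shift_zpow]
  simp [charge]

/-- The only sets that allow no step towards the origin, within the non-negative or the negative
integers, and no annihilation of `0` and `-1`, are the intervals `vacuum z`. -/
lemma exists_eq_vacuum {F : Finset ℤ} (h1 : ∀ d ∈ F, 1 ≤ d → d - 1 ∈ F)
    (h2 : ∀ d ∈ F, d ≤ -2 → d + 1 ∈ F) (h3 : ¬ (0 ∈ F ∧ -1 ∈ F)) : ∃ z, F = vacuum z := by
  have h1' : ∀ k : ℕ, ∀ d ∈ F, (k : ℤ) ≤ d → d - k ∈ F := by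
    intro k
    induction k with
    | zero => exact fun d hd _ => by simpa using hd
    | succ k ih =>
      intro d hd hk
      have := h1 _ (ih d hd (by omega)) (by push_cast at hk ⊢; omega)
      rwa [show d - ((k + 1 : ℕ) : ℤ) = d - k - 1 by push_cast; ring]
  have h2' : ∀ k : ℕ, ∀ d ∈ F, d ≤ -1 - (k : ℤ) → d + k ∈ F := by
    intro k
    induction k with
    | zero => exact fun d hd _ => by simpa using hd
    | succ k ih =>
      intro d hd hk
      have := h2 _ (ih d hd (by push_cast at hk ⊢; omega)) (by push_cast at hk ⊢; omega)
      rwa [show d + ((k + 1 : ℕ) : ℤ) = d + k + 1 by push_cast; ring]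
  rcases F.eq_empty_or_nonempty with rfl | hF
  · refine ⟨0, ?_⟩
    ext d
    rw [mem_vacuum]
    simp only [Finset.notMem_empty, false_iff]
    omega
  by_cases h0 : (0 : ℤ) ∈ F
  · refine ⟨F.max' hF + 1, ?_⟩
    ext d
    rw [mem_vacuum]
    have hm := F.le_max' 0 h0
    constructor
    · intro hd
      have h4 := F.le_max' d hd
      refine Or.inl ⟨?_, by omega⟩
      by_contra hneg
      refine h3 ⟨h0, ?_⟩
      have := h2' (-1 - d).toNat d hd (by omega)
      rwa [show d + ((-1 - d).toNat : ℤ) = -1 by omega] at this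
    · rintro (⟨h5, h6⟩ | ⟨h5, h6⟩)
      · have := h1' (F.max' hF - d).toNat _ (F.max'_mem hF) (by omega)
        rwa [show F.max' hF - ((F.max' hF - d).toNat : ℤ) = d by omega] at this
      · omega
  · have hneg : ∀ d ∈ F, d < 0 := by
      intro d hd
      by_contra hge
      have := h1' d.toNat d hd (by omega)
      rw [show d - (d.toNat : ℤ) = 0 by omega] at this
      exact h0 this
    refine ⟨F.min' hF, ?_⟩
    ext d
    rw [mem_vacuum]
    have hm := hneg _ (F.min'_mem hF)
    constructor
    · exact fun hd => Or.inr ⟨hneg d hd, F.min'_le d hd⟩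
    · rintro (⟨h5, h6⟩ | ⟨h5, h6⟩)
      · omega
      · have := h2' (d - F.min' hF).toNat _ (F.min'_mem hF) (by omega)
        rwa [show F.min' hF + ((d - F.min' hF).toNat : ℤ) = d by omega] at this

end

/-! ### Partition-like sets and their generating series -/

section

variable {n : ℕ}

/-- The multi-weight of a bar, as an exponent. -/
def barExponent (n : ℕ) : Fin (n + 1) →₀ ℕ := Finsupp.equivFunOnFinite.symm (barWeight n)

lemma barExponent_apply (j : Fin (n + 1)) : barExponent n j = barWeight n j := rfl

lemma qSeries_pow (n k : ℕ) :
    qSeries n ^ k = MvPowerSeries.monomial (k • barExponent n) 1 := by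
  have h : qSeries n = MvPowerSeries.monomial (barExponent n) 1 := by
    rw [MvPowerSeries.monomial_one_eq, qSeries, Finsupp.prod_fintype]
    · rfl
    · simp
  rw [h, MvPowerSeries.monomial_pow, one_pow]

lemma le_apply_zero {k : ℕ} {d : Fin (n + 1) →₀ ℕ} (h : d = k • barExponent n) : d 0 = k := by
  subst h
  simp [barExponent_apply, barWeight]

lemma coeff_qSeries_pow (d : Fin (n + 1) →₀ ℕ) {k : ℕ} (h : d 0 ≠ k) :
    MvPowerSeries.coeff d (qSeries n ^ k) = 0 := by
  rw [qSeries_pow, MvPowerSeries.coeff_monomial, if_neg fun he => h (le_apply_zero he)]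

lemma summable_monomial {X : Type*} {w : X → Fin (n + 1) →₀ ℕ}
    (hw : ∀ d, {x | w x = d}.Finite) :
    Summable fun x => MvPowerSeries.monomial (w x) (1 : ℤ) := by
  rw [MvPowerSeries.WithPiTopology.summable_iff_summable_coeff]
  intro d
  refine summable_of_hasFiniteSupport ((hw d).subset fun x hx => ?_)
  rw [Function.mem_support, MvPowerSeries.coeff_monomial] at hx
  by_contra h
  exact hx (if_neg fun he => h he.symm)

lemma summable_qSeries_pow {X : Type*} {e : X → ℕ} (he : ∀ N, {x | e x = N}.Finite) :
    Summable fun x => qSeries n ^ e x := by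
  simp only [qSeries_pow]
  refine summable_monomial fun d => (he (d 0)).subset fun x hx => ?_
  exact (le_apply_zero hx.symm).symm

lemma multipliable_one_sub_qSeries (n : ℕ) :
    Multipliable fun k : ℕ => 1 - qSeries n ^ (k + 1) := by
  simp only [sub_eq_add_neg]
  apply MvPowerSeries.WithPiTopology.multipliable_one_add_of_tendsto_order_atTop_nhds_top
  rw [ENat.tendsto_nhds_top_iff_natCast_lt]
  intro N
  filter_upwards [Filter.eventually_gt_atTop N] with k hk
  refine lt_of_lt_of_le (b := ((k + 1 : ℕ) : ℕ∞)) (by exact_mod_cast by omega) ?_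
  refine MvPowerSeries.le_order fun d hd => ?_
  rw [map_neg, coeff_qSeries_pow, neg_zero]
  have : d 0 ≤ d.degree := Finsupp.le_degree 0 d
  have : d.degree < k + 1 := by exact_mod_cast hd
  omega

/-- A filtration of a set with an energy function, beginning with a single element of energy
zero, in which the new elements of each step correspond to all elements up to this step, with
energy raised by the number of the step. The partitions, filtered by their largest part, are an
example, and the generating series is always theirs. -/
structure IsPartitionLike {X : Type*} (e : X → ℕ) (P : ℕ → Set X) (t : ℕ → X → X) : Prop where
  mono : ∀ k, P k ⊆ P (k + 1)
  exhausting : ∀ x, ∃ k, x ∈ P k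
  zero : ∃ x, P 0 = {x} ∧ e x = 0
  bijOn : ∀ k, Set.BijOn (t k) (P (k + 1)) (P (k + 1) \ P k)
  energy : ∀ k, ∀ x ∈ P (k + 1), e (t k x) = e x + (k + 1)

namespace IsPartitionLike

variable {X : Type*} {e : X → ℕ} {P : ℕ → Set X} {t : ℕ → X → X}

lemma mem_of_energy_le (h : IsPartitionLike e P t) {k : ℕ} {x : X} (hx : e x ≤ k) : x ∈ P k := by
  obtain ⟨j, hj⟩ := h.exhausting x
  have hmono : Monotone P := monotone_nat_of_le_succ h.mono
  induction j with
  | zero => exact hmono (Nat.zero_le k) hj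
  | succ j ih =>
    by_cases hj' : x ∈ P j
    · exact ih hj'
    · obtain ⟨y, hy, rfl⟩ := (h.bijOn j).surjOn ⟨hj, hj'⟩
      rw [h.energy j y hy] at hx
      exact hmono (by omega) hj

lemma finite (h : IsPartitionLike e P t) (N : ℕ) : {x | e x = N}.Finite := by
  have hk : ∀ k N, {x | x ∈ P k ∧ e x = N}.Finite := by
    intro k
    induction k with
    | zero =>
      obtain ⟨x, hx, -⟩ := h.zero
      intro N
      exact (Set.finite_singleton x).subset fun y hy => hx ▸ hy.1
    | succ k ih =>
      intro N
      induction N using Nat.strong_induction_on with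
      | _ N ihN =>
        have hsub : {x | x ∈ P (k + 1) ∧ e x = N} ⊆ {x | x ∈ P k ∧ e x = N} ∪
            t k '' {x | x ∈ P (k + 1) ∧ e x = N - (k + 1) ∧ k + 1 ≤ N} := by
          rintro x ⟨h1, h2⟩
          by_cases h3 : x ∈ P k
          · exact Or.inl ⟨h3, h2⟩
          · obtain ⟨y, hy, rfl⟩ := (h.bijOn k).surjOn ⟨h1, h3⟩
            rw [h.energy k y hy] at h2
            exact Or.inr ⟨y, ⟨hy, by omega, by omega⟩, rfl⟩
        refine Set.Finite.subset ((ih N).union (Set.Finite.image _ ?_)) hsub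
        by_cases hN : k + 1 ≤ N
        · exact (ihN (N - (k + 1)) (by omega)).subset fun x hx => ⟨hx.1, hx.2.1⟩
        · exact Set.finite_empty.subset fun x hx => hN hx.2.2
  exact (hk N N).subset fun x hx => ⟨h.mem_of_energy_le hx.le, hx⟩

/-- The generating series of the step `k + 1`, times `1 - q ^ (k + 1)`, is that of the step `k`, and
all elements of energy at most `k` occur in the step `k`. -/
theorem tsum_mul_tprod (h : IsPartitionLike e P t) :
    (∑' x, qSeries n ^ e x) * ∏' k : ℕ, (1 - qSeries n ^ (k + 1)) = 1 := by
  have hs : ∀ s : Set X, Summable fun x : s => qSeries n ^ e x := fun s =>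
    summable_qSeries_pow fun N =>
      ((h.finite N).preimage Subtype.val_injective.injOn).subset fun x hx => hx
  have hrec : ∀ k, (∑' x : P (k + 1), qSeries n ^ e x) * (1 - qSeries n ^ (k + 1)) =
      ∑' x : P k, qSeries n ^ e x := by
    intro k
    have h1 : ∑' x : P (k + 1), qSeries n ^ e x =
        ∑' x : P k, qSeries n ^ e x + ∑' x : (P (k + 1) \ P k : Set X), qSeries n ^ e x := by
      have := Summable.tsum_union_disjoint (f := fun x => qSeries n ^ e x)
        (Set.disjoint_sdiff_right (s := P k) (t := P (k + 1))) (hs _) (hs _)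
      rw [← this, Set.union_sdiff_cancel (h.mono k)]
    have h2 : ∑' x : (P (k + 1) \ P k : Set X), qSeries n ^ e x =
        (∑' x : P (k + 1), qSeries n ^ e x) * qSeries n ^ (k + 1) := by
      rw [← Equiv.tsum_eq (h.bijOn k).equiv, ← (hs _).tsum_mul_right]
      refine tsum_congr fun x => ?_
      rw [← pow_add, ← h.energy k x x.2]
      rfl
    rw [mul_sub, mul_one, ← h2, h1]
    ring
  have hprod : ∀ k, (∑' x : P k, qSeries n ^ e x) *
      ∏ i ∈ Finset.range k, (1 - qSeries n ^ (i + 1)) = 1 := by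
    intro k
    induction k with
    | zero =>
      obtain ⟨x, hx, h0⟩ := h.zero
      rw [hx, tsum_singleton x fun x => qSeries n ^ e x, h0]
      simp
    | succ k ih => rw [Finset.prod_range_succ, mul_comm (∏ i ∈ _, _), ← mul_assoc, hrec, ih]
  have hlim : Filter.Tendsto (fun k => ∑' x : P k, qSeries n ^ e x) Filter.atTop
      (nhds (∑' x, qSeries n ^ e x)) := by
    rw [MvPowerSeries.WithPiTopology.tendsto_iff_coeff_tendsto]
    intro d
    refine tendsto_const_nhds.congr' ?_
    filter_upwards [Filter.eventually_ge_atTop (d 0)] with k hk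
    have h1 := MvPowerSeries.WithPiTopology.hasSum_iff_hasSum_coeff.1
      (summable_qSeries_pow (n := n) h.finite).hasSum d
    have h2 := MvPowerSeries.WithPiTopology.hasSum_iff_hasSum_coeff.1 (hs (P k)).hasSum d
    refine HasSum.unique h1 ?_
    refine (hasSum_subtype_iff_of_support_subset
      (f := fun x => MvPowerSeries.coeff d (qSeries n ^ e x)) fun x hx => ?_).1 h2
    refine h.mem_of_energy_le ?_
    by_contra hlt
    exact hx (coeff_qSeries_pow d (by omega))
  exact tendsto_nhds_unique
    ((hlim.mul (multipliable_one_sub_qSeries n).hasProd.tendsto_prod_nat).congr hprod)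
    tendsto_const_nhds

end IsPartitionLike

lemma tsum_pow_mul {X Y : Type*} {e : X → ℕ} {e' : Y → ℕ} (he : ∀ N, {x | e x = N}.Finite)
    (he' : ∀ N, {x | e' x = N}.Finite) :
    (∀ N, {p : X × Y | e p.1 + e' p.2 = N}.Finite) ∧
    ∑' p : X × Y, qSeries n ^ (e p.1 + e' p.2) =
      (∑' x, qSeries n ^ e x) * ∑' y, qSeries n ^ e' y := by
  have hf : ∀ N, {p : X × Y | e p.1 + e' p.2 = N}.Finite := by
    intro N
    refine Set.Finite.subset (Set.Finite.prod
      ((Set.finite_le_nat N).biUnion fun k _ => he k)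
      ((Set.finite_le_nat N).biUnion fun k _ => he' k)) fun p hp => ?_
    have hp' : e p.1 + e' p.2 = N := hp
    simp only [Set.mem_prod, Set.mem_iUnion]
    exact ⟨⟨e p.1, show e p.1 ≤ N by omega, rfl⟩, ⟨e' p.2, show e' p.2 ≤ N by omega, rfl⟩⟩
  refine ⟨hf, ?_⟩
  have := (summable_qSeries_pow (n := n) hf)
  simp only [pow_add] at this ⊢
  exact (Summable.tsum_mul_tsum (summable_qSeries_pow he) (summable_qSeries_pow he') this).symm

lemma tsum_pow_pi {X : Type*} {e : X → ℕ} (he : ∀ N, {x | e x = N}.Finite) (r : ℕ) :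
    (∀ N, {p : Fin r → X | ∑ i, e (p i) = N}.Finite) ∧
    ∑' p : Fin r → X, qSeries n ^ ∑ i, e (p i) = (∑' x, qSeries n ^ e x) ^ r := by
  induction r with
  | zero => exact ⟨fun N => Set.toFinite _, by simp⟩
  | succ r ih =>
    obtain ⟨h1, h2⟩ := tsum_pow_mul (n := n) he ih.1
    constructor
    · intro N
      refine ((h1 N).image (Fin.consEquiv fun _ => X)).subset fun p hp => ?_
      refine ⟨(Fin.consEquiv fun _ => X).symm p, ?_, Equiv.apply_symm_apply _ _⟩
      rw [Set.mem_ofPred_eq, Fin.sum_univ_succ] at hp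
      exact hp
    · rw [← (Fin.consEquiv fun _ => X).tsum_eq, pow_succ', ← ih.2, ← h2]
      refine tsum_congr fun p => ?_
      rw [Fin.sum_univ_succ]
      rfl

/-- The size of the partition with `κ i` parts equal to `i + 1`. -/
def partsSize (κ : ℕ →₀ ℕ) : ℕ := κ.sum fun i m => m * (i + 1)

lemma partsSize_add (κ κ' : ℕ →₀ ℕ) : partsSize (κ + κ') = partsSize κ + partsSize κ' := by
  rw [partsSize, Finsupp.sum_add_index'] <;> intros <;> simp [partsSize, add_mul]

lemma partsSize_single (i m : ℕ) : partsSize (Finsupp.single i m) = m * (i + 1) := by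
  simp [partsSize]

/-- The step `k` of the filtration consists of the partitions into parts at most `k`; the new ones
of the step `k + 1` arise by adding a part `k + 1`. -/
lemma isPartitionLike_partsSize : IsPartitionLike partsSize
    (fun k => {κ : ℕ →₀ ℕ | ∀ i, k ≤ i → κ i = 0}) fun k κ => κ + Finsupp.single k 1 where
  mono k κ hκ i hi := hκ i (by omega)
  exhausting κ := by
    refine ⟨κ.support.sup id + 1, fun i hi => Finsupp.notMem_support_iff.1 fun h => ?_⟩
    have := Finset.le_sup (f := id) h
    simp only [id] at this
    omega
  zero := by
    refine ⟨0, ?_, by simp [partsSize]⟩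
    ext κ
    simp [Finsupp.ext_iff]
  bijOn k := by
    refine ⟨fun κ hκ => ⟨fun i hi => ?_, fun h => ?_⟩, fun κ _ κ' _ h => add_right_cancel h,
      fun κ hκ => ?_⟩
    · rw [Finsupp.add_apply, Finsupp.single_eq_of_ne (by omega), hκ i hi, add_zero]
    · have := h k le_rfl
      rw [Finsupp.add_apply, Finsupp.single_eq_same] at this
      omega
    · obtain ⟨h1, h2⟩ := hκ
      have hk : κ k ≠ 0 := by
        intro h0
        refine h2 fun i hi => ?_
        rcases hi.eq_or_lt with rfl | hi
        · exact h0
        · exact h1 i hi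
      have hle : Finsupp.single k 1 ≤ κ := by
        rw [Finsupp.single_le_iff]
        omega
      refine ⟨κ - Finsupp.single k 1, fun i hi => ?_, tsub_add_cancel_of_le hle⟩
      rw [Finsupp.tsub_apply, h1 i hi, Nat.zero_sub]
  energy k κ _ := by rw [partsSize_add, partsSize_single, one_mul]

lemma mem_shift_zpow_neg {k : ℕ} {A : Finset ℤ} {d : ℤ} :
    d ∈ (shift ^ (-(k : ℤ))) A ↔ (d + k ∈ A ↔ (0 ≤ d ∨ d < -k)) := by
  rw [mem_shift_zpow, sub_neg_eq_add]
  have : (0 ≤ d ↔ -(k : ℤ) ≤ d) ↔ (0 ≤ d ∨ d < -k) := by omega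
  rw [this]

lemma charge_of_nonneg {A : Finset ℤ} (hA : ∀ d ∈ A, 0 ≤ d) : charge A = A.card := by
  rw [charge, Finset.card_eq_sum_ones, Nat.cast_sum]
  refine Finset.sum_congr rfl fun d hd => ?_
  rw [beadSign, if_pos (hA d hd)]
  rfl

lemma shift_zpow_nonneg {k : ℕ} {F : Finset ℤ} (hF : ∀ d ∈ F, -(k : ℤ) ≤ d) :
    ∀ d ∈ (shift ^ (k : ℤ)) F, 0 ≤ d := by
  intro d hd
  rw [mem_shift_zpow] at hd
  by_contra hneg
  have h1 : d - k ∉ F := fun h => by have := hF _ h; omega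
  exact h1 (hd.2 (by omega))

lemma le_of_mem_shift_zpow_neg {k : ℕ} {A : Finset ℤ} (hA : ∀ d ∈ A, 0 ≤ d) :
    ∀ d ∈ (shift ^ (-(k : ℤ))) A, -(k : ℤ) ≤ d := by
  intro d hd
  rw [mem_shift_zpow_neg] at hd
  by_contra hlt
  have := hA _ (hd.2 (by omega))
  omega

/-- The translate by one. For a set of non-negative integers, this keeps the charge. -/
def stepUp (A : Finset ℤ) : Finset ℤ := A.map (Equiv.addRight (1 : ℤ)).toEmbedding

lemma mem_stepUp {A : Finset ℤ} {d : ℤ} : d ∈ stepUp A ↔ d - 1 ∈ A := by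
  rw [stepUp, Finset.mem_map_equiv]
  simp [sub_eq_add_neg]

lemma stepUp_nonneg {A : Finset ℤ} (hA : ∀ d ∈ A, 0 ≤ d) : ∀ d ∈ stepUp A, 0 ≤ d := by
  intro d hd
  have := hA _ (mem_stepUp.1 hd)
  omega

lemma charge_stepUp {A : Finset ℤ} (hA : ∀ d ∈ A, 0 ≤ d) : charge (stepUp A) = charge A := by
  rw [charge_of_nonneg hA, charge_of_nonneg (stepUp_nonneg hA), stepUp, Finset.card_map]

lemma energy_stepUp {A : Finset ℤ} (hA : ∀ d ∈ A, 0 ≤ d) :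
    (energy (stepUp A) : ℤ) = energy A + charge A := by
  rw [charge_of_nonneg hA, energy, energy, stepUp, Finset.sum_map, Finset.card_eq_sum_ones]
  push_cast
  rw [← Finset.sum_add_distrib]
  refine Finset.sum_congr rfl fun d hd => ?_
  have := hA d hd
  rw [abs_of_nonneg this]
  simp only [Equiv.coe_toEmbedding, Equiv.coe_addRight]
  rw [abs_of_nonneg (by omega)]

/-- For a set `F` of charge zero with all elements at least `-(k + 1)`, the shift by `k + 1` is a
set of `k + 1` non-negative integers, which all move up by one before the shift is undone. -/
def raise (k : ℕ) (F : Finset ℤ) : Finset ℤ :=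
  (shift ^ (-((k + 1 : ℕ) : ℤ))) (stepUp ((shift ^ ((k + 1 : ℕ) : ℤ)) F))

lemma shift_zpow_neg_cancel (z : ℤ) (F : Finset ℤ) : (shift ^ (-z)) ((shift ^ z) F) = F := by
  rw [← Equiv.Perm.mul_apply, ← zpow_add, neg_add_cancel, zpow_zero, Equiv.Perm.one_apply]

lemma shift_zpow_cancel_neg (z : ℤ) (F : Finset ℤ) : (shift ^ z) ((shift ^ (-z)) F) = F := by
  rw [← Equiv.Perm.mul_apply, ← zpow_add, add_neg_cancel, zpow_zero, Equiv.Perm.one_apply]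

lemma charge_raise {k : ℕ} {F : Finset ℤ} (hF : ∀ d ∈ F, -((k + 1 : ℕ) : ℤ) ≤ d) :
    charge (raise k F) = charge F := by
  rw [raise, charge_shift_zpow, charge_stepUp (shift_zpow_nonneg hF), charge_shift_zpow]
  ring

lemma energy_raise {k : ℕ} {F : Finset ℤ} (hF : ∀ d ∈ F, -((k + 1 : ℕ) : ℤ) ≤ d)
    (h0 : charge F = 0) : energy (raise k F) = energy F + (k + 1) := by
  have h1 := energy_shift_zpow (-((k + 1 : ℕ) : ℤ)) (stepUp ((shift ^ ((k + 1 : ℕ) : ℤ)) F))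
  have h2 := energy_shift_zpow ((k + 1 : ℕ) : ℤ) F
  rw [energy_stepUp (shift_zpow_nonneg hF), charge_stepUp (shift_zpow_nonneg hF),
    charge_shift_zpow, h0] at h1
  rw [h0] at h2
  zify
  rw [raise]
  push_cast at h1 h2 ⊢
  linarith

open Classical in
/-- The map `raise`, on those sets of charge zero whose charge it preserves. -/
def raiseZero (k : ℕ) (F : ChargeZero) : ChargeZero :=
  if h : charge (raise k F.1) = 0 then ⟨raise k F.1, h⟩ else F

lemma coe_raiseZero {k : ℕ} {F : ChargeZero} (hF : ∀ d ∈ F.1, -((k + 1 : ℕ) : ℤ) ≤ d) :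
    (raiseZero k F).1 = raise k F.1 := by
  rw [raiseZero, dif_pos ((charge_raise hF).trans F.2)]

/-- The step `k` of the filtration consists of the sets with elements at least `-k`; the new ones of
the step `k + 1` arise by `raise`, which vacates the lowest place `-(k + 1)`. -/
lemma isPartitionLike_energy : IsPartitionLike (fun F : ChargeZero => energy F.1)
    (fun k => {F | ∀ d ∈ F.1, -(k : ℤ) ≤ d})
    raiseZero where
  mono k F hF d hd := by
    have := hF d hd
    push_cast
    omega
  exhausting F := by
    refine ⟨energy F.1, fun d hd => ?_⟩
    have := Finset.single_le_sum (f := Int.natAbs) (fun _ _ => Nat.zero_le _) hd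
    rw [energy]
    omega
  zero := by
    refine ⟨⟨∅, rfl⟩, ?_, rfl⟩
    ext F
    simp only [Nat.cast_zero, neg_zero, Set.mem_ofPred_eq, Set.mem_singleton_iff]
    constructor
    · intro h
      have h1 := charge_of_nonneg h
      rw [F.2] at h1
      exact Subtype.ext (Finset.card_eq_zero.1 (by exact_mod_cast h1.symm))
    · rintro rfl
      simp
  bijOn k := by
    refine ⟨fun F hF => ?_, fun F hF F' hF' h => ?_, fun F hF => ?_⟩
    · have h1 := stepUp_nonneg (shift_zpow_nonneg hF)
      simp only [Set.mem_sdiff, Set.mem_ofPred_eq, coe_raiseZero hF]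
      refine ⟨le_of_mem_shift_zpow_neg h1, fun h => ?_⟩
      have h2 : -((k + 1 : ℕ) : ℤ) ∈ raise k F.1 := by
        rw [raise, mem_shift_zpow_neg, mem_stepUp]
        refine iff_of_false (fun h => ?_) (by omega)
        have := shift_zpow_nonneg hF _ h
        omega
      have := h _ h2
      push_cast at this
      omega
    · have h' := congrArg Subtype.val h
      simp only [coe_raiseZero hF, coe_raiseZero hF', raise, EmbeddingLike.apply_eq_iff_eq, stepUp,
        Finset.map_inj] at h'
      exact Subtype.ext h'
    · obtain ⟨h1, h2⟩ := hF
      have hB := shift_zpow_nonneg h1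
      have hmem : -((k + 1 : ℕ) : ℤ) ∈ F.1 := by
        by_contra hn
        refine h2 fun d hd => ?_
        have := h1 d hd
        rcases this.eq_or_lt with h | h
        · exact absurd (h ▸ hd) hn
        · push_cast at h
          omega
      have h0 : (0 : ℤ) ∉ (shift ^ ((k + 1 : ℕ) : ℤ)) F.1 := by
        rw [mem_shift_zpow, zero_sub]
        intro h
        have := h.1 hmem
        omega
      obtain ⟨A, hA⟩ : ∃ A, stepUp A = (shift ^ ((k + 1 : ℕ) : ℤ)) F.1 := by
        refine ⟨((shift ^ ((k + 1 : ℕ) : ℤ)) F.1).map (Equiv.addRight (-1 : ℤ)).toEmbedding, ?_⟩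
        ext d
        rw [mem_stepUp, Finset.mem_map_equiv]
        simp
      have hA0 : ∀ d ∈ A, 0 ≤ d := by
        intro d hd
        have h3 : d + 1 ∈ stepUp A := by rwa [mem_stepUp, add_sub_cancel_right]
        rw [hA] at h3
        have h4 := hB _ h3
        by_contra hneg
        have : d + 1 = 0 := by omega
        rw [this] at h3
        exact h0 h3
      have hG := le_of_mem_shift_zpow_neg (k := k + 1) hA0
      have hr : raise k ((shift ^ (-((k + 1 : ℕ) : ℤ))) A) = F.1 := by
        rw [raise, shift_zpow_cancel_neg, hA, shift_zpow_neg_cancel]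
      have hc : charge ((shift ^ (-((k + 1 : ℕ) : ℤ))) A) = 0 := by
        rw [← charge_raise hG, hr, F.2]
      refine ⟨⟨_, hc⟩, hG, Subtype.ext ?_⟩
      rw [coe_raiseZero hG, hr]
  energy k F hF := by
    rw [coe_raiseZero hF]
    exact energy_raise hF F.2

end

/-! ### The lattice of charges -/

section

variable {n : ℕ}

lemma coord_succ (m : Fin n → ℤ) (i : Fin n) : coord m (i + 1) = m i := by
  rw [coord, dif_pos ⟨by omega, i.2⟩]
  rfl

lemma coord_zero (m : Fin n → ℤ) : coord m 0 = 0 := by rw [coord, dif_neg (by omega)]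

/-- The coordinates `0, m_1, …, m_{n-2}, m_{n-1} + m_n` along the chain in the Dynkin diagram, with
the two ends of the fork taken together. -/
def chainCoord (m : Fin n → ℤ) (k : ℕ) : ℤ :=
  if k + 1 = n then coord m (n - 1) + coord m n else coord m k

/-- The charges that belong to `m`, in the residue class `k`. These are, up to sign, the coordinates
of `∑ m_i α_i` in the standard orthonormal basis, with `α_i` the simple roots of type `D_n`. -/
def chargeOf (m : Fin n → ℤ) (k : ℕ) : ℤ :=
  if k + 1 = n then coord m (n - 1) - coord m n else chainCoord m k - chainCoord m (k + 1)

lemma sum_range_ite_sub (M : ℕ → ℤ) {j r : ℕ} (h : j ≤ r) :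
    ∑ k ∈ Finset.range r, (if j ≤ k then M k - M (k + 1) else 0) = M j - M r := by
  induction r, h using Nat.le_induction with
  | base =>
    rw [Finset.sum_eq_zero, sub_self]
    intro k hk
    rw [if_neg (by simpa using hk)]
  | succ r hr ih =>
    rw [Finset.sum_range_succ, ih, if_pos hr]
    ring

lemma sum_chargeOf (m : Fin n → ℤ) {j : ℕ} (hj : j + 1 ≤ n) :
    (∑ k : Fin n, if j ≤ (k : ℕ) then chargeOf m k else 0) =
      chainCoord m j - 2 * coord m n := by
  obtain ⟨r, rfl⟩ : ∃ r, n = r + 1 := ⟨n - 1, by omega⟩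
  rw [Fin.sum_univ_eq_sum_range fun k => if j ≤ k then chargeOf m k else 0,
    Finset.sum_range_succ, if_pos (show j ≤ r by omega)]
  have h : ∑ k ∈ Finset.range r, (if j ≤ k then chargeOf m k else 0) =
      chainCoord m j - chainCoord m r := by
    rw [← sum_range_ite_sub _ (show j ≤ r by omega)]
    refine Finset.sum_congr rfl fun k hk => ?_
    rw [Finset.mem_range] at hk
    rw [chargeOf, if_neg (show k + 1 ≠ r + 1 by omega)]
  rw [h, chargeOf, if_pos rfl, chainCoord, chainCoord, if_pos rfl]
  ring

lemma sum_chargeOf_all (hn : 4 ≤ n) (m : Fin n → ℤ) :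
    ∑ k : Fin n, chargeOf m k = -2 * coord m n := by
  have := sum_chargeOf m (j := 0) (by omega)
  rw [chainCoord, if_neg (by omega), coord_zero] at this
  simpa using this

lemma dotProduct_cartan (hn : 4 ≤ n) (m : Fin n → ℤ) :
    m ⬝ᵥ (CartanMatrix.D n).mulVec m = ∑ k : Fin n, chargeOf m k ^ 2 := by
  obtain ⟨r, rfl⟩ : ∃ r, n = r + 2 := ⟨n - 2, by omega⟩
  -- Each edge of the Dynkin diagram, directed away from the end of its long arm.
  let a : Fin (r + 2) → Fin (r + 2) → ℤ := fun i j =>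
    (if (i : ℕ) + 1 = j ∧ (j : ℕ) < r then 1 else 0) +
      if (i : ℕ) + 1 = r ∧ ((j : ℕ) = r ∨ (j : ℕ) = r + 1) then 1 else 0
  have hC : ∀ i j, CartanMatrix.D (r + 2) i j = (if i = j then 2 else 0) - a i j - a j i := by
    intro i j
    have := i.2
    have := j.2
    simp only [CartanMatrix.D, Matrix.of_apply, a, Fin.ext_iff]
    split_ifs <;> omega
  have ha : ∀ i : Fin (r + 2), ∑ j, a i j * m j =
      if (i : ℕ) + 1 ≤ r then chainCoord m (i + 2) else 0 := by
    intro i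
    have h : ∀ j, a i j * m j = (if (i : ℕ) + 1 = j ∧ (j : ℕ) < r then coord m (j + 1) else 0) +
        if (i : ℕ) + 1 = r ∧ ((j : ℕ) = r ∨ (j : ℕ) = r + 1) then coord m (j + 1) else 0 := by
      intro j
      rw [coord_succ]
      simp only [a, add_mul, ite_mul, one_mul, zero_mul]
    rw [Finset.sum_congr rfl fun j _ => h j, Fin.sum_univ_eq_sum_range fun j =>
      (if (i : ℕ) + 1 = j ∧ j < r then coord m (j + 1) else 0) +
        if (i : ℕ) + 1 = r ∧ (j = r ∨ j = r + 1) then coord m (j + 1) else 0,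
      Finset.sum_range_succ, Finset.sum_range_succ, Finset.sum_add_distrib]
    have h0 : ∑ j ∈ Finset.range r,
        (if (i : ℕ) + 1 = r ∧ (j = r ∨ j = r + 1) then coord m (j + 1) else 0) = 0 := by
      refine Finset.sum_eq_zero fun j hj => ?_
      rw [Finset.mem_range] at hj
      rw [if_neg (by omega)]
    have h1 : ∑ j ∈ Finset.range r, (if (i : ℕ) + 1 = j ∧ j < r then coord m (j + 1) else 0) =
        if (i : ℕ) + 1 < r then coord m (i + 2) else 0 := by
      simp only [ite_and]
      rw [Finset.sum_ite_eq]
      simp only [Finset.mem_range]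
      split_ifs <;> rfl
    rw [h0, h1, chainCoord]
    rcases lt_trichotomy ((i : ℕ) + 1) r with h | h | h
    · simp only [show ¬ r < r by omega, show ¬ r + 1 < r by omega, show (i : ℕ) + 1 ≠ r by omega,
        h, h.le, and_false, false_and, if_false, if_true, show (i : ℕ) + 2 + 1 ≠ r + 2 by omega,
        add_zero]
    · simp only [h, show ¬ r < r by omega, show ¬ r + 1 < r by omega, le_refl, and_false,
        true_and, if_false, if_true, show (i : ℕ) + 2 + 1 = r + 2 by omega, true_or, or_true,
        zero_add, add_assoc]
      rfl
    · simp only [show ¬ (i : ℕ) + 1 ≤ r by omega, show ¬ (i : ℕ) + 1 < r by omega,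
        show (i : ℕ) + 1 ≠ r by omega, show ¬ r < r by omega, show ¬ r + 1 < r by omega, and_false,
        false_and, if_false, add_zero]
  have hexp : m ⬝ᵥ (CartanMatrix.D (r + 2)).mulVec m =
      ∑ i, (2 * m i ^ 2 - 2 * (m i * ∑ j, a i j * m j)) := by
    have hswap : ∑ i, ∑ j, m i * (a j i * m j) = ∑ i, ∑ j, m i * (a i j * m j) := by
      rw [Finset.sum_comm]
      refine Finset.sum_congr rfl fun i _ => Finset.sum_congr rfl fun j _ => by ring
    simp only [dotProduct, Matrix.mulVec, hC, sub_mul, Finset.sum_sub_distrib, mul_sub,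
      Finset.mul_sum]
    rw [hswap, ← sub_eq_zero]
    simp only [ite_mul, zero_mul, mul_ite, mul_zero, Finset.sum_ite_eq, Finset.mem_univ, if_true]
    simp only [← Finset.mul_sum]
    have : ∀ i, m i * (2 * m i) = 2 * m i ^ 2 := fun i => by ring
    simp only [this, ← Finset.mul_sum]
    ring
  rw [hexp]
  have hsum : ∀ i : Fin (r + 2), 2 * m i ^ 2 - 2 * (m i * ∑ j, a i j * m j) =
      2 * coord m (i + 1) ^ 2 -
        if (i : ℕ) + 1 ≤ r then 2 * (coord m (i + 1) * chainCoord m (i + 2)) else 0 := by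
    intro i
    rw [ha, coord_succ]
    split_ifs <;> ring
  rw [Finset.sum_congr rfl fun i _ => hsum i, Fin.sum_univ_eq_sum_range fun i =>
      2 * coord m (i + 1) ^ 2 -
        if i + 1 ≤ r then 2 * (coord m (i + 1) * chainCoord m (i + 2)) else 0,
    Fin.sum_univ_eq_sum_range fun k => chargeOf m k ^ 2]
  have key : ∀ s ≤ r, ∑ i ∈ Finset.range s, (2 * coord m (i + 1) ^ 2 -
      if i + 1 ≤ r then 2 * (coord m (i + 1) * chainCoord m (i + 2)) else 0) =
      ∑ k ∈ Finset.range (s + 1), chargeOf m k ^ 2 - chainCoord m (s + 1) ^ 2 := by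
    intro s
    induction s with
    | zero =>
      intro _
      simp only [Finset.range_zero, Finset.sum_empty, zero_add, Finset.range_one,
        Finset.sum_singleton, chargeOf, show 1 ≠ r + 2 by omega, if_false]
      rw [show chainCoord m 0 = 0 by rw [chainCoord, if_neg (by omega), coord_zero]]
      ring
    | succ s ih =>
      intro hs
      rw [Finset.sum_range_succ, ih (by omega), Finset.sum_range_succ _ (s + 1), if_pos hs,
        chargeOf, if_neg (show s + 1 + 1 ≠ r + 2 by omega),
        show chainCoord m (s + 1) = coord m (s + 1) by rw [chainCoord, if_neg (by omega)]]
      ring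
  rw [Finset.sum_range_succ, Finset.sum_range_succ, key r le_rfl, Finset.sum_range_succ _ (r + 1),
    if_neg (by omega), if_neg (by omega), chargeOf, if_pos rfl, chainCoord, if_pos rfl]
  simp only [show r + 2 - 1 = r + 1 by omega, show r + 1 + 1 = r + 2 by omega]
  ring

/-- The sets of beads, shifted to charge zero, and the partition `κ`, which are free once the
charges are given. -/
abbrev Excitation (n : ℕ) : Type := (Fin n → ChargeZero) × (ℕ →₀ ℕ)

/-- The number of bar weights that the excitation adds to the weight of a wall. -/
def excitationSize (x : Excitation n) : ℕ := ∑ k, energy (x.1 k).1 + partsSize x.2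

/-- The family of sets with charges `ζ` that `x` is shifted to. -/
def chargedBeads (ζ : Fin n → ℤ) (x : Fin n → ChargeZero) : Fin n → Finset ℤ :=
  fun k => chargeEquiv.symm (ζ k, x k)

lemma charge_chargedBeads (ζ : Fin n → ℤ) (x : Fin n → ChargeZero) (k : Fin n) :
    charge (chargedBeads ζ x k) = ζ k := charge_chargeEquiv_symm _ _

/-- The Young wall with the charges of `m` and the excitation `x`. -/
def wallOf (m : Fin n → ℤ) (x : Excitation n) : Set Block :=
  beadWall n (beads n (chargedBeads (fun k => chargeOf m k) x.1)) x.2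

/-- The summand `-∑ ζ_k / 2` of the energy cancels against the linear term in the weight, so that
half of the square norm of the charges remains. -/
lemma weight_wallOf (hn : 4 ≤ n) (m : Fin n → ℤ) (x : Excitation n) :
    (2 * weight n (wallOf m x) 0 : ℤ) =
      m ⬝ᵥ (CartanMatrix.D n).mulVec m + 2 * excitationSize x ∧
    ∀ j : Fin (n + 1), (weight n (wallOf m x) j : ℤ) =
      coord m j + barWeight n j * weight n (wallOf m x) 0 := by
  have hsum : ∑ k, charge (chargedBeads (fun k => chargeOf m k) x.1 k) = -2 * coord m n := by
    simp only [charge_chargedBeads, sum_chargeOf_all hn]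
  obtain ⟨h0, h1, h2, h3, h4⟩ := weight_beads (κ := x.2) hn
    (show Even (∑ k, charge (chargedBeads (fun k => chargeOf m k) x.1 k)) by
      rw [hsum, neg_mul]
      exact (even_two_mul _).neg)
  have h2' : ∀ j : Fin (n + 1), 2 ≤ (j : ℕ) → (j : ℕ) ≤ n - 2 →
      (weight n (wallOf m x) j : ℤ) = _ := h2
  clear h2
  rw [← wallOf] at h0 h1 h3 h4
  rw [hsum] at h0 h1
  simp only [charge_chargedBeads] at h1 h2' h3
  have e0 : (weight n (wallOf m x) 0 : ℤ) =
      totalEnergy (chargedBeads (fun k => chargeOf m k) x.1) x.2 - coord m n := by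
    have : (⟨0, by omega⟩ : Fin (n + 1)) = 0 := rfl
    rw [this] at h0
    omega
  constructor
  · have ht : totalEnergy (chargedBeads (fun k => chargeOf m k) x.1) x.2 =
        ∑ k, energy (chargedBeads (fun k => chargeOf m k) x.1 k) + partsSize x.2 := rfl
    rw [e0, dotProduct_cartan hn, ht, excitationSize]
    have := sum_chargeOf_all hn m
    have hE : ∀ k : Fin n, (2 * energy (chargedBeads (fun k => chargeOf m k) x.1 k) : ℤ) =
        2 * energy (x.1 k).1 + (chargeOf m k ^ 2 - chargeOf m k) := by
      intro k
      rw [chargedBeads, energy_chargeEquiv_symm]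
      ring
    push_cast
    rw [mul_sub, mul_add, Finset.mul_sum, Finset.sum_congr rfl fun k _ => hE k,
      Finset.sum_add_distrib, Finset.sum_sub_distrib, this, ← Finset.mul_sum]
    ring
  · have l1 : 1 < n + 1 := by omega
    have l2 : n - 1 < n + 1 := by omega
    have l3 : n < n + 1 := by omega
    intro j
    rcases Nat.eq_zero_or_pos j with hj | hj
    · have : j = 0 := Fin.ext hj
      subst this
      simp [barWeight, coord_zero]
    rw [barWeight]
    have hj' := j.2
    by_cases hj1 : (j : ℕ) = 1
    · have : j = ⟨1, l1⟩ := Fin.ext hj1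
      subst this
      rw [if_neg (by simp), e0]
      simp only [chargeOf, chainCoord, coord_zero, show (0 + 1 : ℕ) ≠ n by omega,
        show (0 + 1 + 1 : ℕ) ≠ n by omega, if_false, zero_sub, zero_add] at h1 ⊢
      push_cast
      linarith
    by_cases hj2 : (j : ℕ) ≤ n - 2
    · rw [if_pos ⟨by omega, by omega⟩, h2' j (by omega) hj2, sum_chargeOf m (by omega), e0,
        chainCoord, if_neg (by omega)]
      push_cast
      ring
    rw [if_neg (by omega), e0]
    by_cases hj3 : (j : ℕ) = n
    · have : j = ⟨n, l3⟩ := Fin.ext hj3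
      subst this
      rw [h4]
      push_cast
      ring
    · have : j = ⟨n - 1, l2⟩ := Fin.ext (by simp only; omega)
      subst this
      rw [h3, chargeOf, if_pos (show n - 1 + 1 = n by omega)]
      push_cast
      ring

lemma chargeOf_injective (hn : 4 ≤ n) :
    Function.Injective fun (m : Fin n → ℤ) (k : Fin n) => chargeOf m k := by
  intro m m' h
  have hk : ∀ k : Fin n, chargeOf m k = chargeOf m' k := fun k => congrFun h k
  have hlast : coord m n = coord m' n := by
    have h1 := sum_chargeOf_all hn m
    have h2 := sum_chargeOf_all hn m'
    simp only [hk] at h1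
    omega
  have hchain : ∀ j, j + 1 ≤ n → chainCoord m j = chainCoord m' j := by
    intro j hj
    have h1 := sum_chargeOf m hj
    have h2 := sum_chargeOf m' hj
    simp only [hk] at h1
    omega
  funext i
  rw [← coord_succ m, ← coord_succ m']
  have hi := i.2
  by_cases h1 : (i : ℕ) + 2 < n
  · have := hchain (i + 1) (by omega)
    rwa [chainCoord, chainCoord, if_neg (by omega), if_neg (by omega)] at this
  · by_cases h2 : (i : ℕ) + 1 = n
    · rw [h2, hlast]
    · have := hchain (n - 1) (by omega)
      rw [chainCoord, chainCoord, if_pos (by omega), if_pos (by omega), hlast] at this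
      rw [show (i : ℕ) + 1 = n - 1 by omega]
      omega

/-- The charges fill the lattice of type `D_n`, of the vectors with even sum. -/
lemma exists_chargeOf_eq (hn : 4 ≤ n) {ζ : Fin n → ℤ} (h : Even (∑ k, ζ k)) :
    ∃ m : Fin n → ℤ, (fun k : Fin n => chargeOf m k) = ζ := by
  obtain ⟨s, hs⟩ := h
  let M : ℕ → ℤ := fun j => -∑ k : Fin n, if (k : ℕ) < j then ζ k else 0
  let m : Fin n → ℤ := fun i =>
    if (i : ℕ) + 1 = n then -s else if (i : ℕ) + 2 = n then ζ ⟨n - 1, by omega⟩ - s else M (i + 1)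
  have hM0 : M 0 = 0 := by simp [M]
  have hMs : ∀ k : Fin n, M (k + 1) = M k - ζ k := by
    intro k
    have : ∀ i : Fin n, (if (i : ℕ) < k + 1 then ζ i else 0) =
        (if (i : ℕ) < k then ζ i else 0) + if i = k then ζ i else 0 := by
      intro i
      by_cases hik : i = k
      · subst hik
        simp
      · have hik' : (i : ℕ) ≠ k := fun h => hik (Fin.ext h)
        rw [if_neg hik, add_zero]
        exact if_congr (by omega) rfl rfl
    simp only [M, this, Finset.sum_add_distrib, Finset.sum_ite_eq', Finset.mem_univ, if_true]
    ring
  have hMn : M (n - 1) = ζ ⟨n - 1, by omega⟩ - 2 * s := by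
    have h1 := hMs ⟨n - 1, by omega⟩
    have h2 : M (n - 1 + 1) = -2 * s := by
      simp only [M, show ∀ k : Fin n, (k : ℕ) < n - 1 + 1 by intro k; have := k.2; omega, if_true,
        hs]
      ring
    simp only [h2] at h1
    omega
  have hn1 : coord m (n - 1) = ζ ⟨n - 1, by omega⟩ - s := by
    have := coord_succ m ⟨n - 2, by omega⟩
    simp only [show n - 2 + 1 = n - 1 by omega, m, show n - 1 ≠ n by omega,
      show n - 2 + 2 = n by omega, if_true, if_false] at this
    exact this
  have hn0 : coord m n = -s := by
    have := coord_succ m ⟨n - 1, by omega⟩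
    simp only [show n - 1 + 1 = n by omega, m, if_true] at this
    exact this
  have hchain : ∀ j, j + 1 ≤ n → chainCoord m j = M j := by
    intro j hj
    rw [chainCoord]
    split_ifs with hj'
    · rw [hn1, hn0, show j = n - 1 by omega, hMn]
      ring
    · rcases Nat.eq_zero_or_pos j with rfl | hj0
      · rw [coord_zero, hM0]
      · have := coord_succ m ⟨j - 1, by omega⟩
        simp only [show j - 1 + 1 = j by omega, m, show j ≠ n by omega,
          show j - 1 + 2 ≠ n by omega, if_false] at this
        exact this
  refine ⟨m, funext fun k => ?_⟩
  have hk := k.2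
  rw [chargeOf]
  split_ifs with h
  · have : k = ⟨n - 1, by omega⟩ := Fin.ext (by simp only; omega)
    rw [hn1, hn0, this]
    ring
  · rw [hchain _ (by omega), hchain _ (by omega), hMs]
    ring

theorem wallOf_bijective (hn : 4 ≤ n) :
    (∀ (m : Fin n → ℤ) (x : Excitation n), IsYoungWall n (wallOf m x)) ∧
    (∀ m m' : Fin n → ℤ, ∀ x x' : Excitation n, wallOf m x = wallOf m' x' → m = m' ∧ x = x') ∧
    ∀ Y, IsYoungWall n Y → ∃ (m : Fin n → ℤ) (x : Excitation n), Y = wallOf m x := by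
  have heven : ∀ (m : Fin n → ℤ) (x : Excitation n),
      Even (beads n (chargedBeads (fun k => chargeOf m k) x.1)).card := by
    intro m x
    rw [even_card_beads hn]
    simp only [charge_chargedBeads, sum_chargeOf_all hn, neg_mul]
    exact (even_two_mul _).neg
  refine ⟨fun m x => isYoungWall_beadWall hn (isReduced_beads hn _) _, fun m m' x x' h => ?_,
    fun Y hY => ?_⟩
  · obtain ⟨h1, h2⟩ := beadWall_injective hn (isReduced_beads hn _) (isReduced_beads hn _)
      (heven m x) (heven m' x') h
    have h3 : ∀ k : Fin n, (chargeOf m k, x.1 k) = (chargeOf m' k, x'.1 k) := fun k =>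
      chargeEquiv.symm.injective (congrFun (beads_injective hn h1) k)
    refine ⟨chargeOf_injective hn (funext fun k => congrArg Prod.fst (h3 k)), ?_⟩
    exact Prod.ext (funext fun k => congrArg Prod.snd (h3 k)) h2
  · obtain ⟨D, κ, hD, hc, rfl⟩ := hY.exists_beads hn
    obtain ⟨E, rfl⟩ := hD.exists_beads_eq hn
    rw [even_card_beads hn] at hc
    obtain ⟨m, hm⟩ := exists_chargeOf_eq hn hc
    refine ⟨m, (fun k => (chargeEquiv (E k)).2, κ), ?_⟩
    rw [wallOf]
    congr 2
    funext k
    rw [chargedBeads, congrFun hm k]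
    exact (chargeEquiv.symm_apply_apply (E k)).symm

end

/-! ### Ground walls are cores, and weights of moves of beads -/

section

variable {n : ℕ}

/-- The Young wall of the charges of `m`, without excitation. -/
def groundWall (m : Fin n → ℤ) : Set Block := wallOf m ((fun _ => ⟨∅, rfl⟩), 0)

lemma excitationSize_ground : excitationSize (n := n) ((fun _ => ⟨∅, rfl⟩), 0) = 0 := by
  simp [excitationSize, energy, partsSize]

lemma weight_groundWall (hn : 4 ≤ n) (m : Fin n → ℤ) (i : Fin (n + 1)) :
    (weight n (groundWall m) i : ℚ) = thetaExponent n m i := by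
  obtain ⟨h1, h2⟩ := weight_wallOf hn m ((fun _ => ⟨∅, rfl⟩), 0)
  rw [excitationSize_ground, ← groundWall] at h1
  have h3 := h2 i
  rw [← groundWall] at h3
  have h1' : (2 * weight n (groundWall m) 0 : ℚ) =
      ((m ⬝ᵥ (CartanMatrix.D n).mulVec m : ℤ) : ℚ) := by
    exact_mod_cast (by simpa using h1)
  have h3' : (weight n (groundWall m) i : ℚ) =
      coord m i + barWeight n i * weight n (groundWall m) 0 := by exact_mod_cast h3
  rw [h3', thetaExponent, ← h1']
  ring

lemma weight_wallOf_eq (hn : 4 ≤ n) (m : Fin n → ℤ) (x : Excitation n) :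
    weight n (wallOf m x) = weight n (groundWall m) + excitationSize x • barExponent n := by
  obtain ⟨h1, h2⟩ := weight_wallOf hn m x
  obtain ⟨h3, h4⟩ := weight_wallOf hn m ((fun _ => ⟨∅, rfl⟩), 0)
  rw [excitationSize_ground, ← groundWall] at h3
  ext j
  have h5 := h2 j
  have h6 := h4 j
  rw [← groundWall] at h6
  have h7 : (weight n (wallOf m x) 0 : ℤ) = weight n (groundWall m) 0 + excitationSize x := by
    push_cast at h3
    omega
  rw [h7] at h5
  rw [Finsupp.add_apply, Finsupp.smul_apply, barExponent_apply, smul_eq_mul]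
  zify
  rw [h5, h6]
  ring

lemma eq_of_weight_eq (hn : 4 ≤ n) {m m' : Fin n → ℤ} {x x' : Excitation n}
    (h : weight n (wallOf m x) = weight n (wallOf m' x')) :
    m = m' ∧ excitationSize x = excitationSize x' := by
  obtain ⟨h1, h2⟩ := weight_wallOf hn m x
  obtain ⟨h3, h4⟩ := weight_wallOf hn m' x'
  have hm : m = m' := by
    funext i
    have h5 := h2 i.succ
    have h6 := h4 i.succ
    rw [h] at h5
    rw [← coord_succ m, ← coord_succ m']
    simp only [Fin.val_succ] at h5 h6
    omega
  subst hm
  rw [h] at h1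
  exact ⟨rfl, by omega⟩

theorem isCore_groundWall (hn : 4 ≤ n) (m : Fin n → ℤ) : IsCore n (groundWall m) := by
  obtain ⟨hwall, -, hsurj⟩ := wallOf_bijective hn
  refine ⟨hwall m _, ?_⟩
  rintro ⟨S, hS, hbar, hY⟩
  obtain ⟨m', x', hx'⟩ := hsurj _ hY
  have hw : weight n (groundWall m) = weight n (wallOf m' x') + barExponent n := by
    ext j
    have h1 := ncard_label_sdiff (hwall m _) hY Set.sdiff_subset j
    rw [← groundWall, Set.sdiff_sdiff_cancel_left hS, hbar.2.2 j, hx'] at h1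
    rw [Finsupp.add_apply, barExponent_apply, ← h1, add_comm]
  -- An excitation one larger than that of the remaining wall has the weight of the ground wall.
  rw [weight_wallOf_eq hn, add_assoc, ← succ_nsmul] at hw
  obtain ⟨x, hx⟩ : ∃ x : Excitation n, excitationSize x = excitationSize x' + 1 := by
    refine ⟨(x'.1, x'.2 + Finsupp.single 0 1), ?_⟩
    rw [excitationSize, partsSize_add, partsSize_single, excitationSize]
    ring
  rw [← hx, ← weight_wallOf_eq hn, groundWall] at hw
  have := (eq_of_weight_eq hn hw).2
  rw [excitationSize_ground] at this
  omega

/-- Two walls of beads with the same charges, with energies that differ by one, differ by the weight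
of a bar. -/
lemma weight_beadWall_sub (hn : 4 ≤ n) {D D' : Finset ℤ} {κ κ' : ℕ →₀ ℕ} (hD : IsReduced n D)
    (hD' : IsReduced n D') (hc : Even D.card)
    (hζ : ∀ k : ℤ, ∑ y ∈ D, (if y % (2 * n - 2) = k then beadSign (y / (2 * n - 2)) else 0) =
      ∑ y ∈ D', if y % (2 * n - 2) = k then beadSign (y / (2 * n - 2)) else 0)
    (he : ∑ y ∈ D, (y / (2 * n - 2)).natAbs + partsSize κ =
      ∑ y ∈ D', (y / (2 * n - 2)).natAbs + partsSize κ' + 1) (j : Fin (n + 1)) :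
    weight n (beadWall n D κ) j = weight n (beadWall n D' κ') j + barWeight n j := by
  obtain ⟨E, rfl⟩ := hD.exists_beads_eq hn
  obtain ⟨E', rfl⟩ := hD'.exists_beads_eq hn
  have hcharge : ∀ (E : Fin n → Finset ℤ) (k : Fin n), ∑ y ∈ beads n E,
      (if y % (2 * n - 2) = ((k : ℕ) : ℤ) then beadSign (y / (2 * n - 2)) else 0) =
        charge (E k) := by
    intro E k
    rw [sum_beads hn, Finset.sum_eq_single k]
    · refine Finset.sum_congr rfl fun d _ => ?_
      rw [(bead_div_mod hn d k.2).1, (bead_div_mod hn d k.2).2, if_pos rfl]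
    · intro i _ hi
      refine Finset.sum_eq_zero fun d _ => ?_
      rw [(bead_div_mod hn d i.2).2, if_neg]
      exact fun h => hi (Fin.ext (by exact_mod_cast h))
    · simp
  have hen : ∀ (E : Fin n → Finset ℤ) (κ : ℕ →₀ ℕ),
      ∑ y ∈ beads n E, (y / (2 * n - 2)).natAbs + partsSize κ = totalEnergy E κ := by
    intro E κ
    rw [sum_beads hn, totalEnergy, partsSize]
    congr 1
    refine Finset.sum_congr rfl fun k _ => Finset.sum_congr rfl fun d _ => ?_
    rw [(bead_div_mod hn d k.2).1]
  have hE : ∀ k, charge (E k) = charge (E' k) := fun k => by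
    rw [← hcharge, ← hcharge, hζ]
  rw [hen, hen] at he
  rw [even_card_beads hn] at hc
  obtain ⟨a0, a1, a2, a3, a4⟩ := weight_beads (κ := κ) hn hc
  simp only [hE] at hc a0 a1 a2 a3
  obtain ⟨b0, b1, b2, b3, b4⟩ := weight_beads (κ := κ') hn hc
  rw [he] at a0 a1 a3 a4
  simp only [he] at a2
  push_cast at a0 a1 a2 a3 a4
  have l1 : 1 < n + 1 := by omega
  have l2 : n - 1 < n + 1 := by omega
  have l3 : n < n + 1 := by omega
  have hj' := j.2
  rw [barWeight]
  by_cases h : 2 ≤ (j : ℕ) ∧ (j : ℕ) + 2 ≤ n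
  · have h1 := a2 j h.1 (by omega)
    have h2 := b2 j h.1 (by omega)
    rw [if_pos h]
    omega
  rw [if_neg h]
  rcases (show (j : ℕ) = 0 ∨ (j : ℕ) = 1 ∨ (j : ℕ) = n - 1 ∨ (j : ℕ) = n by omega)
    with h | h | h | h
  · have : j = ⟨0, by omega⟩ := Fin.ext h
    rw [this]
    omega
  · have : j = ⟨1, l1⟩ := Fin.ext h
    rw [this]
    omega
  · have : j = ⟨n - 1, l2⟩ := Fin.ext h
    rw [this]
    omega
  · have : j = ⟨n, l3⟩ := Fin.ext h
    rw [this]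
    omega

lemma tailCount_erase {D : Finset ℤ} {κ : ℕ →₀ ℕ} {y : ℤ} (hy : y ∈ D) (x : ℕ) :
    tailCount n D κ x = tailCount n (D.erase y) κ x + if x ≤ y.natAbs then 1 else 0 := by
  rw [tailCount, tailCount, Finset.filter_erase]
  split_ifs with h
  · rw [← Finset.card_erase_add_one (s := D.filter fun y => x ≤ y.natAbs)
      (Finset.mem_filter.2 ⟨hy, h⟩)]
    ring
  · rw [Finset.erase_eq_of_notMem (s := D.filter fun y => x ≤ y.natAbs)
      fun hm => h (Finset.mem_filter.1 hm).2, add_zero]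

lemma tailCount_add_single {D : Finset ℤ} (κ : ℕ →₀ ℕ) (i x : ℕ) :
    tailCount n D (κ + Finsupp.single i 1) x =
      tailCount n D κ x + if x ≤ (i + 1) * (n - 1) then 2 else 0 := by
  rw [tailCount, Finsupp.sum_add_index', Finsupp.sum_single_index, tailCount]
  · split_ifs <;> ring
  · simp
  · simp
  · intro _ a b
    split_ifs <;> rfl

/-- One more pair of beads at `v (n - 1)`. For `v = 0` there is nothing to add. -/
lemma exists_add_pair (n : ℕ) (κ : ℕ →₀ ℕ) (v : ℕ) :
    ∃ κ', partsSize κ' = partsSize κ + v ∧ ∀ (D : Finset ℤ) (x : ℕ), 1 ≤ x →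
      tailCount n D κ' x = tailCount n D κ x + if x ≤ v * (n - 1) then 2 else 0 := by
  rcases Nat.eq_zero_or_pos v with rfl | hv
  · refine ⟨κ, rfl, fun D x hx => ?_⟩
    rw [if_neg (by omega), add_zero]
  · refine ⟨κ + Finsupp.single (v - 1) 1, ?_, fun D x _ => ?_⟩
    · rw [partsSize_add, partsSize_single]
      omega
    · rw [tailCount_add_single, show v - 1 + 1 = v by omega]

lemma beadShape_congr {D D' : Finset ℤ} {κ κ' : ℕ →₀ ℕ} {u : ℕ}
    (h1 : ((u * (n - 1) : ℕ) : ℤ) ∈ D ↔ ((u * (n - 1) : ℕ) : ℤ) ∈ D')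
    (h2 : -((u * (n - 1) : ℕ) : ℤ) ∈ D ↔ -((u * (n - 1) : ℕ) : ℤ) ∈ D')
    (h3 : tailCount n D κ (u * (n - 1) + 1) % 2 = tailCount n D' κ' (u * (n - 1) + 1) % 2) :
    beadShape n D κ u = beadShape n D' κ' u := by
  have h4 : Even (tailCount n D κ (u * (n - 1) + 1)) ↔
      Even (tailCount n D' κ' (u * (n - 1) + 1)) := by rw [Nat.even_iff, Nat.even_iff, h3]
  have h5 : Odd (tailCount n D κ (u * (n - 1) + 1)) ↔
      Odd (tailCount n D' κ' (u * (n - 1) + 1)) := by rw [Nat.odd_iff, Nat.odd_iff, h3]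
  simp only [beadShape, h1, h2, h4, h5]

/-- The criterion for a move of beads, from `D` and `κ` to `D'` and `κ'`, to be the removal of a
bar. -/
lemma not_isCore_beadWall (hn : 4 ≤ n) {D D' : Finset ℤ} {κ κ' : ℕ →₀ ℕ} (hD : IsReduced n D)
    (hD' : IsReduced n D') (hc : Even D.card)
    (hζ : ∀ k : ℤ, ∑ y ∈ D, (if y % (2 * n - 2) = k then beadSign (y / (2 * n - 2)) else 0) =
      ∑ y ∈ D', if y % (2 * n - 2) = k then beadSign (y / (2 * n - 2)) else 0)
    (he : ∑ y ∈ D, (y / (2 * n - 2)).natAbs + partsSize κ =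
      ∑ y ∈ D', (y / (2 * n - 2)).natAbs + partsSize κ' + 1)
    (H : ∀ u, 1 ≤ u → tailCount n D' κ' (u * (n - 1)) ≤ tailCount n D κ (u * (n - 1) + 1) ∨
      beadShape n D' κ' u = beadShape n D κ u) {lo hi : ℕ}
    (hin : ∀ x, lo < x → x ≤ hi → tailCount n D' κ' x < tailCount n D κ x ∧
      tailCount n D κ x ≤ tailCount n D' κ' x + 2)
    (hout : ∀ x, 1 ≤ x → x ≤ lo ∨ hi < x → tailCount n D κ x = tailCount n D' κ' x)
    (hstep : ∀ x, lo < x → x < hi → tailCount n D κ x ≤ tailCount n D κ (x + 1) + 1) :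
    ¬ IsCore n (beadWall n D κ) := by
  refine not_isCore_wall hn (isProfile_beads hn hD κ) (isProfile_beads hn hD' κ')
    (weight_beadWall_sub hn hD hD' hc hζ he) H (lo := lo) (hi := hi) ?_ hin ?_ hstep
  · intro x hx
    by_cases h : lo < x ∧ x ≤ hi
    · exact (hin x h.1 h.2).1.le
    · exact (hout x hx (by omega)).ge
  · intro x hx hlt
    by_contra h
    have := hout x hx (by omega)
    omega

lemma parts_eq_zero_of_isCore (hn : 4 ≤ n) {D : Finset ℤ} {κ : ℕ →₀ ℕ} (hD : IsReduced n D)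
    (hc : Even D.card) (hY : IsCore n (beadWall n D κ)) : κ = 0 := by
  by_contra hκ
  obtain ⟨i, hi⟩ := Finsupp.ne_iff.1 hκ
  rw [Finsupp.zero_apply] at hi
  obtain ⟨κ₀, rfl⟩ : ∃ κ₀, κ = κ₀ + Finsupp.single i 1 :=
    ⟨κ - Finsupp.single i 1, (tsub_add_cancel_of_le (by rw [Finsupp.single_le_iff]; omega)).symm⟩
  -- The pair at `(i + 1) (n - 1)` moves to `i (n - 1)`, or vanishes if `i = 0`.
  obtain ⟨κ', hs, ht⟩ := exists_add_pair n κ₀ i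
  have hmul : (i + 1) * (n - 1) = i * (n - 1) + (n - 1) := by ring
  have hin : ∀ x, i * (n - 1) < x → x ≤ (i + 1) * (n - 1) →
      tailCount n D (κ₀ + Finsupp.single i 1) x = tailCount n D κ' x + 2 := by
    intro x h1 h2
    rw [ht D x (by omega), tailCount_add_single, if_pos h2, if_neg (by omega)]
  have hout : ∀ x, 1 ≤ x → x ≤ i * (n - 1) ∨ (i + 1) * (n - 1) < x →
      tailCount n D (κ₀ + Finsupp.single i 1) x = tailCount n D κ' x := by
    intro x h0 h
    rw [ht D x h0, tailCount_add_single]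
    split_ifs <;> omega
  refine not_isCore_beadWall hn hD hD hc (κ' := κ') (fun _ => rfl) ?_ (fun u hu => Or.inr ?_)
    (fun x h1 h2 => ?_) hout (fun x h1 h2 => ?_) hY
  · rw [partsSize_add, partsSize_single, hs]
    ring
  · refine beadShape_congr Iff.rfl Iff.rfl ?_
    by_cases h : i * (n - 1) < u * (n - 1) + 1 ∧ u * (n - 1) + 1 ≤ (i + 1) * (n - 1)
    · rw [hin _ h.1 h.2]
      omega
    · rw [hout _ (by omega) (by omega)]
  · rw [hin x h1 h2]
    omega
  · refine (isProfile_beads hn hD _).step x fun hdvd => ?_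
    obtain ⟨v, rfl⟩ := hdvd
    rw [mul_comm (n - 1) v] at h1 h2
    have h3 := Nat.lt_of_mul_lt_mul_right h1
    have h4 := Nat.lt_of_mul_lt_mul_right h2
    omega

end

/-! ### Cores are ground walls -/

section

variable {n : ℕ}

lemma half_bead (hn : 4 ≤ n) (u : ℕ) :
    ((u * (n - 1) : ℕ) : ℤ) % (2 * n - 2) = (-((u * (n - 1) : ℕ) : ℤ)) % (2 * n - 2) ∧
    (((u * (n - 1) : ℕ) : ℤ) / (2 * n - 2)).natAbs +
      ((-((u * (n - 1) : ℕ) : ℤ)) / (2 * n - 2)).natAbs = u ∧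
    ((u * (n - 1) : ℕ) : ℤ) % (2 * n - 2) < n := by
  rcases Nat.even_or_odd' u with ⟨i, rfl | rfl⟩
  · have h1 := bead_div_mod hn (i : ℤ) (k := 0) (by omega)
    have h2 := bead_div_mod hn (-(i : ℤ)) (k := 0) (by omega)
    rw [half_even_eq hn, ← neg_mul]
    simp only [Nat.cast_zero, add_zero] at h1 h2
    rw [h1.1, h1.2, h2.1, h2.2]
    exact ⟨rfl, by omega, by omega⟩
  · have h1 := bead_div_mod hn (i : ℤ) (k := n - 1) (by omega)
    have h2 := bead_div_mod hn (-(i + 1 : ℤ)) (k := n - 1) (by omega)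
    have h3 : -((i : ℤ) * (2 * n - 2) + (n - 1 : ℕ)) =
        -(i + 1 : ℤ) * (2 * n - 2) + (n - 1 : ℕ) := by
      push_cast [show 1 ≤ n by omega]
      ring
    rw [half_odd_eq hn, h3, h1.1, h1.2, h2.1, h2.2]
    exact ⟨rfl, by omega, by omega⟩

/-- If no two beads have the same position, the condition on shapes for a move of beads has to be
verified only at the lower end `lo` of the interval in which columns are lost: below and above it
the shapes do not change, and inside it the loss of one column is enough for the other alternative.
-/
lemma le_or_beadShape_eq (hn : 4 ≤ n) {D D' : Finset ℤ} {κ' : ℕ →₀ ℕ}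
    (hpair : ∀ u, 1 ≤ u → ¬ (((u * (n - 1) : ℕ) : ℤ) ∈ D ∧ -((u * (n - 1) : ℕ) : ℤ) ∈ D))
    {lo hi : ℕ}
    (hin : ∀ x, lo < x → x ≤ hi → tailCount n D' κ' x < tailCount n D 0 x)
    (hout : ∀ x, 1 ≤ x → x ≤ lo ∨ hi < x → tailCount n D 0 x = tailCount n D' κ' x)
    (hmem : ∀ y : ℤ, y.natAbs < lo ∨ hi < y.natAbs → (y ∈ D' ↔ y ∈ D))
    (hlo : ∀ u, 1 ≤ u → u * (n - 1) = lo →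
      tailCount n D' κ' (u * (n - 1)) ≤ tailCount n D 0 (u * (n - 1) + 1) ∨
      beadShape n D' κ' u = beadShape n D 0 u) :
    ∀ u, 1 ≤ u → tailCount n D' κ' (u * (n - 1)) ≤ tailCount n D 0 (u * (n - 1) + 1) ∨
      beadShape n D' κ' u = beadShape n D 0 u := by
  intro u hu
  have h1 := tailCount_half (n := n) (D := D) (κ := 0) hn hu
  rcases lt_trichotomy (u * (n - 1)) lo with h | h | h
  · right
    refine beadShape_congr (hmem _ (by omega)) (hmem _ (by omega)) ?_
    rw [hout _ (by omega) (by omega)]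
  · exact hlo u hu h
  · by_cases hh : u * (n - 1) ≤ hi
    · left
      have h2 := hin _ h hh
      have h3 := hpair u hu
      rw [Finsupp.zero_apply] at h1
      split_ifs at h1 <;> first | omega | exact absurd ⟨‹_›, ‹_›⟩ h3
    · right
      refine beadShape_congr (hmem _ (by omega)) (hmem _ (by omega)) ?_
      rw [hout _ (by omega) (by omega)]

lemma tailCount_le_succ (hn : 4 ≤ n) {D : Finset ℤ} (hD : IsReduced n D)
    (hpair : ∀ u, 1 ≤ u → ¬ (((u * (n - 1) : ℕ) : ℤ) ∈ D ∧ -((u * (n - 1) : ℕ) : ℤ) ∈ D))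
    {x : ℕ} (hx : 1 ≤ x) : tailCount n D 0 x ≤ tailCount n D 0 (x + 1) + 1 := by
  by_cases hd : (n - 1) ∣ x
  · obtain ⟨u, rfl⟩ := hd
    have hu : 1 ≤ u := Nat.pos_of_mul_pos_left hx
    rw [mul_comm (n - 1) u]
    have h1 := tailCount_half (n := n) (D := D) (κ := 0) hn hu
    have h3 := hpair u hu
    rw [Finsupp.zero_apply] at h1
    split_ifs at h1 <;> first | omega | exact absurd ⟨‹_›, ‹_›⟩ h3
  · exact (isProfile_beads hn hD 0).step x hd

lemma sum_erase_erase {M : Type*} [AddCommMonoid M] {D : Finset ℤ} {y z : ℤ} (hy : y ∈ D)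
    (hz : z ∈ D) (hyz : z ≠ y) (g : ℤ → M) :
    ∑ a ∈ D, g a = ∑ a ∈ (D.erase y).erase z, g a + (g y + g z) := by
  rw [← Finset.sum_erase_add _ _ hy, ← Finset.sum_erase_add _ _ (Finset.mem_erase.2 ⟨hyz, hz⟩),
    add_assoc, add_comm (g z)]

/-- The removal of two beads of opposite sign in the same residue class keeps the charges. -/
lemma charge_erase_erase {D : Finset ℤ} {y z : ℤ} (hy : y ∈ D)
    (hz : z ∈ D) (hmod : y % (2 * n - 2) = z % (2 * n - 2))
    (hsign : beadSign (y / (2 * n - 2)) + beadSign (z / (2 * n - 2)) = 0) (k : ℤ) :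
    ∑ y ∈ D, (if y % (2 * n - 2) = k then beadSign (y / (2 * n - 2)) else 0) =
      ∑ y ∈ (D.erase y).erase z,
        if y % (2 * n - 2) = k then beadSign (y / (2 * n - 2)) else 0 := by
  have hyz : z ≠ y := by
    rintro rfl
    rw [beadSign] at hsign
    split_ifs at hsign <;> omega
  rw [sum_erase_erase hy hz hyz, hmod]
  split_ifs
  · rw [hsign, add_zero]
  · simp

lemma tailCount_erase_erase {D : Finset ℤ} {κ : ℕ →₀ ℕ} {y z : ℤ} (hy : y ∈ D) (hz : z ∈ D)
    (hyz : z ≠ y) (x : ℕ) :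
    tailCount n D κ x = tailCount n ((D.erase y).erase z) κ x +
      (if x ≤ y.natAbs then 1 else 0) + if x ≤ z.natAbs then 1 else 0 := by
  rw [tailCount_erase hy, tailCount_erase (Finset.mem_erase.2 ⟨hyz, hz⟩)]
  ring

lemma beadSign_div (hn : 4 ≤ n) (y : ℤ) : beadSign (y / (2 * n - 2)) = beadSign y := by
  rw [beadSign, beadSign]
  exact if_congr (Int.ediv_nonneg_iff_of_pos (by omega)) rfl rfl

/-- In a core, no two beads of opposite sign have the same position `u (n - 1)`. Otherwise they
could be replaced by a pair of beads at `(u - 1) (n - 1)`. -/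
lemma no_pair_of_isCore (hn : 4 ≤ n) {D : Finset ℤ} (hD : IsReduced n D)
    (hc : Even D.card) (hY : IsCore n (beadWall n D 0)) {u : ℕ} (hu : 1 ≤ u) :
    ¬ (((u * (n - 1) : ℕ) : ℤ) ∈ D ∧ -((u * (n - 1) : ℕ) : ℤ) ∈ D) := by
  rintro ⟨hy, hz⟩
  obtain ⟨v, rfl⟩ : ∃ v, u = v + 1 := ⟨u - 1, by omega⟩
  have hpos : 0 < (v + 1) * (n - 1) := Nat.mul_pos hu (by omega)
  have hmul : (v + 1) * (n - 1) = v * (n - 1) + (n - 1) := by ring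
  obtain ⟨b1, b2, -⟩ := half_bead hn (v + 1)
  obtain ⟨κ', hs, ht⟩ := exists_add_pair n 0 v
  have hyz : -(((v + 1) * (n - 1) : ℕ) : ℤ) ≠ (((v + 1) * (n - 1) : ℕ) : ℤ) := by omega
  have hdiff := fun x => tailCount_erase_erase (n := n) (κ := 0) hy hz hyz x
  have hsum := sum_erase_erase hy hz hyz fun a : ℤ => (a / (2 * n - 2)).natAbs
  have hin : ∀ x, v * (n - 1) < x → x ≤ (v + 1) * (n - 1) → tailCount n D 0 x =
      tailCount n ((D.erase (((v + 1) * (n - 1) : ℕ) : ℤ)).erase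
        (-(((v + 1) * (n - 1) : ℕ) : ℤ))) κ' x + 2 := by
    intro x h1 h2
    rw [ht _ x (by omega), hdiff, if_pos (by omega), if_pos (by omega), if_neg (by omega)]
  have hout : ∀ x, 1 ≤ x → x ≤ v * (n - 1) ∨ (v + 1) * (n - 1) < x → tailCount n D 0 x =
      tailCount n ((D.erase (((v + 1) * (n - 1) : ℕ) : ℤ)).erase
        (-(((v + 1) * (n - 1) : ℕ) : ℤ))) κ' x := by
    intro x h0 h
    rw [ht _ x (by omega), hdiff]
    split_ifs <;> omega
  refine not_isCore_beadWall hn hD (D' := (D.erase (((v + 1) * (n - 1) : ℕ) : ℤ)).erase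
    (-(((v + 1) * (n - 1) : ℕ) : ℤ))) (κ' := κ')
    (fun a ha => hD a (Finset.mem_of_mem_erase (Finset.mem_of_mem_erase ha))) hc
    (charge_erase_erase hy hz b1 ?_) ?_ (fun w hw => ?_) (fun x h1 h2 => ?_) hout
    (fun x h1 h2 => ?_) hY
  · rw [beadSign_div hn, beadSign_div hn, beadSign, beadSign, if_pos (by omega),
      if_neg (by omega)]
    rfl
  · have : partsSize 0 = 0 := rfl
    omega
  · by_cases h : w = v + 1
    · subst h
      left
      have h1 := hin _ (by omega) le_rfl
      rw [tailCount_half hn hu, if_pos hy, if_pos hz, Finsupp.zero_apply] at h1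
      omega
    · right
      have hne : w * (n - 1) ≠ (v + 1) * (n - 1) := fun he =>
        h (Nat.eq_of_mul_eq_mul_right (by omega) he)
      refine beadShape_congr ?_ ?_ ?_
      · rw [Finset.mem_erase, Finset.mem_erase]
        exact ⟨fun h => h.2.2, fun h => ⟨by omega, by omega, h⟩⟩
      · rw [Finset.mem_erase, Finset.mem_erase]
        exact ⟨fun h => h.2.2, fun h => ⟨by omega, by omega, h⟩⟩
      · by_cases h2 : v * (n - 1) < w * (n - 1) + 1 ∧ w * (n - 1) + 1 ≤ (v + 1) * (n - 1)
        · rw [hin _ h2.1 h2.2]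
          omega
        · rw [hout _ (by omega) (by omega)]
  · rw [hin x h1 h2]
    omega
  · refine (isProfile_beads hn hD _).step x fun hdvd => ?_
    obtain ⟨w, rfl⟩ := hdvd
    rw [mul_comm (n - 1) w] at h1 h2
    have h3 := Nat.lt_of_mul_lt_mul_right h1
    have h4 := Nat.lt_of_mul_lt_mul_right h2
    omega

/-- In a core, no bead can move by `2 n - 2` towards the origin. -/
lemma no_step_of_isCore (hn : 4 ≤ n) {D : Finset ℤ} (hD : IsReduced n D)
    (hc : Even D.card) (hY : IsCore n (beadWall n D 0)) {y z : ℤ} (hy : y ∈ D)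
    (habs : (y.natAbs : ℤ) = z.natAbs + (2 * n - 2))
    (hdiv : (y / (2 * n - 2)).natAbs = (z / (2 * n - 2)).natAbs + 1)
    (hmod : y % (2 * n - 2) = z % (2 * n - 2)) (hsign : beadSign y = beadSign z) : z ∈ D := by
  by_contra hz
  have hpair := fun u (hu : 1 ≤ u) => no_pair_of_isCore hn hD hc hY hu
  have hzy : z ≠ y := fun h => hz (h ▸ hy)
  by_cases hcase : ∃ u, 1 ≤ u ∧ u * (n - 1) = z.natAbs ∧ -z ∈ D ∧ beadShape n D 0 u = false
  · -- A bead at `z` next to the one at `-z` would need the other shape. Instead of moving `y` to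
    -- `z`, the beads at `y` and `-z` are replaced by a pair of beads at `|z|`.
    obtain ⟨u, hu, huz, hz', hsh⟩ := hcase
    have hpos : 0 < u * (n - 1) := Nat.mul_pos hu (by omega)
    obtain ⟨b1, b2, -⟩ := half_bead hn u
    obtain ⟨κ', hs, ht⟩ := exists_add_pair n 0 u
    have hb : z % (2 * n - 2) = (-z) % (2 * n - 2) ∧
        (z / (2 * n - 2)).natAbs + ((-z) / (2 * n - 2)).natAbs = u := by
      rcases Int.natAbs_eq z with h | h
      · rw [← huz] at h
        rw [h]
        exact ⟨b1, b2⟩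
      · rw [← huz] at h
        rw [h, neg_neg]
        exact ⟨b1.symm, by omega⟩
    have hyz : -z ≠ y := by
      rintro rfl
      omega
    have hdiff := fun x => tailCount_erase_erase (n := n) (κ := 0) hy hz' hyz x
    have hsum := sum_erase_erase hy hz' hyz fun a : ℤ => (a / (2 * n - 2)).natAbs
    have hin : ∀ x, z.natAbs < x → x ≤ y.natAbs → tailCount n D 0 x =
        tailCount n ((D.erase y).erase (-z)) κ' x + 1 := by
      intro x h1 h2
      rw [ht _ x (by omega), hdiff, if_pos h2, if_neg (by omega), if_neg (by omega)]
    have hout : ∀ x, 1 ≤ x → x ≤ z.natAbs ∨ y.natAbs < x → tailCount n D 0 x =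
        tailCount n ((D.erase y).erase (-z)) κ' x := by
      intro x h0 h
      rw [ht _ x (by omega), hdiff]
      split_ifs <;> omega
    refine not_isCore_beadWall hn hD (D' := (D.erase y).erase (-z)) (κ' := κ')
      (fun a ha => hD a (Finset.mem_of_mem_erase (Finset.mem_of_mem_erase ha))) hc
      (charge_erase_erase hy hz' (hmod.trans hb.1) ?_) ?_
      (le_or_beadShape_eq hn hpair (lo := z.natAbs) (hi := y.natAbs)
        (fun x h1 h2 => ?_) hout (fun a ha => ?_) fun w hw hwz => Or.inr ?_)
      (fun x h1 h2 => ?_) hout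
      (fun x h1 h2 => tailCount_le_succ hn hD hpair (by omega)) hY
    · rw [beadSign_div hn, beadSign_div hn, hsign, beadSign, beadSign]
      split_ifs <;> omega
    · have : partsSize 0 = 0 := rfl
      omega
    · rw [hin x h1 h2]
      omega
    · rw [Finset.mem_erase, Finset.mem_erase]
      refine ⟨fun h => h.2.2, fun h => ⟨?_, ?_, h⟩⟩
      · rintro rfl
        omega
      · rintro rfl
        omega
    · have hwu : w = u := Nat.eq_of_mul_eq_mul_right (show 0 < n - 1 by omega) (hwz.trans huz.symm)
      subst hwu
      rw [hsh, beadShape, if_neg (by omega), if_neg, if_neg]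
      · rw [Finset.mem_erase, Finset.mem_erase]
        rintro ⟨h1, -, h2⟩
        refine hz ?_
        rcases Int.natAbs_eq z with h | h
        · rw [hwz] at h1
          omega
        · rwa [h, ← hwz]
      · rw [Finset.mem_erase, Finset.mem_erase]
        rintro ⟨h1, -, h2⟩
        refine hz ?_
        rcases Int.natAbs_eq z with h | h
        · rwa [h, ← hwz]
        · rw [hwz] at h1
          omega
    · rw [hin x h1 h2]
      omega
  · -- Otherwise the bead at `y` moves to `z`.
    have hz1 : z ∉ D.erase y := fun h => hz (Finset.mem_of_mem_erase h)
    have herase : (insert z (D.erase y)).erase z = D.erase y := Finset.erase_insert hz1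
    have hdiff : ∀ x, tailCount n D 0 x + (if x ≤ z.natAbs then 1 else 0) =
        tailCount n (insert z (D.erase y)) 0 x + if x ≤ y.natAbs then 1 else 0 := by
      intro x
      rw [tailCount_erase hy, tailCount_erase (Finset.mem_insert_self z (D.erase y)), herase]
      ring
    have hin : ∀ x, z.natAbs < x → x ≤ y.natAbs → tailCount n D 0 x =
        tailCount n (insert z (D.erase y)) 0 x + 1 := by
      intro x h1 h2
      have := hdiff x
      rwa [if_pos h2, if_neg (by omega), add_zero] at this
    have hout : ∀ x, 1 ≤ x → x ≤ z.natAbs ∨ y.natAbs < x → tailCount n D 0 x =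
        tailCount n (insert z (D.erase y)) 0 x := by
      intro x h0 h
      have := hdiff x
      split_ifs at this <;> omega
    refine not_isCore_beadWall hn hD (D' := insert z (D.erase y)) (κ' := 0)
      (fun a ha => ?_) hc (fun k => ?_) ?_
      (le_or_beadShape_eq hn hpair (lo := z.natAbs) (hi := y.natAbs)
        (fun x h1 h2 => ?_) hout (fun a ha => ?_) fun w hw hwz => ?_)
      (fun x h1 h2 => ?_) hout
      (fun x h1 h2 => tailCount_le_succ hn hD hpair (by omega)) hY
    · rcases Finset.mem_insert.1 ha with rfl | ha
      · rw [← hmod]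
        exact hD y hy
      · exact hD a (Finset.mem_of_mem_erase ha)
    · rw [Finset.sum_insert hz1, ← Finset.add_sum_erase _ _ hy, hmod, beadSign_div hn y,
        beadSign_div hn z, hsign]
    · rw [Finset.sum_insert hz1, ← Finset.add_sum_erase _ _ hy, hdiv]
      ring
    · rw [hin x h1 h2]
      omega
    · rw [Finset.mem_insert, Finset.mem_erase]
      constructor
      · rintro (rfl | h)
        · omega
        · exact h.2
      · refine fun h => Or.inr ⟨?_, h⟩
        rintro rfl
        omega
    · by_cases hz' : -z ∈ D
      · right
        have hsh : beadShape n D 0 w = true := by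
          by_contra h
          exact hcase ⟨w, hw, hwz, hz', by simpa using h⟩
        have h1 : -z ∈ insert z (D.erase y) := by
          refine Finset.mem_insert_of_mem (Finset.mem_erase.2 ⟨?_, hz'⟩)
          rintro rfl
          omega
        have h2 := Finset.mem_insert_self z (D.erase y)
        rw [hsh, beadShape, if_neg (by omega), hwz]
        rcases Int.natAbs_eq z with h | h
        · rw [← h, if_pos h2, if_pos h1]
        · have h' : (z.natAbs : ℤ) = -z := by omega
          rw [h', if_pos h1, neg_neg, if_pos h2]
      · left
        rw [← hout _ (Nat.mul_pos hw (by omega)) (by omega), tailCount_half hn hw, hwz]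
        rcases Int.natAbs_eq z with h | h
        · rw [← h, if_neg hz, if_neg hz']
          simp
        · have h' : (z.natAbs : ℤ) = -z := by omega
          rw [h', if_neg hz', neg_neg, if_neg hz]
          simp
    · rw [hin x h1 h2]
      omega

/-- In a core, the beads `k` and `k - (2 n - 2)`, which are the elements `0` and `-1` in the residue
class `k`, do not both occur. Otherwise they could be removed. -/
lemma no_annihilation_of_isCore (hn : 4 ≤ n) {D : Finset ℤ} (hD : IsReduced n D)
    (hc : Even D.card) (hY : IsCore n (beadWall n D 0)) {k : ℕ} (hk : k < n) :
    ¬ ((k : ℤ) ∈ D ∧ (k : ℤ) - (2 * n - 2) ∈ D) := by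
  rintro ⟨hy, hz⟩
  have hpair := fun u (hu : 1 ≤ u) => no_pair_of_isCore hn hD hc hY hu
  have b1 := bead_div_mod hn 0 hk
  have b2 := bead_div_mod hn (-1) hk
  rw [zero_mul, zero_add] at b1
  rw [show (-1 : ℤ) * (2 * n - 2) + (k : ℕ) = (k : ℤ) - (2 * n - 2) by ring] at b2
  have hk1 : k < n - 1 := by
    by_contra h
    refine hpair 1 le_rfl ?_
    rw [one_mul, show n - 1 = k by omega]
    refine ⟨hy, ?_⟩
    rwa [show -(k : ℤ) = k - (2 * n - 2) by omega]
  have hyz : (k : ℤ) - (2 * n - 2) ≠ k := by omega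
  have hdiff := fun x => tailCount_erase_erase (n := n) (κ := 0) hy hz hyz x
  have hsum := sum_erase_erase hy hz hyz fun a : ℤ => (a / (2 * n - 2)).natAbs
  simp only [b1.1, b2.1] at hsum
  have hout : ∀ x, 1 ≤ x → x ≤ 0 ∨ 2 * n - 2 - k < x → tailCount n D 0 x =
      tailCount n ((D.erase k).erase ((k : ℤ) - (2 * n - 2))) 0 x := by
    intro x h1 h2
    rw [hdiff, if_neg (by omega), if_neg (by omega), add_zero, add_zero]
  refine not_isCore_beadWall hn hD (D' := (D.erase k).erase ((k : ℤ) - (2 * n - 2))) (κ' := 0)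
    (fun a ha => hD a (Finset.mem_of_mem_erase (Finset.mem_of_mem_erase ha))) hc
    (charge_erase_erase hy hz (b1.2.trans b2.2.symm) ?_) ?_
    (le_or_beadShape_eq hn hpair (lo := 0) (hi := 2 * n - 2 - k)
      (fun x h1 h2 => ?_) hout (fun a ha => ?_) fun w hw hwz => ?_)
    (fun x h1 h2 => ?_) hout
    (fun x h1 h2 => tailCount_le_succ hn hD hpair (by omega)) hY
  · rw [b1.1, b2.1]
    rfl
  · rw [hsum]
    simp
    ring
  · rw [hdiff]
    split_ifs <;> omega
  · rw [Finset.mem_erase, Finset.mem_erase]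
    refine ⟨fun h => h.2.2, fun h => ⟨?_, ?_, h⟩⟩
    · rintro rfl
      omega
    · rintro rfl
      omega
  · have : 0 < w * (n - 1) := Nat.mul_pos hw (by omega)
    omega
  · rw [hdiff]
    split_ifs <;> omega

lemma chargeEquiv_symm_empty (z : ℤ) : chargeEquiv.symm (z, ⟨∅, rfl⟩) = vacuum z := rfl

theorem eq_groundWall_of_isCore (hn : 4 ≤ n) {Y : Set Block} (hY : IsCore n Y) :
    ∃ m : Fin n → ℤ, Y = groundWall m := by
  obtain ⟨D, κ, hD, hc, rfl⟩ := hY.1.exists_beads hn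
  obtain rfl := parts_eq_zero_of_isCore hn hD hc hY
  obtain ⟨E, rfl⟩ := hD.exists_beads_eq hn
  have hvac : ∀ k, ∃ z, E k = vacuum z := by
    intro k
    have hk := k.2
    have hN : (0 : ℤ) < 2 * n - 2 := by omega
    refine exists_eq_vacuum (fun d hd h1 => ?_) (fun d hd h1 => ?_) ?_
    · have h := mul_le_mul_of_nonneg_right h1 hN.le
      refine (mem_beads hn k _).1 (no_step_of_isCore hn hD hc hY ((mem_beads hn k d).2 hd)
        ?_ ?_ ?_ ?_)
      · have e : d * (2 * n - 2) = (d - 1) * (2 * n - 2) + (2 * n - 2) := by ring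
        omega
      · rw [(bead_div_mod hn _ hk).1, (bead_div_mod hn _ hk).1]
        omega
      · rw [(bead_div_mod hn _ hk).2, (bead_div_mod hn _ hk).2]
      · have e : d * (2 * n - 2) = (d - 1) * (2 * n - 2) + (2 * n - 2) := by ring
        rw [beadSign, beadSign, if_pos (by omega), if_pos (by omega)]
    · have h := mul_le_mul_of_nonneg_right h1 hN.le
      refine (mem_beads hn k _).1 (no_step_of_isCore hn hD hc hY ((mem_beads hn k d).2 hd)
        ?_ ?_ ?_ ?_)
      · have e : d * (2 * n - 2) = (d + 1) * (2 * n - 2) - (2 * n - 2) := by ring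
        omega
      · rw [(bead_div_mod hn _ hk).1, (bead_div_mod hn _ hk).1]
        omega
      · rw [(bead_div_mod hn _ hk).2, (bead_div_mod hn _ hk).2]
      · have e : d * (2 * n - 2) = (d + 1) * (2 * n - 2) - (2 * n - 2) := by ring
        rw [beadSign, beadSign, if_neg (by omega), if_neg (by omega)]
    · rintro ⟨h0, h1⟩
      refine no_annihilation_of_isCore hn hD hc hY hk ⟨?_, ?_⟩
      · have := (mem_beads hn k 0).2 h0
        rwa [zero_mul, zero_add] at this
      · have := (mem_beads hn k (-1)).2 h1
        rwa [show (-1 : ℤ) * (2 * n - 2) + (k : ℕ) = (k : ℤ) - (2 * n - 2) by ring] at this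
  rw [even_card_beads hn] at hc
  obtain ⟨m, hm⟩ := exists_chargeOf_eq hn hc
  refine ⟨m, ?_⟩
  rw [groundWall, wallOf]
  congr 2
  funext k
  obtain ⟨z, hz⟩ := hvac k
  rw [chargedBeads, congrFun hm k, chargeEquiv_symm_empty, hz, charge_vacuum]

end

/-! ### The generating series of Young walls -/

section

variable {n : ℕ}

/-- The Young walls are pairs of a ground wall and an excitation. -/
def wallEquiv (hn : 4 ≤ n) : (Fin n → ℤ) × Excitation n ≃ YoungWall n :=
  Equiv.ofBijective (fun p => ⟨wallOf p.1 p.2, (wallOf_bijective hn).1 p.1 p.2⟩) <| by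
    refine ⟨fun p p' h => ?_, fun Y => ?_⟩
    · have := (wallOf_bijective hn).2.1 _ _ _ _ (congrArg Subtype.val h)
      exact Prod.ext this.1 this.2
    · obtain ⟨m, x, h⟩ := (wallOf_bijective hn).2.2 Y.1 Y.2
      exact ⟨(m, x), Subtype.ext h.symm⟩

theorem generating_series (hn : 4 ≤ n) :
    ∃ (e : (Fin n → ℤ) → (Fin (n + 1) →₀ ℕ)) (Z Θ P : MvPowerSeries (Fin (n + 1)) ℤ),
      (∀ m i, (e m i : ℚ) = thetaExponent n m i) ∧
      HasSum (fun Y : YoungWall n => MvPowerSeries.monomial (weight n Y.1) (1 : ℤ)) Z ∧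
      HasSum (fun m : Fin n → ℤ => MvPowerSeries.monomial (e m) (1 : ℤ)) Θ ∧
      HasProd (fun k : ℕ => (1 - qSeries n ^ (k + 1)) ^ (n + 1)) P ∧
      IsUnit P ∧ Z * P = Θ := by
  have hE := (isPartitionLike_energy).finite
  have hκ := (isPartitionLike_partsSize).finite
  obtain ⟨hpi, hpi'⟩ := tsum_pow_pi (n := n) hE n
  obtain ⟨hx, hx'⟩ := tsum_pow_mul (n := n) hpi hκ
  have h1 := isPartitionLike_energy.tsum_mul_tprod (n := n)
  have h2 := isPartitionLike_partsSize.tsum_mul_tprod (n := n)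
  -- There are `n` factors for the sets of charge zero and one for the partition `κ`.
  have hG : (∑' x : Excitation n, qSeries n ^ excitationSize x) *
      (∏' k : ℕ, (1 - qSeries n ^ (k + 1))) ^ (n + 1) = 1 := by
    have : ∑' x : Excitation n, qSeries n ^ excitationSize x =
      (∑' F : ChargeZero, qSeries n ^ energy F.1) ^ n *
        ∑' κ, qSeries n ^ partsSize κ := by rw [← hpi', ← hx']; rfl
    rw [this, pow_succ, mul_mul_mul_comm, ← mul_pow, h1, h2, one_pow, one_mul]
  have hΘ : Summable fun m : Fin n → ℤ =>
      MvPowerSeries.monomial (weight n (groundWall m)) (1 : ℤ) := by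
    refine summable_monomial fun d => Set.Subsingleton.finite fun m hm m' hm' => ?_
    exact (eq_of_weight_eq hn (show weight n (groundWall m) = weight n (groundWall m') from
      Eq.trans hm hm'.symm)).1
  have hmul : ∀ p : (Fin n → ℤ) × Excitation n,
      MvPowerSeries.monomial (weight n (groundWall p.1)) (1 : ℤ) *
        qSeries n ^ excitationSize p.2 =
      MvPowerSeries.monomial (weight n (wallOf p.1 p.2)) (1 : ℤ) := by
    intro p
    rw [qSeries_pow, MvPowerSeries.monomial_mul_monomial, one_mul, weight_wallOf_eq hn]
  have hsum : Summable fun p : (Fin n → ℤ) × Excitation n =>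
      MvPowerSeries.monomial (weight n (groundWall p.1)) (1 : ℤ) *
        qSeries n ^ excitationSize p.2 := by
    simp only [hmul]
    refine summable_monomial fun d => ?_
    rcases Set.eq_empty_or_nonempty
      {p : (Fin n → ℤ) × Excitation n | weight n (wallOf p.1 p.2) = d} with h | ⟨p, hp⟩
    · rw [h]
      exact Set.finite_empty
    · refine Set.Finite.subset ((Set.finite_singleton p.1).prod (hx (excitationSize p.2)))
        fun p' hp' => ?_
      have := eq_of_weight_eq hn (Eq.trans hp' (Eq.symm hp))
      exact ⟨this.1, this.2⟩
  refine ⟨fun m => weight n (groundWall m),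
    (∑' m : Fin n → ℤ, MvPowerSeries.monomial (weight n (groundWall m)) (1 : ℤ)) *
      ∑' x : Excitation n, qSeries n ^ excitationSize x, _, _, weight_groundWall hn, ?_, hΘ.hasSum,
    (multipliable_one_sub_qSeries n).hasProd.pow (n + 1),
    IsUnit.of_mul_eq_one _ ((mul_comm _ _).trans hG), ?_⟩
  · rw [← (wallEquiv hn).hasSum_iff]
    exact (hΘ.hasSum.mul (summable_qSeries_pow hx).hasSum hsum).congr_fun fun p => (hmul p).symm
  · rw [mul_assoc, hG, mul_one]

/-! ### The change of coordinates -/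

lemma two_mul_aPart (x : ℤ) : 2 * aPart x = x + bPart x := by
  rw [aPart, bPart]
  omega

lemma bPart_eq (x : ℤ) : bPart x = 0 ∨ bPart x = 1 := by
  rw [bPart]
  omega

lemma cPart_mul_self (x : ℤ) : cPart x * cPart x = 1 := by
  rw [cPart]
  rcases bPart_eq x with h | h <;> rw [h] <;> rfl

lemma zSum_succ (z : Fin n → ℤ) (k : ℕ) : zSum z 1 (k + 1) = zSum z 1 k + coord z (k + 1) := by
  rw [zSum, zSum, Finset.sum_Icc_succ_top (by omega)]

lemma zSum_add (z : Fin n → ℤ) {i r : ℕ} (hi : 1 ≤ i) (hir : i ≤ r + 1) :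
    zSum z 1 (i - 1) + zSum z i r = zSum z 1 r := by
  rw [zSum, zSum, zSum, ← Finset.sum_union]
  · refine Finset.sum_congr ?_ fun _ _ => rfl
    ext j
    simp only [Finset.mem_union, Finset.mem_Icc]
    omega
  · rw [Finset.disjoint_left]
    intro j h1 h2
    rw [Finset.mem_Icc] at h1 h2
    omega

/-- The formula for `m_i` without case distinction on the parity of `z_1 + … + z_{i-1}`. -/
lemma coord_latticeChange (z : Fin n → ℤ) {i : ℕ} (hi : 1 ≤ i)
    (hi' : i ≤ n - 2) :
    coord (latticeChange n z) i = -zSum z 1 (i - 1) - bPart (zSum z 1 (n - 2)) -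
      cPart (zSum z 1 (n - 2)) * (coord z (n - 1) + coord z n) := by
  rw [coord, dif_pos ⟨hi, by omega⟩]
  simp only [latticeChange, show i - 1 + 1 = i by omega, hi', if_true]
  have h1 := two_mul_aPart (zSum z 1 (i - 1))
  rw [← zSum_add z hi (show i ≤ n - 2 + 1 by omega)]
  congr 1
  rw [cPart, neg_mul, h1]
  simp only [bPart]
  rcases Int.emod_two_eq (zSum z 1 (i - 1)) with h | h <;>
    rcases Int.emod_two_eq (zSum z i (n - 2)) with h' | h' <;> rw [h, h'] <;> omega

lemma coord_latticeChange_top (z : Fin n → ℤ) {i : ℕ} (hi : n - 2 < i) (hi' : i ≤ n) :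
    coord (latticeChange n z) i =
      -aPart (zSum z 1 (n - 2)) - cPart (zSum z 1 (n - 2)) * coord z i := by
  rw [coord, dif_pos ⟨by omega, hi'⟩]
  simp only [latticeChange, show i - 1 + 1 = i by omega, show ¬ i ≤ n - 2 by omega, if_false]

lemma chainCoord_latticeChange (hn : 4 ≤ n) (z : Fin n → ℤ) {i : ℕ} (hi : 1 ≤ i)
    (hi' : i ≤ n - 1) :
    chainCoord (latticeChange n z) i = -zSum z 1 (i - 1) - bPart (zSum z 1 (n - 2)) -
      cPart (zSum z 1 (n - 2)) * (coord z (n - 1) + coord z n) := by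
  rw [chainCoord]
  split_ifs with h
  · rw [coord_latticeChange_top z (by omega) (by omega),
      coord_latticeChange_top z (by omega) le_rfl, show i - 1 = n - 2 by omega]
    linarith [two_mul_aPart (zSum z 1 (n - 2))]
  · rw [coord_latticeChange z hi (by omega)]

lemma chargeOf_latticeChange (hn : 4 ≤ n) (z : Fin n → ℤ) :
    chargeOf (latticeChange n z) 0 = bPart (zSum z 1 (n - 2)) +
      cPart (zSum z 1 (n - 2)) * (coord z (n - 1) + coord z n) ∧
    (∀ k, 1 ≤ k → k ≤ n - 2 → chargeOf (latticeChange n z) k = coord z k) ∧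
    chargeOf (latticeChange n z) (n - 1) =
      -cPart (zSum z 1 (n - 2)) * (coord z (n - 1) - coord z n) := by
  refine ⟨?_, fun k hk hk' => ?_, ?_⟩
  · rw [chargeOf, if_neg (by omega), chainCoord, if_neg (by omega), coord_zero, zero_add,
      chainCoord_latticeChange hn z le_rfl (by omega), Nat.sub_self]
    have : zSum z 1 0 = 0 := by simp [zSum]
    rw [this]
    ring
  · rw [chargeOf, if_neg (by omega), chainCoord_latticeChange hn z hk (by omega),
      chainCoord_latticeChange hn z (by omega) (by omega), Nat.add_sub_cancel]
    obtain ⟨j, rfl⟩ : ∃ j, k = j + 1 := ⟨k - 1, by omega⟩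
    rw [zSum_succ, Nat.add_sub_cancel]
    ring
  · rw [chargeOf, if_pos (by omega), coord_latticeChange_top z (by omega) (by omega),
      coord_latticeChange_top z (by omega) le_rfl]
    ring

lemma eq_of_coord_eq {z z' : Fin n → ℤ} (h : ∀ k, 1 ≤ k → k ≤ n → coord z k = coord z' k) :
    z = z' := by
  funext i
  rw [← coord_succ z, ← coord_succ z', h _ (by omega) (by omega)]

theorem latticeChange_bijective (hn : 4 ≤ n) : Function.Bijective (latticeChange n) := by
  have hinj : ∀ c x y : ℤ, c * c = 1 → c * x = c * y → x = y := by
    intro c x y hc h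
    rw [← one_mul x, ← one_mul y, ← hc, mul_assoc, h, mul_assoc]
  constructor
  · -- The charges give `z_1, …, z_{n-2}`, and the last two coordinates follow as `c ^ 2 = 1`.
    intro z z' h
    obtain ⟨-, h1, -⟩ := chargeOf_latticeChange hn z
    obtain ⟨-, h1', -⟩ := chargeOf_latticeChange hn z'
    have h2 : ∀ k, 1 ≤ k → k ≤ n - 2 → coord z k = coord z' k := fun k hk hk' => by
      rw [← h1 k hk hk', ← h1' k hk hk', h]
    have hT : zSum z 1 (n - 2) = zSum z' 1 (n - 2) := by
      refine Finset.sum_congr rfl fun k hk => ?_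
      rw [Finset.mem_Icc] at hk
      exact h2 k hk.1 hk.2
    refine eq_of_coord_eq fun k hk hk' => ?_
    by_cases hk2 : k ≤ n - 2
    · exact h2 k hk hk2
    · have e1 := coord_latticeChange_top z (show n - 2 < k by omega) hk'
      have e2 := coord_latticeChange_top z' (show n - 2 < k by omega) hk'
      rw [h, hT, e2] at e1
      exact hinj _ _ _ (cPart_mul_self (zSum z' 1 (n - 2))) (by linarith)
  · intro m
    -- For `m` in the image of `z`, this is `z_1 + … + z_{n-2}`.
    let T := chainCoord m 1 - chainCoord m (n - 1)
    let z : Fin n → ℤ := fun i => if (i : ℕ) + 1 ≤ n - 2 then chargeOf m (i + 1) else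
      -cPart T * (m i + aPart T)
    have hz : ∀ k, 1 ≤ k → k ≤ n - 2 → coord z k = chargeOf m k := by
      intro k hk hk'
      rw [coord, dif_pos ⟨hk, by omega⟩]
      simp only [z, show k - 1 + 1 = k by omega, hk', if_true]
    have hz' : ∀ k, n - 2 < k → k ≤ n → coord z k = -cPart T * (coord m k + aPart T) := by
      intro k hk hk'
      rw [coord, dif_pos ⟨by omega, hk'⟩, coord, dif_pos ⟨by omega, hk'⟩]
      simp only [z, show ¬ k - 1 + 1 ≤ n - 2 by omega, if_false]
    have hsum : ∀ j, j ≤ n - 2 → zSum z 1 j = chainCoord m 1 - chainCoord m (j + 1) := by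
      intro j
      induction j with
      | zero => simp [zSum]
      | succ j ih =>
        intro hj
        rw [zSum_succ, ih (by omega), hz _ (by omega) hj, chargeOf, if_neg (by omega)]
        ring
    have hT : zSum z 1 (n - 2) = T := by
      rw [hsum _ le_rfl, show n - 2 + 1 = n - 1 by omega]
    have hc := cPart_mul_self T
    refine ⟨z, eq_of_coord_eq fun k hk hk' => ?_⟩
    by_cases hk2 : k ≤ n - 2
    · rw [coord_latticeChange z hk hk2, hT, hsum _ (by omega), hz' _ (by omega) (by omega),
        hz' _ (by omega) le_rfl, show k - 1 + 1 = k by omega]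
      have h1 : chainCoord m (n - 1) = coord m (n - 1) + coord m n := by
        rw [chainCoord, if_pos (by omega)]
      have h2 : chainCoord m k = coord m k := by rw [chainCoord, if_neg (by omega)]
      have h3 := two_mul_aPart T
      have h4 : T = chainCoord m 1 - chainCoord m (n - 1) := rfl
      have h5 : cPart T * (-cPart T * (coord m (n - 1) + aPart T) +
          -cPart T * (coord m n + aPart T)) =
          -(cPart T * cPart T) * (coord m (n - 1) + coord m n + 2 * aPart T) := by ring
      rw [h5, hc, h3, h2]
      linarith
    · rw [coord_latticeChange_top z (by omega) hk', hT, hz' k (by omega) hk', ← mul_assoc, mul_neg,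
        hc]
      ring

theorem sum_latticeChange (hn : 4 ≤ n) (z : Fin n → ℤ) (a b c : ℤ) (hb : b = 0 ∨ b = 1)
    (hc : c = 2 * b - 1) (h : ∑ i ∈ Finset.Icc 1 (n - 2), coord z i = 2 * a - b) :
    ∑ i, latticeChange n z i =
      -(∑ i ∈ Finset.Icc 1 (n - 2), ((n : ℤ) - 1 - i) * coord z i)
        - ((n : ℤ) - 1) * c * (coord z (n - 1) + coord z n) - ((n : ℤ) - 1) * b := by
  have hb' : bPart (zSum z 1 (n - 2)) = b := by
    rw [zSum, h, bPart]
    omega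
  have hc' : cPart (zSum z 1 (n - 2)) = c := by rw [cPart, hb', hc]
  have h1 : ∑ i, latticeChange n z i = ∑ i ∈ Finset.range (n - 2), coord (latticeChange n z) (i + 1)
      + chainCoord (latticeChange n z) (n - 1) := by
    obtain ⟨r, rfl⟩ : ∃ r, n = r + 2 := ⟨n - 2, by omega⟩
    rw [Finset.sum_congr rfl fun i _ => (coord_succ (latticeChange (r + 2) z) i).symm,
      Fin.sum_univ_eq_sum_range fun i => coord (latticeChange (r + 2) z) (i + 1),
      Finset.sum_range_succ, Finset.sum_range_succ, chainCoord, if_pos (by omega)]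
    simp only [show r + 2 - 2 = r by omega, show r + 2 - 1 = r + 1 by omega]
    ring
  have h2 : ∀ j ≤ n - 2, ∑ i ∈ Finset.range j, coord (latticeChange n z) (i + 1) +
      chainCoord (latticeChange n z) (j + 1) =
      -(∑ i ∈ Finset.Icc 1 j, ((j : ℤ) + 1 - i) * coord z i) -
        ((j : ℤ) + 1) * (b + c * (coord z (n - 1) + coord z n)) := by
    intro j
    induction j with
    | zero =>
      intro _
      rw [chainCoord_latticeChange hn z le_rfl (by omega), hb', hc']
      simp [zSum]
      ring
    | succ j ih =>
      intro hj
      have h3 : chainCoord (latticeChange n z) (j + 1) = coord (latticeChange n z) (j + 1) := by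
        rw [chainCoord, if_neg (by omega)]
      rw [Finset.sum_range_succ, ← h3, ih (by omega),
        chainCoord_latticeChange hn z (by omega) (by omega), hb', hc', Nat.add_sub_cancel,
        Finset.sum_Icc_succ_top (by omega), zSum, Finset.sum_Icc_succ_top (by omega)]
      have h4 : ∑ i ∈ Finset.Icc 1 j, (((j + 1 : ℕ) : ℤ) + 1 - i) * coord z i =
          ∑ i ∈ Finset.Icc 1 j, ((j : ℤ) + 1 - i) * coord z i +
            ∑ i ∈ Finset.Icc 1 j, coord z i := by
        rw [← Finset.sum_add_distrib]
        refine Finset.sum_congr rfl fun i _ => ?_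
        push_cast
        ring
      rw [h4]
      push_cast
      ring
  rw [h1, show n - 1 = n - 2 + 1 by omega, h2 _ le_rfl, show n - 2 + 1 = n - 1 by omega]
  push_cast [show 2 ≤ n by omega]
  have h5 : ∀ i : ℕ, (n : ℤ) - 2 + 1 - i = n - 1 - i := fun i => by ring
  simp only [h5]
  ring

end

/-! ### Colours and rulers for walls without pairs of beads -/

section

variable {n : ℕ} {D : Finset ℤ} {S : ℕ → Prop}

/-- In a wall without pairs of beads, the columns of positive height correspond to the beads other
than `0`, with heights equal to absolute values. -/
lemma ncard_colHeight (D : Finset ℤ) (hS : ¬ S 0) [DecidablePred S] :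
    {c | S (colHeight (tailCount n D 0) c)}.ncard = (D.filter fun y => S y.natAbs).card := by
  have hanti : Antitone (tailCount n D 0) := tailCount_antitone
  have hzero := exists_tailCount_eq_zero (n := n) D 0
  have hpos : ∀ c, S (colHeight (tailCount n D 0) c) → c < tailCount n D 0 1 := by
    intro c hc
    rw [lt_iff_le_colHeight hanti hzero le_rfl]
    by_contra h
    exact hS (by rwa [show colHeight (tailCount n D 0) c = 0 by omega] at hc)
  have hfin : ∀ X, {c | S (colHeight (tailCount n D 0) c) ∧
      colHeight (tailCount n D 0) c < X}.Finite := fun X =>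
    (Set.finite_lt_nat (tailCount n D 0 1)).subset fun c hc => hpos c hc.1
  have hind : ∀ X, {c | S (colHeight (tailCount n D 0) c) ∧
      colHeight (tailCount n D 0) c < X}.ncard =
      (D.filter fun y => S y.natAbs ∧ y.natAbs < X).card := by
    intro X
    induction X with
    | zero => simp
    | succ X ih =>
      by_cases hX : S X
      · have hX1 : 1 ≤ X := Nat.pos_of_ne_zero fun h => hS (h ▸ hX)
        have h1 : {c | S (colHeight (tailCount n D 0) c) ∧ colHeight (tailCount n D 0) c < X + 1} =
            {c | S (colHeight (tailCount n D 0) c) ∧ colHeight (tailCount n D 0) c < X} ∪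
              (Finset.Ico (tailCount n D 0 (X + 1)) (tailCount n D 0 X) : Finset ℕ) := by
          ext c
          simp only [Set.mem_union, Set.mem_ofPred_eq, Finset.coe_Ico, Set.mem_Ico]
          rw [← colHeight_eq_iff hanti hzero hX1]
          constructor
          · rintro ⟨h1, h2⟩
            by_cases h : colHeight (tailCount n D 0) c = X
            · exact Or.inr h
            · exact Or.inl ⟨h1, by omega⟩
          · rintro (⟨h1, h2⟩ | h)
            · exact ⟨h1, by omega⟩
            · exact ⟨h ▸ hX, by omega⟩
        have h2 : (D.filter fun y => S y.natAbs ∧ y.natAbs < X + 1) =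
            (D.filter fun y => S y.natAbs ∧ y.natAbs < X) ∪ D.filter fun y => y.natAbs = X := by
          ext y
          simp only [Finset.mem_filter, Finset.mem_union, ← and_or_left]
          refine and_congr_right fun _ => ?_
          constructor
          · rintro ⟨h1, h2⟩
            by_cases h : y.natAbs = X
            · exact Or.inr h
            · exact Or.inl ⟨h1, by omega⟩
          · rintro (⟨h1, h2⟩ | h)
            · exact ⟨h1, by omega⟩
            · exact ⟨h ▸ hX, by omega⟩
        have h3 : (D.filter fun y => X ≤ y.natAbs).card =
            (D.filter fun y => X + 1 ≤ y.natAbs).card + (D.filter fun y => y.natAbs = X).card := by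
          rw [← Finset.card_union_of_disjoint]
          · congr 1
            ext y
            simp only [Finset.mem_filter, Finset.mem_union, ← and_or_left]
            refine and_congr_right fun _ => ?_
            omega
          · rw [Finset.disjoint_filter]
            intro y _ h1 h2
            omega
        rw [h1, h2, Set.ncard_union_eq ?_ (hfin X) (Finset.finite_toSet _), ih,
          Set.ncard_coe_finset, Nat.card_Ico, Finset.card_union_of_disjoint]
        · simp only [tailCount, Finsupp.sum_zero_index]
          omega
        · rw [Finset.disjoint_filter]
          intro y _ h1 h2
          omega
        · rw [Set.disjoint_left]
          intro c h1 h2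
          rw [Finset.coe_Ico, Set.mem_Ico, ← colHeight_eq_iff hanti hzero hX1] at h2
          have := h1.2
          omega
      · have h1 : {c | S (colHeight (tailCount n D 0) c) ∧
            colHeight (tailCount n D 0) c < X + 1} =
            {c | S (colHeight (tailCount n D 0) c) ∧ colHeight (tailCount n D 0) c < X} := by
          ext c
          refine and_congr_right fun h => ?_
          have : colHeight (tailCount n D 0) c ≠ X := fun he => hX (he ▸ h)
          omega
        rw [h1, ih]
        congr 1
        refine Finset.filter_congr fun y _ => and_congr_right fun h => ?_
        have : y.natAbs ≠ X := fun he => hX (he ▸ h)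
        omega
  obtain ⟨X, hX⟩ := hzero
  have h1 : ∀ c, colHeight (tailCount n D 0) c < X + 1 := by
    intro c
    by_contra h
    have := (lt_iff_le_colHeight hanti ⟨X, hX⟩ (c := c) (x := X + 1) (by omega)).2 (by omega)
    have := hanti (show X ≤ X + 1 by omega)
    omega
  have h2 : ∀ y ∈ D, y.natAbs < X + 1 := fun y hy => by
    have := natAbs_lt_of_tailCount hX hy
    omega
  have := hind (X + 1)
  simp only [h1, and_true] at this
  rw [this]
  congr 1
  exact Finset.filter_congr fun y hy => ⟨fun h => h.1, fun h => ⟨h, h2 y hy⟩⟩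

lemma rulerBeads_beadWall (hn : 4 ≤ n) (hD : IsReduced n D) {k : ℕ} (hk : 1 ≤ k)
    (hk' : k < 2 * n - 2) (hkn : k ≠ n - 1) :
    rulerBeads n (beadWall n D 0) k =
      (D.filter fun y => y.natAbs % (2 * n - 2) = k).card := by
  have hP := isProfile_beads hn hD 0
  rw [rulerBeads, ← ncard_colHeight (n := n) (S := fun s => s % (2 * n - 2) = k) D
    (by simp; omega)]
  congr 1
  ext c
  rw [Set.mem_ofPred_eq, Set.mem_ofPred_eq, beadWall, isFullColumn_wall hn hP.anti hP.zero,
    height_wall hn hP.anti hP.lower]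
  refine ⟨fun h => h.2, fun h => ⟨fun hd => ?_, h⟩⟩
  have h2 : (n - 1) ∣ colHeight (tailCount n D 0) c % (2 * n - 2) :=
    (Nat.dvd_mod_iff ⟨2, by omega⟩).2 hd
  rw [h] at h2
  obtain ⟨j, hj⟩ := h2
  have h3 : j < 2 := by
    by_contra hj2
    have := Nat.mul_le_mul_left (n - 1) (show 2 ≤ j by omega)
    omega
  interval_cases j <;> omega

lemma shorterFull_beadWall (hn : 4 ≤ n) (hD : IsReduced n D) (c : ℕ) :
    shorterFull n (beadWall n D 0) c = (D.filter fun y => ¬ (n - 1) ∣ y.natAbs ∧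
      y.natAbs < colHeight (tailCount n D 0) c).card := by
  have hP := isProfile_beads hn hD 0
  rw [shorterFull, ← ncard_colHeight (n := n) (S := fun s => ¬ (n - 1) ∣ s ∧
    s < colHeight (tailCount n D 0) c) D (by simp)]
  congr 1
  ext c'
  rw [Set.mem_ofPred_eq, Set.mem_ofPred_eq, beadWall, isFullColumn_wall hn hP.anti hP.zero,
    height_wall hn hP.anti hP.lower, height_wall hn hP.anti hP.lower]

lemma ends_beadWall (hn : 4 ≤ n) (hD : IsReduced n D) {c u : ℕ} (hu : 1 ≤ u)
    (hc : colHeight (tailCount n D 0) c = u * (n - 1)) :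
    (EndsInUpper (beadWall n D 0) c ↔ beadShape n D 0 u = true) ∧
    (EndsInLower (beadWall n D 0) c ↔ beadShape n D 0 u = false) := by
  have hP := isProfile_beads hn hD 0
  have hpos : 0 < u * (n - 1) := Nat.mul_pos hu (by omega)
  have hmem : ∀ j, 1 ≤ j → ∀ b, (⟨c, j * (n - 2), halfPiece b⟩ : Block) ∈ beadWall n D 0 ↔
      j < u ∨ (b = beadShape n D 0 j ∧ j ≤ u) := by
    intro j hj b
    have hj0 : 0 < j * (n - 1) := Nat.mul_pos hj (by omega)
    rw [beadWall, mem_wall_half hn, lt_iff_le_colHeight hP.anti hP.zero (by omega),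
      lt_iff_le_colHeight hP.anti hP.zero hj0, hc]
    have h1 : j * (n - 1) + 1 ≤ u * (n - 1) ↔ j < u := by
      rw [Nat.succ_le_iff]
      exact Nat.mul_lt_mul_right (by omega)
    have h2 : j * (n - 1) ≤ u * (n - 1) ↔ j ≤ u := Nat.mul_le_mul_right_iff (by omega)
    rw [h1, h2]
    simp [show j ≠ 0 by omega]
  have hkey : ∀ b, (∃ r, 0 < r ∧ Block.mk c r (halfPiece b) ∈ beadWall n D 0 ∧
      Block.mk c r (halfPiece (!b)) ∉ beadWall n D 0) ↔ beadShape n D 0 u = b := by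
    intro b
    constructor
    · rintro ⟨r, hr, h1, h2⟩
      rcases row_cases hn r with ⟨j, rfl⟩ | ⟨j, t, ht, ht', rfl⟩
      · have hj : 1 ≤ j := Nat.pos_of_mul_pos_right hr
        rw [hmem j hj] at h1 h2
        rcases h1 with h1 | ⟨h1, h3⟩
        · exact absurd (Or.inl h1) h2
        · have : j = u := by
            by_contra hne
            exact h2 (Or.inl (by omega))
          rw [← this, h1]
      · rw [beadWall, mem_wall_full hn _ _ _ ht ht'] at h1
        exact absurd h1.1 (halfPiece_ne_full _)
    · rintro rfl
      refine ⟨u * (n - 2), Nat.mul_pos hu (by omega), ?_, ?_⟩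
      · rw [hmem u hu]
        exact Or.inr ⟨rfl, le_rfl⟩
      · rw [hmem u hu]
        simp
  exact ⟨hkey true, hkey false⟩

/-- Black is the colour of the beads at `u (n - 1)`: the shape of the half-block at the top is upper
left if and only if the number of shorter full columns is even. -/
def IsBlackSite (n : ℕ) (D : Finset ℤ) (u : ℕ) : Prop :=
  beadShape n D 0 u = true ↔
    Even (D.filter fun y => ¬ (n - 1) ∣ y.natAbs ∧ y.natAbs < u * (n - 1)).card

lemma ncard_beads_beadWall (hn : 4 ≤ n) {u : ℕ} (hu : 1 ≤ u) (Q : Prop) [Decidable Q] :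
    {c | Q ∧ colHeight (tailCount n D 0) c = u * (n - 1)}.ncard =
      if Q then (if ((u * (n - 1) : ℕ) : ℤ) ∈ D then 1 else 0) +
        if -((u * (n - 1) : ℕ) : ℤ) ∈ D then 1 else 0 else 0 := by
  have hpos : 0 < u * (n - 1) := Nat.mul_pos hu (by omega)
  by_cases hQ : Q
  · simp only [hQ, true_and, if_true]
    rw [ncard_colHeight (n := n) (S := fun s => s = u * (n - 1)) D (by omega),
      card_filter_natAbs_eq D hpos]
  · simp [hQ]

open Classical in
lemma blackBeads_beadWall (hn : 4 ≤ n) (hD : IsReduced n D) {u : ℕ} (hu : 1 ≤ u) :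
    blackBeads n (beadWall n D 0) ((n - 1) * u) = if IsBlackSite n D u then
      (if ((u * (n - 1) : ℕ) : ℤ) ∈ D then 1 else 0) +
        if -((u * (n - 1) : ℕ) : ℤ) ∈ D then 1 else 0 else 0 := by
  have hP := isProfile_beads hn hD 0
  rw [← ncard_beads_beadWall hn hu, blackBeads]
  congr 1
  ext c
  rw [Set.mem_ofPred_eq, Set.mem_ofPred_eq, mul_comm, beadWall,
    height_wall hn hP.anti hP.lower, ← beadWall]
  refine and_congr_left fun hc => ?_
  obtain ⟨h1, h2⟩ := ends_beadWall hn hD hu hc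
  rw [IsBlackColumn, h1, h2, shorterFull_beadWall hn hD, hc, IsBlackSite, ← Nat.not_even_iff_odd]
  cases beadShape n D 0 u <;> simp

open Classical in
lemma whiteBeads_beadWall (hn : 4 ≤ n) (hD : IsReduced n D) {u : ℕ} (hu : 1 ≤ u) :
    whiteBeads n (beadWall n D 0) ((n - 1) * u) = if ¬ IsBlackSite n D u then
      (if ((u * (n - 1) : ℕ) : ℤ) ∈ D then 1 else 0) +
        if -((u * (n - 1) : ℕ) : ℤ) ∈ D then 1 else 0 else 0 := by
  have hP := isProfile_beads hn hD 0
  rw [← ncard_beads_beadWall hn hu, whiteBeads]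
  congr 1
  ext c
  rw [Set.mem_ofPred_eq, Set.mem_ofPred_eq, mul_comm, beadWall,
    height_wall hn hP.anti hP.lower, ← beadWall]
  refine and_congr_left fun hc => ?_
  obtain ⟨h1, h2⟩ := ends_beadWall hn hD hu hc
  rw [IsWhiteColumn, h1, h2, shorterFull_beadWall hn hD, hc, IsBlackSite, ← Nat.not_even_iff_odd]
  cases beadShape n D 0 u <;> simp

/-- This relates the number of shorter full columns, which enters into the colour of a bead at `t`,
to the number of all taller columns, which enters into its shape. -/
lemma card_full_lt (D : Finset ℤ) {t : ℕ} (ht : (n - 1) ∣ t) :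
    (D.filter fun y => ¬ (n - 1) ∣ y.natAbs ∧ y.natAbs < t).card + tailCount n D 0 (t + 1) =
      (D.filter fun y => ¬ (n - 1) ∣ y.natAbs).card +
        (D.filter fun y => (n - 1) ∣ y.natAbs ∧ t < y.natAbs).card := by
  simp only [tailCount, Finsupp.sum_zero_index, mul_zero, add_zero, Finset.card_filter,
    ← Finset.sum_add_distrib]
  refine Finset.sum_congr rfl fun y _ => ?_
  by_cases h : (n - 1) ∣ y.natAbs
  · simp [h]
  · have : y.natAbs ≠ t := fun he => h (he ▸ ht)
    simp only [h, not_false_eq_true, true_and, if_true, false_and, if_false]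
    split_ifs <;> omega

end

/-! ### Pyramids -/

section

variable {n : ℕ}

/-- The number of positive even multiples of `n - 1` that carry a coloured bead, if the last two
coordinates are `x` and `y`. -/
def evenSites (x y : ℤ) : ℕ := if 0 ≤ x + y then (x + y).toNat else (-(x + y) - 1).toNat

/-- There is a coloured bead at `u (n - 1)`: the occupied even multiples are the first
`evenSites x y` ones, and the occupied odd multiples are the first `|x - y|` ones. -/
def SiteOccupied (x y : ℤ) (u : ℕ) : Prop :=
  (u % 2 = 0 → u / 2 ≤ evenSites x y) ∧ (u % 2 = 1 → u / 2 < (x - y).natAbs)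

/-- The bead at `u (n - 1)` is black: the colour is determined by the signs of `x + y` and `x - y`
and by the parity of the number of coloured beads at higher positions. -/
def SiteBlack (x y : ℤ) (u : ℕ) : Prop :=
  ((u % 2 = 0 ∧ x + y < 0) ∨ (u % 2 = 1 ∧ 0 < x - y)) ↔
    (evenSites x y - u / 2 + ((x - y).natAbs - (u + 1) / 2)) % 2 = 0

/-- The sums `(p - i) + (p' - i)` of the rows of two pyramids decrease by two from `p + p'` to
`|p - p'|`, and then by one. -/
lemma exists_pyramid_iff (x y : ℤ) {u : ℕ} (hu : 1 ≤ u) :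
    (∃ i, (pyramid x - i) + (pyramid y - i) = u) ↔ SiteOccupied x y u := by
  constructor
  · rintro ⟨i, hi⟩
    simp only [SiteOccupied, evenSites, pyramid] at hi ⊢
    split_ifs at hi ⊢ <;> omega
  · intro h
    by_cases h1 : pyramid x ≤ pyramid y
    · by_cases h2 : u ≤ pyramid y - pyramid x
      · exact ⟨pyramid y - u, by omega⟩
      · refine ⟨(pyramid x + pyramid y - u) / 2, ?_⟩
        simp only [SiteOccupied, evenSites, pyramid] at h h1 h2 ⊢
        split_ifs at h h1 h2 ⊢ <;> omega
    · by_cases h2 : u ≤ pyramid x - pyramid y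
      · exact ⟨pyramid x - u, by omega⟩
      · refine ⟨(pyramid x + pyramid y - u) / 2, ?_⟩
        simp only [SiteOccupied, evenSites, pyramid] at h h1 h2 ⊢
        split_ifs at h h1 h2 ⊢ <;> omega

lemma pyramid_eq (x : ℤ) :
    (0 ≤ x ∧ (pyramid x : ℤ) = 2 * x) ∨ (x < 0 ∧ (pyramid x : ℤ) = -2 * x - 1) := by
  rw [pyramid]
  split_ifs <;> omega
lemma evenSites_eq (x y : ℤ) : (0 ≤ x + y ∧ (evenSites x y : ℤ) = x + y) ∨
    (x + y < 0 ∧ (evenSites x y : ℤ) = -(x + y) - 1) := by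
  rw [evenSites]
  split_ifs <;> omega

set_option maxHeartbeats 1000000 in
/-- The colour that two pyramids give to the bead at `u (n - 1)` is that of `SiteBlack`. -/
lemma pyramid_odd_iff (x y : ℤ) {u i : ℕ} (hu : 1 ≤ u)
    (hi : (pyramid x - i) + (pyramid y - i) = u) :
    (pyramid y - i) % 2 = 1 ↔ SiteBlack x y u := by
  have hx := pyramid_eq x
  have hy := pyramid_eq y
  have hA := evenSites_eq x y
  have hB : (0 ≤ x - y ∧ ((x - y).natAbs : ℤ) = x - y) ∨
    (x - y < 0 ∧ ((x - y).natAbs : ℤ) = -(x - y)) := by omega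
  rw [SiteBlack]
  generalize (x - y).natAbs = B at hB ⊢
  generalize evenSites x y = A at hA ⊢
  generalize pyramid x = p at hx hi
  generalize pyramid y = p' at hy hi ⊢
  rcases Nat.even_or_odd' u with ⟨v, rfl | rfl⟩
  · have e1 : 2 * v % 2 = 0 := by omega
    have e2 : 2 * v / 2 = v := by omega
    have e3 : (2 * v + 1) / 2 = v := by omega
    rw [e1, e2, e3]
    simp only [true_and, zero_ne_one, false_and, or_false]
    rcases hA with ⟨ha, hA⟩ | ⟨ha, hA⟩ <;> rcases hB with ⟨hb, hB⟩ | ⟨hb, hB⟩ <;>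
    rcases hx with ⟨hx, hp⟩ | ⟨hx, hp⟩ <;> rcases hy with ⟨hy, hp'⟩ | ⟨hy, hp'⟩ <;>
    first
    | (exfalso; omega)
    | (rcases le_total p i with h1 | h1 <;> rcases le_total p' i with h2 | h2 <;>
        rcases le_total B v with h3 | h3 <;> first | (exfalso; omega) | omega)
  · have e1 : (2 * v + 1) % 2 = 1 := by omega
    have e2 : (2 * v + 1) / 2 = v := by omega
    have e3 : (2 * v + 1 + 1) / 2 = v + 1 := by omega
    rw [e1, e2, e3]
    simp only [true_and, one_ne_zero, false_and, false_or]
    rcases hA with ⟨ha, hA⟩ | ⟨ha, hA⟩ <;> rcases hB with ⟨hb, hB⟩ | ⟨hb, hB⟩ <;>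
    rcases hx with ⟨hx, hp⟩ | ⟨hx, hp⟩ <;> rcases hy with ⟨hy, hp'⟩ | ⟨hy, hp'⟩ <;>
    first
    | (exfalso; omega)
    | (rcases le_total p i with h1 | h1 <;> rcases le_total p' i with h2 | h2 <;>
        rcases le_total A v with h3 | h3 <;> first | (exfalso; omega) | omega)

open Classical in
/-- At most one row of a pair of pyramids gives a bead at `u (n - 1)`, with the expected colour. -/
lemma ncard_pyramid (x y : ℤ) {u : ℕ} (hu : 1 ≤ u) :
    {i : ℕ | (pyramid x - i) + (pyramid y - i) = u ∧ Odd (pyramid y - i)}.ncard =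
      (if SiteOccupied x y u ∧ SiteBlack x y u then 1 else 0) ∧
    {i : ℕ | (pyramid x - i) + (pyramid y - i) = u ∧ Even (pyramid y - i)}.ncard =
      if SiteOccupied x y u ∧ ¬ SiteBlack x y u then 1 else 0 := by
  rw [← exists_pyramid_iff x y hu]
  have h1 : ∀ i, ((pyramid x - i) + (pyramid y - i) = u ∧ Odd (pyramid y - i)) ↔
      (pyramid x - i) + (pyramid y - i) = u ∧ SiteBlack x y u := fun i => by
    rw [Nat.odd_iff]
    exact and_congr_right fun h => pyramid_odd_iff x y hu h
  have h2 : ∀ i, ((pyramid x - i) + (pyramid y - i) = u ∧ Even (pyramid y - i)) ↔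
      (pyramid x - i) + (pyramid y - i) = u ∧ ¬ SiteBlack x y u := fun i => by
    rw [← Nat.not_odd_iff_even, Nat.odd_iff]
    exact and_congr_right fun h => not_congr (pyramid_odd_iff x y hu h)
  simp only [h1, h2]
  have h3 : ∀ Q : Prop, {i : ℕ | (pyramid x - i) + (pyramid y - i) = u ∧ Q}.ncard =
      if (∃ i, (pyramid x - i) + (pyramid y - i) = u) ∧ Q then 1 else 0 := by
    intro Q
    split_ifs with h
    · obtain ⟨⟨i, hi⟩, hQ⟩ := h
      rw [Set.ncard_eq_one]
      refine ⟨i, ?_⟩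
      ext j
      simp only [Set.mem_ofPred_eq, Set.mem_singleton_iff, hQ, and_true]
      omega
    · rw [Set.ncard_eq_zero (Set.Finite.subset (Set.finite_le_nat (pyramid x + pyramid y))
        fun i hi => show i ≤ _ by have := hi.1; omega)]
      ext j
      simp only [Set.mem_ofPred_eq, Set.mem_empty_iff_false, iff_false]
      exact fun hj => h ⟨⟨j, hj.1⟩, hj.2⟩
  exact ⟨h3 _, by convert h3 (¬ SiteBlack x y u)⟩

/-- The coloured beads determine the last two coordinates. -/
lemma eq_of_sites {x y x' y' : ℤ}
    (h1 : ∀ u, 1 ≤ u → (SiteOccupied x y u ↔ SiteOccupied x' y' u))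
    (h2 : ∀ u, 1 ≤ u → SiteOccupied x y u → (SiteBlack x y u ↔ SiteBlack x' y' u)) :
    x = x' ∧ y = y' := by
  have hA : evenSites x y = evenSites x' y' := by
    have a1 := h1 (2 * (evenSites x y + 1)) (by omega)
    have a2 := h1 (2 * (evenSites x' y' + 1)) (by omega)
    have a3 : 1 ≤ evenSites x y → _ := fun h => h1 (2 * evenSites x y) (by omega)
    have a4 : 1 ≤ evenSites x' y' → _ := fun h => h1 (2 * evenSites x' y') (by omega)
    simp only [SiteOccupied] at a1 a2 a3 a4
    omega
  have hB : (x - y).natAbs = (x' - y').natAbs := by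
    have a1 := h1 (2 * (x - y).natAbs + 1) (by omega)
    have a2 := h1 (2 * (x' - y').natAbs + 1) (by omega)
    simp only [SiteOccupied] at a1 a2
    omega
  -- The parity of `x + y` is that of `x - y`; as `evenSites` is `x + y` or `-(x + y) - 1`, it
  -- determines the sign of `x + y`.
  have hσ : x + y = x' + y' := by
    simp only [evenSites] at hA
    split_ifs at hA <;> omega
  -- The outermost odd bead shows the sign of `x - y`.
  have hd : x - y = x' - y' := by
    by_cases h0 : (x - y).natAbs = 0
    · omega
    · have a1 := h2 (2 * (x - y).natAbs - 1) (by omega)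
        (by simp only [SiteOccupied]; omega)
      simp only [SiteBlack, hA, hB] at a1
      omega
  omega

lemma natAbs_bead_mod (hn : 4 ≤ n) (d : ℤ) {k : ℕ} (hk : k < n) :
    (0 ≤ d → (d * (2 * n - 2) + k).natAbs % (2 * n - 2) = k) ∧
    (d < 0 → (d * (2 * n - 2) + k).natAbs % (2 * n - 2) = if k = 0 then 0 else 2 * n - 2 - k) := by
  have hN : ((2 * n - 2 : ℕ) : ℤ) = 2 * n - 2 := by omega
  constructor
  · intro hd
    obtain ⟨i, rfl⟩ := Int.eq_ofNat_of_zero_le hd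
    have : ((i : ℤ) * (2 * n - 2) + k).natAbs = i * (2 * n - 2) + k := by
      rw [← hN]
      exact_mod_cast Int.natAbs_natCast _
    rw [this, mul_add_mod_of_lt (by omega)]
  · intro hd
    obtain ⟨i, rfl⟩ : ∃ i : ℕ, d = -(i + 1 : ℤ) := ⟨(-d - 1).toNat, by omega⟩
    have : (-(i + 1 : ℤ) * (2 * n - 2) + k).natAbs = i * (2 * n - 2) + (2 * n - 2 - k) := by
      have : -(i + 1 : ℤ) * (2 * n - 2) + k = -((i * (2 * n - 2) + (2 * n - 2 - k) : ℕ) : ℤ) := by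
        push_cast [show k ≤ 2 * n - 2 by omega, hN]
        ring
      rw [this, Int.natAbs_neg, Int.natAbs_natCast]
    rw [this]
    split_ifs with h
    · subst h
      rw [Nat.sub_zero, ← Nat.succ_mul, Nat.mul_mod_left]
    · rw [mul_add_mod_of_lt (by omega)]

/-- The beads of the residue class `k` with positive sign are on the ruler `R_k`, those with
negative sign on `R_{2n-2-k}`. -/
lemma rulerBeads_sub (hn : 4 ≤ n) (E : Fin n → Finset ℤ) (k : Fin n) (h1 : 1 ≤ (k : ℕ))
    (h2 : (k : ℕ) ≤ n - 2) :
    (rulerBeads n (beadWall n (beads n E) 0) k : ℤ) -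
      rulerBeads n (beadWall n (beads n E) 0) (2 * n - 2 - k) = charge (E k) := by
  have hD := isReduced_beads hn E
  rw [rulerBeads_beadWall hn hD h1 (by omega) (by omega),
    rulerBeads_beadWall hn hD (by omega) (by omega) (by omega), Finset.card_filter,
    Finset.card_filter]
  push_cast
  rw [← Finset.sum_sub_distrib, sum_beads hn, Finset.sum_eq_single k]
  · refine Finset.sum_congr rfl fun d _ => ?_
    obtain ⟨a1, a2⟩ := natAbs_bead_mod hn d k.2
    rw [beadSign]
    split_ifs with h
    all_goals first | rw [a1 (by omega)] at * | rw [a2 (by omega)] at *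
    all_goals first | omega | (split_ifs at * <;> omega)
  · intro j _ hj
    have hj' : (j : ℕ) ≠ k := fun h => hj (Fin.ext h)
    refine Finset.sum_eq_zero fun d _ => ?_
    obtain ⟨a1, a2⟩ := natAbs_bead_mod hn d j.2
    have := j.2
    rcases lt_or_ge d 0 with h | h
    · rw [a2 h]
      split_ifs <;> omega
    · rw [a1 h, if_neg (by omega), if_neg (by omega)]
      rfl
  · simp

lemma dvd_natAbs_bead (hn : 4 ≤ n) (d : ℤ) {k : ℕ} (hk : k < n) :
    (n - 1) ∣ (d * (2 * n - 2) + (k : ℕ) : ℤ).natAbs ↔ k = 0 ∨ k = n - 1 := by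
  rw [← Int.natCast_dvd]
  have h := (bead_div_mod hn d hk).2
  constructor
  · intro hd
    have := mod_two_mul_of_dvd hn hd
    omega
  · intro hd
    exact dvd_of_mod_two_mul hn (by omega)

lemma even_card_full (hn : 4 ≤ n) (E : Fin n → Finset ℤ) :
    Even ((beads n E).filter fun y => ¬ (n - 1) ∣ y.natAbs).card ↔
      Even (∑ k : Fin n, if 1 ≤ (k : ℕ) ∧ (k : ℕ) ≤ n - 2 then charge (E k) else 0) := by
  rw [← Int.even_coe_nat, ← Int.even_sub, Finset.card_filter, Nat.cast_sum, sum_beads hn,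
    ← Finset.sum_sub_distrib]
  refine Finset.even_sum _ fun k _ => ?_
  have hk := k.2
  have h : ∀ d : ℤ, (¬ (n - 1) ∣ (d * (2 * n - 2) + (k : ℕ)).natAbs) ↔
      1 ≤ (k : ℕ) ∧ (k : ℕ) ≤ n - 2 := by
    intro d
    rw [dvd_natAbs_bead hn d hk]
    omega
  simp only [h]
  split_ifs
  · rw [Int.even_sub, even_charge_iff]
    simp
  · simp

lemma card_half_gt (hn : 4 ≤ n) (E : Fin n → Finset ℤ) (u : ℕ) :
    ((beads n E).filter fun y => (n - 1) ∣ y.natAbs ∧ u * (n - 1) < y.natAbs).card =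
      ((E ⟨0, by omega⟩).filter fun d => u < 2 * d.natAbs).card +
        ((E ⟨n - 1, by omega⟩).filter fun d => u < (2 * d + 1).natAbs).card := by
  have e1 : ∀ d : ℤ, u * (n - 1) < (d * (2 * n - 2) + ((0 : ℕ) : ℤ)).natAbs ↔ u < 2 * d.natAbs := by
    intro d
    have : d * (2 * n - 2) + ((0 : ℕ) : ℤ) = 2 * d * (n - 1 : ℕ) := by
      push_cast [show 1 ≤ n by omega]
      ring
    rw [this, Int.natAbs_mul, Int.natAbs_natCast, Int.natAbs_mul]
    exact Nat.mul_lt_mul_right (by omega)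
  have e2 : ∀ d : ℤ, u * (n - 1) < (d * (2 * n - 2) + ((n - 1 : ℕ) : ℤ)).natAbs ↔
      u < (2 * d + 1).natAbs := by
    intro d
    have : d * (2 * n - 2) + (n - 1 : ℕ) = (2 * d + 1) * (n - 1 : ℕ) := by
      push_cast [show 1 ≤ n by omega]
      ring
    rw [this, Int.natAbs_mul, Int.natAbs_natCast]
    exact Nat.mul_lt_mul_right (by omega)
  have h0 : (⟨0, by omega⟩ : Fin n) ≠ ⟨n - 1, by omega⟩ := by
    intro h
    have := congrArg Fin.val h
    simp only at this
    omega
  rw [Finset.card_filter, sum_beads hn, Finset.card_filter, Finset.card_filter]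
  simp only [dvd_natAbs_bead hn _ (Fin.is_lt _)]
  rw [← Finset.add_sum_erase _ _ (Finset.mem_univ (⟨0, by omega⟩ : Fin n)),
    ← Finset.add_sum_erase _ _ (Finset.mem_erase.2 ⟨h0.symm, Finset.mem_univ _⟩),
    Finset.sum_eq_zero (s := (Finset.univ.erase _).erase _), add_zero]
  · simp only [e1, e2, true_or, or_true, true_and]
  · intro k hk
    rw [Finset.mem_erase, Finset.mem_erase] at hk
    refine Finset.sum_eq_zero fun d _ => if_neg fun h => ?_
    rcases h.1 with h | h
    · exact hk.2.1 (Fin.ext h)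
    · exact hk.1 (Fin.ext h)

lemma card_vacuum_even (z : ℤ) (u : ℕ) :
    ((vacuum z).filter fun d => u < 2 * d.natAbs).card =
      (if 0 < z then z - 1 else -z).toNat - u / 2 := by
  split_ifs with h
  · rw [show ((vacuum z).filter fun d => u < 2 * d.natAbs) = Finset.Ico ((u / 2 + 1 : ℕ) : ℤ) z by
      ext d
      rw [Finset.mem_filter, mem_vacuum, Finset.mem_Ico]
      omega, Int.card_Ico]
    omega
  · rw [show ((vacuum z).filter fun d => u < 2 * d.natAbs) = Finset.Ico z (-((u / 2 : ℕ) : ℤ)) by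
      ext d
      rw [Finset.mem_filter, mem_vacuum, Finset.mem_Ico]
      omega, Int.card_Ico]
    omega

lemma card_vacuum_odd (z : ℤ) (u : ℕ) :
    ((vacuum z).filter fun d => u < (2 * d + 1).natAbs).card = z.natAbs - (u + 1) / 2 := by
  rcases lt_or_ge 0 z with h | h
  · rw [show ((vacuum z).filter fun d => u < (2 * d + 1).natAbs) =
      Finset.Ico (((u + 1) / 2 : ℕ) : ℤ) z by
      ext d
      rw [Finset.mem_filter, mem_vacuum, Finset.mem_Ico]
      omega, Int.card_Ico]
    omega
  · rw [show ((vacuum z).filter fun d => u < (2 * d + 1).natAbs) =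
      Finset.Ico z (-(((u + 1) / 2 : ℕ) : ℤ)) by
      ext d
      rw [Finset.mem_filter, mem_vacuum, Finset.mem_Ico]
      omega, Int.card_Ico]
    omega

/-- The colour of a coloured bead depends on its sign, and on the parities of the number of
uncoloured beads and of the number of coloured beads at higher positions. -/
lemma isBlackSite_iff {D : Finset ℤ} {u : ℕ} (hu : 1 ≤ u)
    (h : ((u * (n - 1) : ℕ) : ℤ) ∈ D ↔ -((u * (n - 1) : ℕ) : ℤ) ∉ D) :
    IsBlackSite n D u ↔ (((u * (n - 1) : ℕ) : ℤ) ∈ D ↔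
      ((D.filter fun y => ¬ (n - 1) ∣ y.natAbs).card +
        (D.filter fun y => (n - 1) ∣ y.natAbs ∧ u * (n - 1) < y.natAbs).card) % 2 = 0) := by
  have h1 := card_full_lt D (n := n) (t := u * (n - 1)) (Dvd.intro_left _ rfl)
  rw [← h1, IsBlackSite, Nat.even_iff, beadShape, if_neg (by omega)]
  by_cases hD : ((u * (n - 1) : ℕ) : ℤ) ∈ D
  · rw [if_pos hD, if_neg (h.1 hD), decide_eq_true_eq, Nat.even_iff]
    simp only [hD, true_iff]
    omega
  · have h2 : -((u * (n - 1) : ℕ) : ℤ) ∈ D := by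
      by_contra h3
      exact hD (h.2 h3)
    rw [if_neg hD, if_pos h2, decide_eq_true_eq, Nat.odd_iff]
    simp only [hD, false_iff]
    omega

end

/-! ### The coordinates of ground walls -/

section

variable {n : ℕ}

lemma groundWall_eq (m : Fin n → ℤ) :
    groundWall m = beadWall n (beads n fun k => vacuum (chargeOf m k)) 0 := rfl

lemma toNat_eq_evenSites {b x y : ℤ} (hb : b = 0 ∨ b = 1) :
    (if 0 < b + (2 * b - 1) * (x + y) then b + (2 * b - 1) * (x + y) - 1
      else -(b + (2 * b - 1) * (x + y))).toNat = evenSites x y := by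
  rw [evenSites]
  generalize x + y = s
  rcases hb with rfl | rfl <;> split_ifs <;> omega

/-- The coloured beads of the ground wall of the image of `z` have the positions and colours that
the coordinates `z` prescribe. -/
lemma site_groundWall (hn : 4 ≤ n) (z : Fin n → ℤ) {D : Finset ℤ}
    (hD : D = beads n fun k => vacuum (chargeOf (latticeChange n z) k)) {u : ℕ} (hu : 1 ≤ u) :
    (SiteOccupied (coord z (n - 1)) (coord z n) u →
      (((u * (n - 1) : ℕ) : ℤ) ∈ D ↔ -((u * (n - 1) : ℕ) : ℤ) ∉ D) ∧
      (IsBlackSite n D u ↔ SiteBlack (coord z (n - 1)) (coord z n) u)) ∧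
    (¬ SiteOccupied (coord z (n - 1)) (coord z n) u →
      ((u * (n - 1) : ℕ) : ℤ) ∉ D ∧ -((u * (n - 1) : ℕ) : ℤ) ∉ D) := by
  obtain ⟨c0, c1, c2⟩ := chargeOf_latticeChange hn z
  have hF : ((D.filter fun y => ¬ (n - 1) ∣ y.natAbs).card : ℤ) % 2 =
      bPart (zSum z 1 (n - 2)) := by
    have h1 := even_card_full hn fun k => vacuum (chargeOf (latticeChange n z) k)
    rw [← hD] at h1
    have h2 : (∑ k : Fin n, if 1 ≤ (k : ℕ) ∧ (k : ℕ) ≤ n - 2 then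
        charge (vacuum (chargeOf (latticeChange n z) k)) else 0) = zSum z 1 (n - 2) := by
      rw [Fin.sum_univ_eq_sum_range fun k => if 1 ≤ k ∧ k ≤ n - 2 then
        charge (vacuum (chargeOf (latticeChange n z) k)) else 0, ← Finset.sum_filter, zSum]
      refine Finset.sum_congr ?_ fun k hk => ?_
      · ext k
        simp only [Finset.mem_filter, Finset.mem_range, Finset.mem_Icc]
        omega
      · rw [Finset.mem_Icc] at hk
        rw [charge_vacuum, c1 k hk.1 hk.2]
    rw [h2, Int.even_iff, Nat.even_iff] at h1
    rw [bPart]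
    omega
  have hH : (D.filter fun y => (n - 1) ∣ y.natAbs ∧ u * (n - 1) < y.natAbs).card =
      (if 0 < chargeOf (latticeChange n z) 0 then chargeOf (latticeChange n z) 0 - 1
        else -chargeOf (latticeChange n z) 0).toNat - u / 2 +
      ((chargeOf (latticeChange n z) (n - 1)).natAbs - (u + 1) / 2) := by
    rw [hD, card_half_gt hn, card_vacuum_even, card_vacuum_odd]
  have hM : (((u * (n - 1) : ℕ) : ℤ) ∈ D ↔ (u % 2 = 0 ∧
        ((u / 2 : ℕ) : ℤ) < chargeOf (latticeChange n z) 0) ∨ (u % 2 = 1 ∧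
        ((u / 2 : ℕ) : ℤ) < chargeOf (latticeChange n z) (n - 1))) ∧
      (-((u * (n - 1) : ℕ) : ℤ) ∈ D ↔ (u % 2 = 0 ∧
        chargeOf (latticeChange n z) 0 ≤ -((u / 2 : ℕ) : ℤ)) ∨ (u % 2 = 1 ∧
        chargeOf (latticeChange n z) (n - 1) ≤ -((u / 2 : ℕ) : ℤ) - 1)) := by
    rcases Nat.even_or_odd' u with ⟨v, rfl | rfl⟩
    · rw [hD, half_even_mem hn, neg_half_even_mem hn, mem_vacuum, mem_vacuum,
        show 2 * v / 2 = v by omega]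
      constructor <;> simp only [] <;> omega
    · rw [hD, half_odd_mem hn, neg_half_odd_mem hn, mem_vacuum, mem_vacuum,
        show (2 * v + 1) / 2 = v by omega]
      constructor <;> simp only [] <;> omega
  have hblack := isBlackSite_iff (n := n) (D := D) hu
  rw [hH] at hblack
  rw [hM.1, hM.2] at hblack ⊢
  rw [c0, c2] at hblack ⊢
  generalize coord z (n - 1) = x at *
  generalize coord z n = y at *
  have hA := evenSites_eq x y
  have hB : (0 ≤ x - y ∧ ((x - y).natAbs : ℤ) = x - y) ∨
    (x - y < 0 ∧ ((x - y).natAbs : ℤ) = -(x - y)) := by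
    clear hblack hM hH hF c0 c1 c2 hA
    omega
  generalize hFn : (D.filter fun y => ¬ (n - 1) ∣ y.natAbs).card = F at *
  rw [SiteOccupied, SiteBlack]
  have hb := bPart_eq (zSum z 1 (n - 2))
  rw [cPart] at *
  generalize bPart (zSum z 1 (n - 2)) = b at *
  have hu2 := Nat.mod_two_eq_zero_or_one u
  have hζ : (-(2 * b - 1) * (x - y)).natAbs = (x - y).natAbs := by
    clear hblack hM hH hF c0 c1 c2 hA hB
    rcases hb with rfl | rfl <;> omega
  rw [hζ] at hblack
  rw [toNat_eq_evenSites hb] at hblack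
  generalize (x - y).natAbs = B at *
  generalize evenSites x y = A at *
  generalize A - u / 2 + (B - (u + 1) / 2) = h at *
  clear hM hH c0 c1 c2 hζ
  -- If `b = 1`, the charges of the classes `0` and `n - 1` change sign, up to the translation by
  -- `b`, and so do the signs of the beads. The parity of the number `F` of uncoloured beads makes up
  -- for this.
  have key : ∀ P Q P' : Prop, ∀ b : ℤ, (b = 0 ∧ (P ↔ P')) ∨ (b = 1 ∧ (P ↔ ¬ P')) → (P ↔ ¬ Q) →
      (F : ℤ) % 2 = b → ((P ↔ ¬ Q) → (IsBlackSite n D u ↔ (P ↔ (F + h) % 2 = 0))) →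
      (P ↔ ¬ Q) ∧ (IsBlackSite n D u ↔ (P' ↔ h % 2 = 0)) := by
    rintro P Q P' b hP hPQ hF hbl
    refine ⟨hPQ, (hbl hPQ).trans ?_⟩
    rcases hP with ⟨rfl, hP⟩ | ⟨rfl, hP⟩
    · rw [hP, show (F + h) % 2 = 0 ↔ h % 2 = 0 by omega]
    · rw [hP, show (F + h) % 2 = 0 ↔ ¬ h % 2 = 0 by omega, not_iff_not]
  rcases hu2 with hu2 | hu2 <;>
    simp only [hu2, true_and, false_and, one_ne_zero, zero_ne_one, or_false, false_or,
      false_imp_iff, and_true, true_imp_iff] at hblack ⊢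
  · clear hB
    refine ⟨fun hocc => key _ _ _ b ?_ ?_ hF hblack, fun hocc => ?_⟩ <;> clear hblack key
    · rcases hb with rfl | rfl
      · exact Or.inl ⟨rfl, by omega⟩
      · exact Or.inr ⟨rfl, by omega⟩
    · rcases hb with rfl | rfl <;> omega
    · rcases hb with rfl | rfl <;> omega
  · clear hA
    refine ⟨fun hocc => key _ _ _ b ?_ ?_ hF hblack, fun hocc => ?_⟩ <;> clear hblack key
    · rcases hb with rfl | rfl
      · exact Or.inl ⟨rfl, by omega⟩
      · exact Or.inr ⟨rfl, by omega⟩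
    · rcases hb with rfl | rfl <;> omega
    · rcases hb with rfl | rfl <;> omega

open Classical in
lemma colouredBeads_groundWall (hn : 4 ≤ n) (z : Fin n → ℤ) {u : ℕ} (hu : 1 ≤ u) :
    blackBeads n (groundWall (latticeChange n z)) ((n - 1) * u) =
      (if SiteOccupied (coord z (n - 1)) (coord z n) u ∧ SiteBlack (coord z (n - 1)) (coord z n) u
        then 1 else 0) ∧
    whiteBeads n (groundWall (latticeChange n z)) ((n - 1) * u) =
      if SiteOccupied (coord z (n - 1)) (coord z n) u ∧ ¬ SiteBlack (coord z (n - 1)) (coord z n) u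
        then 1 else 0 := by
  have hD := isReduced_beads hn fun k => vacuum (chargeOf (latticeChange n z) k)
  obtain ⟨h1, h2⟩ := site_groundWall hn z rfl hu
  rw [groundWall_eq, blackBeads_beadWall hn hD hu, whiteBeads_beadWall hn hD hu]
  by_cases hocc : SiteOccupied (coord z (n - 1)) (coord z n) u
  · obtain ⟨h3, h4⟩ := h1 hocc
    simp only [hocc, true_and, h4]
    by_cases hP : ((u * (n - 1) : ℕ) : ℤ) ∈
        beads n fun k => vacuum (chargeOf (latticeChange n z) k)
    · rw [if_pos hP, if_neg (h3.1 hP)]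
      constructor <;> rfl
    · have hQ := not_not.1 (mt h3.2 hP)
      rw [if_neg hP, if_pos hQ]
      constructor <;> rfl
  · obtain ⟨h3, h4⟩ := h2 hocc
    rw [if_neg h3, if_neg h4]
    simp [hocc]

theorem hasCoordinates_groundWall (hn : 4 ≤ n) (z z' : Fin n → ℤ) :
    HasCoordinates n (groundWall (latticeChange n z)) z' ↔ z = z' := by
  classical
  have hruler : ∀ s ∈ Finset.Icc 1 (n - 2), coord z s =
      (rulerBeads n (groundWall (latticeChange n z)) s : ℤ) -
        rulerBeads n (groundWall (latticeChange n z)) (2 * n - 2 - s) := by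
    intro s hs
    rw [Finset.mem_Icc] at hs
    have := rulerBeads_sub hn (fun k => vacuum (chargeOf (latticeChange n z) k))
      ⟨s, by omega⟩ hs.1 hs.2
    simp only at this
    rw [groundWall_eq, this, charge_vacuum, (chargeOf_latticeChange hn z).2.1 s hs.1 hs.2]
  constructor
  · rintro ⟨h1, h2⟩
    have hite : ∀ (A B : Prop) [Decidable A] [Decidable B],
        (if A then 1 else 0) = (if B then 1 else 0) → (A ↔ B) := by
      intro A B _ _ h
      by_cases hA : A <;> by_cases hB : B <;> simp [hA, hB] at h ⊢
    have hsite : ∀ u, 1 ≤ u →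
        (SiteOccupied (coord z (n - 1)) (coord z n) u ∧
          SiteBlack (coord z (n - 1)) (coord z n) u ↔
          SiteOccupied (coord z' (n - 1)) (coord z' n) u ∧
          SiteBlack (coord z' (n - 1)) (coord z' n) u) ∧
        (SiteOccupied (coord z (n - 1)) (coord z n) u ∧
          ¬ SiteBlack (coord z (n - 1)) (coord z n) u ↔
          SiteOccupied (coord z' (n - 1)) (coord z' n) u ∧
          ¬ SiteBlack (coord z' (n - 1)) (coord z' n) u) := by
      intro u hu
      obtain ⟨h3, h4⟩ := h2 u hu
      obtain ⟨h5, h6⟩ := colouredBeads_groundWall hn z hu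
      obtain ⟨h7, h8⟩ := ncard_pyramid (coord z' (n - 1)) (coord z' n) hu
      rw [h5, h7] at h3
      rw [h6, h8] at h4
      exact ⟨hite _ _ h3, hite _ _ h4⟩
    obtain ⟨e1, e2⟩ := eq_of_sites (x := coord z (n - 1)) (y := coord z n)
      (x' := coord z' (n - 1)) (y' := coord z' n)
      (fun u hu => by have := hsite u hu; tauto)
      (fun u hu hocc => by have := hsite u hu; tauto)
    refine eq_of_coord_eq fun k hk hk' => ?_
    by_cases hk2 : k ≤ n - 2
    · rw [hruler k (Finset.mem_Icc.2 ⟨hk, hk2⟩), h1 k (Finset.mem_Icc.2 ⟨hk, hk2⟩)]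
    · rcases (show k = n - 1 ∨ k = n by omega) with rfl | rfl
      · exact e1
      · exact e2
  · rintro rfl
    refine ⟨hruler, fun u hu => ?_⟩
    obtain ⟨h5, h6⟩ := colouredBeads_groundWall hn z hu
    obtain ⟨h7, h8⟩ := ncard_pyramid (coord z (n - 1)) (coord z n) hu
    exact ⟨h5.trans h7.symm, h6.trans h8.symm⟩

/-- The cores are the ground walls, parametrized by their coordinates. -/
def coreEquiv (hn : 4 ≤ n) : (Fin n → ℤ) ≃ CoreWall n :=
  Equiv.ofBijective
    (fun z => ⟨groundWall (latticeChange n z), isCore_groundWall hn _⟩) <| by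
    constructor
    · intro z z' h
      have h' : groundWall (latticeChange n z) = groundWall (latticeChange n z') :=
        congrArg Subtype.val h
      rw [← hasCoordinates_groundWall hn z z', h', hasCoordinates_groundWall hn]
    · rintro ⟨Y, hY⟩
      obtain ⟨m, rfl⟩ := eq_groundWall_of_isCore hn hY
      obtain ⟨z, rfl⟩ := (latticeChange_bijective hn).2 m
      exact ⟨z, rfl⟩

end

end DnWall

end

theorem theorem4p1 (n : ℕ) (hn : 4 ≤ n) :
    -- the coordinates `z` of cores and the change of coordinates `z ↦ m` are bijections
    (∃ Φ : DnWall.CoreWall n ≃ (Fin n → ℤ),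
      (∀ Y : DnWall.CoreWall n, ∀ z : Fin n → ℤ, DnWall.HasCoordinates n Y.1 z ↔ Φ Y = z) ∧
      Function.Bijective (DnWall.latticeChange n) ∧
      -- the multi-weight of a core
      ∀ (Y : DnWall.CoreWall n) (i : Fin (n + 1)),
        (DnWall.weight n Y.1 i : ℚ) =
          DnWall.thetaExponent n (DnWall.latticeChange n (Φ Y)) i) ∧
    -- the generating series of all Young walls
    (∃ (e : (Fin n → ℤ) → (Fin (n + 1) →₀ ℕ)) (Z Θ P : MvPowerSeries (Fin (n + 1)) ℤ),
      (∀ m i, (e m i : ℚ) = DnWall.thetaExponent n m i) ∧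
      HasSum (fun Y : DnWall.YoungWall n => MvPowerSeries.monomial (DnWall.weight n Y.1) (1 : ℤ))
        Z ∧
      HasSum (fun m : Fin n → ℤ => MvPowerSeries.monomial (e m) (1 : ℤ)) Θ ∧
      HasProd (fun k : ℕ => (1 - DnWall.qSeries n ^ (k + 1)) ^ (n + 1)) P ∧
      IsUnit P ∧ Z * P = Θ) ∧
    -- the sum of the coordinates `m`
    (∀ (z : Fin n → ℤ) (a b c : ℤ), (b = 0 ∨ b = 1) → c = 2 * b - 1 →
      ∑ i ∈ Finset.Icc 1 (n - 2), DnWall.coord z i = 2 * a - b →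
      ∑ i, DnWall.latticeChange n z i =
        -(∑ i ∈ Finset.Icc 1 (n - 2), ((n : ℤ) - 1 - i) * DnWall.coord z i)
          - ((n : ℤ) - 1) * c * (DnWall.coord z (n - 1) + DnWall.coord z n)
          - ((n : ℤ) - 1) * b) := by
  refine ⟨⟨(DnWall.coreEquiv hn).symm, fun Y z => ?_, DnWall.latticeChange_bijective hn,
    fun Y i => ?_⟩, DnWall.generating_series hn, DnWall.sum_latticeChange hn⟩
  · obtain ⟨w, rfl⟩ := (DnWall.coreEquiv hn).surjective Y
    rw [Equiv.symm_apply_apply]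
    exact DnWall.hasCoordinates_groundWall hn w z
  · obtain ⟨w, rfl⟩ := (DnWall.coreEquiv hn).surjective Y
    rw [Equiv.symm_apply_apply]
    exact DnWall.weight_groundWall hn _ i
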